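/- **Setting.** Let $(X,\mathsf d)$ be a complete separable metric space and let $\mathfrak m_n,\mathfrak m$ be nonnegative Borel measures on $X$, finite on bounded sets, such that $\mathfrak m_n\to\mathfrak m$ weakly, i.e. $\int v\,d\mathfrak m_n\to\int v\,d\mathfrak m$ for all bounded continuous $v$ with bounded support. $\mathrm{Lip}_b(X)$ (resp. $\mathrm{Lip}_{bs}(X)$) denotes the bounded Lipschitz functions (resp. those with bounded support), $\mathrm{Lip}_a f(x)=\inf_{r>0}\mathrm{Lip}(f|_{B_r(x)})$ the asymptotic Lipschitz constant, and $$\mathsf{Ch}(f)=\inf\Big\{\liminf_k \tfrac12\int \mathrm{Lip}_a^2(f_k)\,d\mathfrak m:\ f_k\in \mathrm{Lip}_b(X)\cap L^2(\mathfrak m),\ \|f_k-f\|_{L^2(\mathfrak m)}\to0\Big\}$$ the Cheeger energy on $L^2(X,\mathfrak m)$. $H^{1,2}(X,\mathsf d,\mathfrak m)=\{\mathsf{Ch}<\infty\}$ is normed by $\|f\|^2=\|f\|_{L^2}^2+2\mathsf{Ch}(f)$. For $f\in H^{1,2}(X,\mathsf d,\mathfrak m)$, the minimal relaxed slope $|Df|$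 is the element of least $L^2$ norm among all $L^2$ functions that are $\mathfrak m$-a.e. larger than some weak $L^2$ limit of $\mathrm{Lip}_a(f_k)$ with $f_k\in\mathrm{Lip}_b(X)\cap L^2(\mathfrak m)$, $f_k\to f$ in $L^2$; by locality it is extended to $f\in \mathrm{Lip}_b(X)$, setting $|Df|=|D\varphi|$ on a ball if $\varphi\in\mathrm{Lip}_{bs}(X)$ coincides with $f$ on that ball. A *derivation* on $(X,\mathsf d,\mathfrak m)$ is a linear map $\boldsymbol b:\mathrm{Lip}_b(X)\to L^0(X,\mathfrak m)$ such that, for some $\mathfrak m$-measurable $h:X\to[0,\infty)$, $|\boldsymbol b(f)|\le h|Df|$ $\mathfrak m$-a.e. for all $f\in \mathrm{Lip}_b(X)$; the $\mathfrak m$-a.e. least such $h$ is $|\boldsymbol b|$, and $\boldsymbol b\in\mathrm{Der}^1_{loc}(X,\mathsf d,\mathfrak m)$ means that $|\boldsymbol b|$ is $\mathfrak m$-integrable on bounded sets. Such a $\boldsymbol b$ has divergence $g=\operatorname{div}\boldsymbol b\in L^1_{loc}(X,\mathfrak m)$ if $-\int \boldsymbol b(f)\,d\mathfrak m=\int fg\,d\mathfrak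 m$ for all $f\in \mathrm{Lip}_{bs}(X)$. Fix $T>0$ and let $(\boldsymbol b_{n,t})_{t\in(0,T)}\subset\mathrm{Der}^1_{loc}(X,\mathsf d,\mathfrak m_n)$ and $(\boldsymbol b_t)_{t\in(0,T)}\subset\mathrm{Der}^1_{loc}(X,\mathsf d,\mathfrak m)$ be Borel time-dependent derivations, i.e. for each $f\in\mathrm{Lip}_b(X)$ the maps $(t,x)\mapsto\boldsymbol b_{n,t}(f)(x)$ and $(t,x)\mapsto\boldsymbol b_t(f)(x)$ have jointly Borel representatives. Let $\mathrm{ev}_t(\gamma)=\gamma(t)$, and let $AC([0,T];X)$ be the set of curves $\gamma\in C([0,T];X)$ for which there is a nonnegative $g\in L^1(0,T)$ with $\mathsf d(\gamma(s),\gamma(t))\le\int_s^tg(r)\,dr$ for all $s\le t$ in $[0,T]$. A Borel probability measure $\boldsymbol\pi$ on $C([0,T];X)$ is a *regular generalized flow relative to $\boldsymbol b_t$* (on $(X,\mathsf d,\mathfrak m)$) if * for some constant $C=C(\boldsymbol\pi,\mathfrak m)<\infty$ one has $(\mathrm{ev}_t)_\#\boldsymbol\pi\le C\mathfrak m$ for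 all $t\in[0,T]$; * $\boldsymbol\pi$ is concentrated on $AC([0,T];X)$ and, for all $f\in\mathrm{Lip}_{bs}(X)$, $\frac{d}{dt}f(\gamma(t))=\boldsymbol b_t(f)(\gamma(t))$ for $\mathscr L^1\times\boldsymbol\pi$-a.e. $(t,\gamma)\in(0,T)\times C([0,T];X)$ (by the first condition, this does not depend on the chosen representative of $\boldsymbol b_t(f)$). **Proposition (Closure theorem).** Let $\boldsymbol\pi_n$ be regular generalized flows relative to $\boldsymbol b_{n,t}$ on $(X,\mathsf d,\mathfrak m_n)$, and assume that: 1. $\sup_n C(\boldsymbol\pi_n,\mathfrak m_n)<\infty$, and $\boldsymbol\pi_n$ weakly converge to a Borel probability measure $\boldsymbol\pi$ on $C([0,T];X)$ which is concentrated on $AC([0,T];X)$; 2. there is a class $\mathcal D\subset\mathrm{Lip}_b(X)$, dense with respect to $\mathfrak m$-flat convergence (every $f\in\mathrm{Lip}_b(X)$ is the $\mathfrak m$-a.e. limit of a sequence in $\mathcal D$ with uniformly bounded sup norms and Lipschitz constants), such that for all $f\in\mathcal D$ $$\lim_{n\to\infty}\int_0^T\!\!\int_X \boldsymbol b_{n,t}(f)\,v_n\,d\mathfrak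 m_n\,dt=\int_0^T\!\!\int_X\boldsymbol b_t(f)\,v\,d\mathfrak m\,dt$$ whenever $v_n,v\ge0$ are Borel on $(0,T)\times X$, $v_n\le C$ for some constant $C<\infty$ independent of $n$, and, for all $t\in(0,T)$, $v_n(t,\cdot)\mathfrak m_n$ and $v(t,\cdot)\mathfrak m$ are probability measures with $v_n(t,\cdot)\mathfrak m_n\to v(t,\cdot)\mathfrak m$ weakly; 3. for all $f\in\mathrm{Lip}_b(X)$, $\int_0^T\|\boldsymbol b_t(f)\|_{L^1+L^\infty(X,\mathfrak m)}\,dt<\infty$ and $\sup_n\int_0^T\|\boldsymbol b_{n,t}(f)\|_{L^1+L^\infty(X,\mathfrak m_n)}\,dt<\infty$; 4. either $H^{1,2}(X,\mathsf d,\mathfrak m)$ is reflexive, or $\boldsymbol b_t$ has divergence in $L^1_{loc}(X,\mathfrak m)$ for a.e. $t\in(0,T)$, with a Borel representative in $(t,x)$ such that $\int_0^T\int_{B_R(\bar x)}|\operatorname{div}\boldsymbol b_t|\,d\mathfrak m\,dt<\infty$ for all $\bar x\in X$ and $R>0$. Then $\boldsymbol\pi$ is a regular generalized flow relative to $\boldsymbol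 b_t$ on $(X,\mathsf d,\mathfrak m)$. -/

import Mathlib

open Set Filter Topology MeasureTheory
open scoped NNReal ENNReal BoundedContinuousFunction

namespace MetricFlow

section Lipschitz

variable {X : Type*} [MetricSpace X]

/-- `Lip_b(X)`: the vector space of bounded Lipschitz functions on `X`. -/
def LipB (X : Type*) [MetricSpace X] : Submodule ℝ (X → ℝ) where
  carrier := {f | (∃ K : ℝ≥0, LipschitzWith K f) ∧ ∃ C : ℝ, ∀ x, |f x| ≤ C}
  add_mem' := by
    rintro f g ⟨⟨K, hK⟩, C, hC⟩ ⟨⟨L, hL⟩, D, hD⟩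
    exact ⟨⟨K + L, hK.add hL⟩, C + D,
      fun x => (abs_add_le _ _).trans (add_le_add (hC x) (hD x))⟩
  zero_mem' := ⟨⟨0, LipschitzWith.const 0⟩, 0, fun x => by simp⟩
  smul_mem' := by
    rintro c f ⟨⟨K, hK⟩, C, hC⟩
    refine ⟨⟨‖c‖₊ * K, ?_⟩, |c| * C, fun x => ?_⟩
    · exact (lipschitzWith_smul c).comp hK
    · simp only [Pi.smul_apply, smul_eq_mul, abs_mul]
      exact mul_le_mul_of_nonneg_left (hC x) (abs_nonneg c)

/-- `f ∈ Lip_bs(X)`: the bounded Lipschitz function `f` has bounded support. -/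
def IsLipBS (f : LipB X) : Prop :=
  Bornology.IsBounded (Function.support (f : X → ℝ))

/-- The Lipschitz constant, in `[0, ∞]`, of the restriction of `f` to `s`. -/
noncomputable def lipConst (f : X → ℝ) (s : Set X) : ℝ≥0∞ :=
  ⨅ (K : ℝ≥0) (_ : LipschitzOnWith K f s), (K : ℝ≥0∞)

/-- The asymptotic Lipschitz constant `Lip_a f (x) = inf_{r > 0} Lip (f|_{B_r(x)})`. -/
noncomputable def asymLip (f : X → ℝ) (x : X) : ℝ≥0∞ :=
  ⨅ (r : ℝ) (_ : 0 < r), lipConst f (Metric.ball x r)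

theorem lipConst_mono (f : X → ℝ) {s t : Set X} (h : s ⊆ t) : lipConst f s ≤ lipConst f t :=
  le_iInf₂ fun K hK => iInf₂_le K (hK.mono h)

theorem lipConst_add_le (f g : X → ℝ) (s : Set X) :
    lipConst (f + g) s ≤ lipConst f s + lipConst g s := by
  simp only [lipConst]
  refine ENNReal.le_of_forall_pos_le_add fun ε hε hlt => ?_
  have hf := (ENNReal.add_lt_top.1 hlt).1
  have hg := (ENNReal.add_lt_top.1 hlt).2
  have hε2 : ((ε / 2 : ℝ≥0) : ℝ≥0∞) ≠ 0 := by
    simpa using hε.ne'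
  obtain ⟨K, hK⟩ := iInf_lt_iff.1 (ENNReal.lt_add_right hf.ne hε2)
  obtain ⟨hK, hK'⟩ := iInf_lt_iff.1 hK
  obtain ⟨L, hL⟩ := iInf_lt_iff.1 (ENNReal.lt_add_right hg.ne hε2)
  obtain ⟨hL, hL'⟩ := iInf_lt_iff.1 hL
  refine (iInf₂_le (K + L) (hK.add hL)).trans ?_
  rw [ENNReal.coe_add]
  refine (add_le_add hK'.le hL'.le).trans (le_of_eq ?_)
  rw [add_add_add_comm, ← ENNReal.coe_add, add_halves]

theorem lipConst_smul_le (c : ℝ) (f : X → ℝ) (s : Set X) :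
    lipConst (c • f) s ≤ ‖c‖ₑ * lipConst f s := by
  simp only [lipConst]
  by_cases hc : c = 0
  · subst hc
    refine (iInf₂_le (0 : ℝ≥0) ?_).trans (by simp)
    rw [zero_smul]
    exact (LipschitzWith.const (0 : ℝ)).lipschitzOnWith
  · rw [ENNReal.mul_iInf_of_ne (by simpa using hc) (by simp)]
    refine le_iInf fun K => ?_
    rw [ENNReal.mul_iInf_of_ne (by simpa using hc) (by simp)]
    refine le_iInf fun hK => ?_
    refine (iInf₂_le (‖c‖₊ * K) ((lipschitzWith_smul c).comp_lipschitzOnWith hK)).trans ?_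
    rw [ENNReal.coe_mul]
    rfl

theorem asymLip_add_le (f g : X → ℝ) (x : X) :
    asymLip (f + g) x ≤ asymLip f x + asymLip g x := by
  refine ENNReal.le_of_forall_pos_le_add fun ε hε hlt => ?_
  have hf := (ENNReal.add_lt_top.1 hlt).1
  have hg := (ENNReal.add_lt_top.1 hlt).2
  have hε2 : ((ε / 2 : ℝ≥0) : ℝ≥0∞) ≠ 0 := by
    simpa using hε.ne'
  obtain ⟨r, hr⟩ := iInf_lt_iff.1 (ENNReal.lt_add_right hf.ne hε2)
  obtain ⟨hr, hr'⟩ := iInf_lt_iff.1 hr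
  obtain ⟨s, hs⟩ := iInf_lt_iff.1 (ENNReal.lt_add_right hg.ne hε2)
  obtain ⟨hs, hs'⟩ := iInf_lt_iff.1 hs
  refine (iInf₂_le (min r s) (lt_min hr hs)).trans ((lipConst_add_le _ _ _).trans ?_)
  refine (add_le_add
    ((lipConst_mono f (Metric.ball_subset_ball (min_le_left r s))).trans hr'.le)
    ((lipConst_mono g (Metric.ball_subset_ball (min_le_right r s))).trans hs'.le)).trans
    (le_of_eq ?_)
  rw [add_add_add_comm, ← ENNReal.coe_add, add_halves]
  rfl

theorem asymLip_smul_le (c : ℝ) (f : X → ℝ) (x : X) :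
    asymLip (c • f) x ≤ ‖c‖ₑ * asymLip f x := by
  by_cases hc : c = 0
  · subst hc
    refine (iInf₂_le (1 : ℝ) one_pos).trans ((lipConst_smul_le _ _ _).trans (by simp))
  · simp only [asymLip]
    rw [ENNReal.mul_iInf_of_ne (by simpa using hc) (by simp)]
    refine le_iInf fun r => ?_
    rw [ENNReal.mul_iInf_of_ne (by simpa using hc) (by simp)]
    exact le_iInf fun hr => (iInf₂_le r hr).trans (lipConst_smul_le _ _ _)

theorem asymLip_measurable [MeasurableSpace X] [BorelSpace X] (f : X → ℝ) :
    Measurable (asymLip f) := by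
  refine UpperSemicontinuous.measurable (fun x c hc => ?_)
  obtain ⟨r, hr⟩ := iInf_lt_iff.1 hc
  obtain ⟨hr, hr'⟩ := iInf_lt_iff.1 hr
  filter_upwards [Metric.ball_mem_nhds x (half_pos hr)] with y hy
  refine lt_of_le_of_lt ((iInf₂_le (r / 2) (half_pos hr)).trans (lipConst_mono f ?_)) hr'
  refine Metric.ball_subset_ball' ?_
  have := Metric.mem_ball.1 hy
  linarith

end Lipschitz

section Sobolev

variable {X : Type*} [MetricSpace X] [MeasurableSpace X]

/-- `F n ∈ Lip_b(X) ∩ L²(X, m)` for every `n`, and `F n → f` in `L²(X, m)`. -/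
def IsLipApprox (m : Measure X) (f : X → ℝ) (F : ℕ → X → ℝ) : Prop :=
  (∀ n, F n ∈ LipB X ∧ MemLp (F n) 2 m) ∧
    Tendsto (fun n => eLpNorm (F n - f) 2 m) atTop (𝓝 0)

/-- The Cheeger energy `Ch : L²(X, m) → [0, ∞]`, the relaxation in `L²(X, m)` of the functional
`f ↦ (1/2) ∫ (Lip_a f)² dm` on `Lip_b(X) ∩ L²(X, m)`. -/
noncomputable def cheeger (m : Measure X) (f : Lp ℝ 2 m) : ℝ≥0∞ :=
  ⨅ (F : ℕ → X → ℝ) (_ : IsLipApprox m f F),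
    liminf (fun n => 2⁻¹ * ∫⁻ x, asymLip (F n) x ^ 2 ∂m) atTop

/-- `g ∈ RS(f)`: `g ∈ L²(X, m)` is larger than a weak `L²(X, m)` limit of `Lip_a (F n)`, for some
`F n ∈ Lip_b(X) ∩ L²(X, m)` with `F n → f` in `L²(X, m)`. -/
def IsRelaxedSlope (m : Measure X) (f g : X → ℝ) : Prop :=
  MemLp g 2 m ∧ ∃ (F : ℕ → X → ℝ) (g₀ : X → ℝ), IsLipApprox m f F ∧
    (∀ n, MemLp (fun x => (asymLip (F n) x).toReal) 2 m) ∧ MemLp g₀ 2 m ∧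
    (∀ ψ : X → ℝ, MemLp ψ 2 m →
      Tendsto (fun n => ∫ x, (asymLip (F n) x).toReal * ψ x ∂m) atTop
        (𝓝 (∫ x, g₀ x * ψ x ∂m))) ∧
    g₀ ≤ᵐ[m] g

/-- `G` is (a representative of) the minimal relaxed slope `|Df|`: the element of `RS(f)` with
smallest `L²(X, m)` norm. -/
def IsMinimalRelaxedSlope (m : Measure X) (f G : X → ℝ) : Prop :=
  IsRelaxedSlope m f G ∧ ∀ g, IsRelaxedSlope m f g → eLpNorm G 2 m ≤ eLpNorm g 2 m

/-- On `U`, the function `G` represents `|Df|` for `f ∈ Lip_b(X)`. Such an `f` need not belong to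
`L²(X, m)`, and `|Df|` is understood through locality: it is `|Dφ|` on `U` for any
`φ ∈ Lip_bs(X)` that coincides with `f` on `U`. -/
def IsSlopeOn (m : Measure X) (f : LipB X) (U : Set X) (G : X → ℝ) : Prop :=
  ∃ φ : LipB X, IsLipBS φ ∧ EqOn (f : X → ℝ) φ U ∧ IsMinimalRelaxedSlope m φ G

variable {m : Measure X}

theorem cheeger_le {f : Lp ℝ 2 m} {F : ℕ → X → ℝ} (hF : IsLipApprox m f F) {c : ℝ≥0∞}
    (h : ∀ n, 2⁻¹ * ∫⁻ x, asymLip (F n) x ^ 2 ∂m ≤ c) : cheeger m f ≤ c :=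
  (iInf₂_le F hF).trans <| (liminf_le_liminf (Eventually.of_forall h)).trans (by simp)

theorem exists_of_cheeger_lt {f : Lp ℝ 2 m} {c : ℝ≥0∞} (h : cheeger m f < c) :
    ∃ F, IsLipApprox m f F ∧ ∀ n, 2⁻¹ * ∫⁻ x, asymLip (F n) x ^ 2 ∂m < c := by
  obtain ⟨F, hF⟩ := iInf_lt_iff.1 h
  obtain ⟨hF, hlt⟩ := iInf_lt_iff.1 hF
  obtain ⟨φ, hφ, hφ'⟩ := extraction_of_frequently_atTop (frequently_lt_of_liminf_lt (by isBoundedDefault) hlt)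
  exact ⟨fun n => F (φ n), ⟨fun n => hF.1 (φ n), hF.2.comp hφ.tendsto_atTop⟩, hφ'⟩

variable [BorelSpace X]

theorem cheeger_smul_le (c : ℝ) (f : Lp ℝ 2 m) :
    cheeger m (c • f) ≤ ‖c‖ₑ ^ 2 * cheeger m f := by
  have key : ∀ F, IsLipApprox m f F →
      cheeger m (c • f) ≤ ‖c‖ₑ ^ 2 * liminf (fun n => 2⁻¹ * ∫⁻ x, asymLip (F n) x ^ 2 ∂m) atTop := by
    intro F hF
    have hF' : IsLipApprox m (c • f : Lp ℝ 2 m) (fun n => c • F n) := by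
      refine ⟨fun n => ⟨(LipB X).smul_mem c (hF.1 n).1, (hF.1 n).2.const_smul c⟩, ?_⟩
      have : ∀ n, eLpNorm (c • F n - ((c • f : Lp ℝ 2 m) : X → ℝ)) 2 m
          = ‖c‖ₑ * eLpNorm (F n - (f : X → ℝ)) 2 m := by
        intro n
        rw [← eLpNorm_const_smul]
        refine eLpNorm_congr_ae ?_
        filter_upwards [Lp.coeFn_smul c f] with x hx
        simp only [Pi.sub_apply, Pi.smul_apply, hx, smul_sub]
      simp only [this]
      simpa using ENNReal.Tendsto.const_mul hF.2 (Or.inr (by simp : ‖c‖ₑ ≠ ∞))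
    refine (iInf₂_le _ hF').trans ?_
    rw [← ENNReal.liminf_const_mul_of_ne_top (by simp)]
    refine liminf_le_liminf (Eventually.of_forall fun n => ?_)
    rw [mul_left_comm, ← lintegral_const_mul (‖c‖ₑ ^ 2) ((asymLip_measurable (F n)).pow_const 2)]
    refine mul_le_mul_right (lintegral_mono fun x => ?_) _
    rw [← mul_pow]
    exact pow_le_pow_left' (asymLip_smul_le c (F n) x) 2
  have h2 : ‖c‖ₑ ^ 2 ≠ ∞ := by simp
  by_cases hc : c = 0
  · have h0 : IsLipApprox m (c • f : Lp ℝ 2 m) (fun _ => 0) := by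
      refine ⟨fun n => ⟨(LipB X).zero_mem, MemLp.zero⟩, ?_⟩
      have : eLpNorm (0 - ((c • f : Lp ℝ 2 m) : X → ℝ)) 2 m = 0 := by
        rw [hc, zero_smul, zero_sub, eLpNorm_neg, eLpNorm_congr_ae (Lp.coeFn_zero ℝ 2 m)]
        simp
      simp only [this, tendsto_const_nhds]
    refine (cheeger_le h0 (c := 0) fun n => ?_).trans bot_le
    have : asymLip (0 : X → ℝ) = 0 := by
      funext x
      have := asymLip_smul_le 0 (0 : X → ℝ) x
      simpa using this
    simp [this]
  · conv_rhs => rw [cheeger]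
    rw [ENNReal.mul_iInf_of_ne (by simpa using hc) h2]
    refine le_iInf fun F => ?_
    rw [ENNReal.mul_iInf_of_ne (by simpa using hc) h2]
    exact le_iInf fun hF => key F hF

theorem cheeger_smul (c : ℝ) (f : Lp ℝ 2 m) :
    cheeger m (c • f) = ‖c‖ₑ ^ 2 * cheeger m f := by
  refine le_antisymm (cheeger_smul_le c f) ?_
  by_cases hc : c = 0
  · simp [hc]
  · have h := cheeger_smul_le c⁻¹ (c • f)
    rw [inv_smul_smul₀ hc] at h
    calc ‖c‖ₑ ^ 2 * cheeger m f ≤ ‖c‖ₑ ^ 2 * (‖c⁻¹‖ₑ ^ 2 * cheeger m (c • f)) := by gcongr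
      _ = ‖c * c⁻¹‖ₑ ^ 2 * cheeger m (c • f) := by rw [enorm_mul, mul_pow, mul_assoc]
      _ = cheeger m (c • f) := by simp [hc]

/-- Minkowski's inequality for `f ↦ (2 Ch(f))^{1/2}`. -/
theorem cheeger_add_le (f g : Lp ℝ 2 m) :
    (2 * cheeger m (f + g)) ^ (1 / 2 : ℝ)
      ≤ (2 * cheeger m f) ^ (1 / 2 : ℝ) + (2 * cheeger m g) ^ (1 / 2 : ℝ) := by
  have two : (2 : ℝ≥0∞) * 2⁻¹ = 1 := ENNReal.mul_inv_cancel (by simp) (by simp)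
  have two' : (2⁻¹ : ℝ≥0∞) * 2 = 1 := ENNReal.inv_mul_cancel (by simp) (by simp)
  have sq : ∀ a : ℝ≥0∞, (a ^ 2) ^ (1 / 2 : ℝ) = a := fun a => by
    rw [← ENNReal.rpow_natCast, ← ENNReal.rpow_mul]; norm_num
  have sq' : ∀ a : ℝ≥0∞, (a ^ (1 / 2 : ℝ)) ^ 2 = a := fun a => by
    rw [← ENNReal.rpow_natCast, ← ENNReal.rpow_mul]; norm_num
  have ex : ∀ (u : Lp ℝ 2 m) (a : ℝ≥0∞), (2 * cheeger m u) ^ (1 / 2 : ℝ) < a →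
      ∃ F, IsLipApprox m u F ∧ ∀ n, (∫⁻ x, asymLip (F n) x ^ 2 ∂m) ^ (1 / 2 : ℝ) ≤ a := by
    intro u a ha
    have h1 : 2 * cheeger m u < a ^ 2 := by
      have := ENNReal.pow_lt_pow_left (n := 2) (by norm_num) ha
      rwa [sq'] at this
    have h2 : cheeger m u < 2⁻¹ * a ^ 2 := by
      have := ENNReal.mul_lt_mul_right (a := (2⁻¹ : ℝ≥0∞)) (by simp) (by simp) h1
      rwa [← mul_assoc, two', one_mul] at this
    obtain ⟨F, hF, hlt⟩ := exists_of_cheeger_lt h2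
    refine ⟨F, hF, fun n => ?_⟩
    have h3 : ∫⁻ x, asymLip (F n) x ^ 2 ∂m ≤ a ^ 2 := by
      have := mul_le_mul_right (hlt n).le (2 : ℝ≥0∞)
      rwa [← mul_assoc, two, one_mul, ← mul_assoc, two, one_mul] at this
    calc _ ≤ (a ^ 2) ^ (1 / 2 : ℝ) := by gcongr
      _ = a := sq a
  refine ENNReal.le_of_forall_pos_le_add fun ε hε hlt => ?_
  have hf := (ENNReal.add_lt_top.1 hlt).1
  have hg := (ENNReal.add_lt_top.1 hlt).2
  have hε2 : ((ε / 2 : ℝ≥0) : ℝ≥0∞) ≠ 0 := by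
    simpa using hε.ne'
  obtain ⟨F, hF, hFa⟩ := ex f _ (ENNReal.lt_add_right hf.ne hε2)
  obtain ⟨G, hG, hGa⟩ := ex g _ (ENNReal.lt_add_right hg.ne hε2)
  have hFG : IsLipApprox m (f + g : Lp ℝ 2 m) (fun n => F n + G n) := by
    refine ⟨fun n => ⟨(LipB X).add_mem (hF.1 n).1 (hG.1 n).1, (hF.1 n).2.add (hG.1 n).2⟩, ?_⟩
    have hb : ∀ n, eLpNorm (F n + G n - ((f + g : Lp ℝ 2 m) : X → ℝ)) 2 m
        ≤ eLpNorm (F n - (f : X → ℝ)) 2 m + eLpNorm (G n - (g : X → ℝ)) 2 m := by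
      intro n
      have : F n + G n - ((f + g : Lp ℝ 2 m) : X → ℝ)
          =ᵐ[m] (F n - (f : X → ℝ)) + (G n - (g : X → ℝ)) := by
        filter_upwards [Lp.coeFn_add f g] with x hx
        simp only [Pi.sub_apply, Pi.add_apply, hx]
        ring
      rw [eLpNorm_congr_ae this]
      exact eLpNorm_add_le ((hF.1 n).2.1.sub (Lp.aestronglyMeasurable f))
        ((hG.1 n).2.1.sub (Lp.aestronglyMeasurable g)) (by norm_num)
    refine tendsto_of_tendsto_of_tendsto_of_le_of_le tendsto_const_nhds ?_ (fun _ => bot_le) hb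
    simpa using hF.2.add hG.2
  set A := (2 * cheeger m f) ^ (1 / 2 : ℝ) with hA
  set B := (2 * cheeger m g) ^ (1 / 2 : ℝ) with hB
  have hsum : (A + ((ε / 2 : ℝ≥0) : ℝ≥0∞)) + (B + ((ε / 2 : ℝ≥0) : ℝ≥0∞)) = A + B + ε := by
    rw [add_add_add_comm, ← ENNReal.coe_add, add_halves]
  have hn : ∀ n, (∫⁻ x, asymLip (F n + G n) x ^ 2 ∂m) ^ (1 / 2 : ℝ) ≤ A + B + ε := by
    intro n
    rw [← hsum]
    refine le_trans ?_ (add_le_add (hFa n) (hGa n))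
    have h := ENNReal.lintegral_Lp_add_le (μ := m) (p := 2)
      (asymLip_measurable (F n)).aemeasurable (asymLip_measurable (G n)).aemeasurable (by norm_num)
    simp only [ENNReal.rpow_ofNat] at h
    refine le_trans ?_ h
    gcongr with x
    exact asymLip_add_le (F n) (G n) x
  have hch : cheeger m (f + g) ≤ 2⁻¹ * (A + B + ε) ^ 2 := by
    refine cheeger_le hFG fun n => ?_
    gcongr
    calc _ = ((∫⁻ x, asymLip (F n + G n) x ^ 2 ∂m) ^ (1 / 2 : ℝ)) ^ 2 := (sq' _).symm
      _ ≤ _ := by gcongr; exact hn n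
  calc (2 * cheeger m (f + g)) ^ (1 / 2 : ℝ)
      ≤ (2 * (2⁻¹ * (A + B + ε) ^ 2)) ^ (1 / 2 : ℝ) := by gcongr
    _ = A + B + ε := by rw [← mul_assoc, two, one_mul, sq]

theorem cheeger_add_lt_top {f g : Lp ℝ 2 m} (hf : cheeger m f < ∞) (hg : cheeger m g < ∞) :
    cheeger m (f + g) < ∞ := by
  have h1 : (2 * cheeger m f) ^ (1 / 2 : ℝ) < ∞ :=
    ENNReal.rpow_lt_top_of_nonneg (by norm_num) (ENNReal.mul_lt_top (by simp) hf).ne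
  have h2 : (2 * cheeger m g) ^ (1 / 2 : ℝ) < ∞ :=
    ENNReal.rpow_lt_top_of_nonneg (by norm_num) (ENNReal.mul_lt_top (by simp) hg).ne
  have h3 := (cheeger_add_le f g).trans_lt (ENNReal.add_lt_top.2 ⟨h1, h2⟩)
  by_contra h
  rw [not_lt, top_le_iff] at h
  rw [h] at h3
  simp [ENNReal.mul_top] at h3

/-- The finiteness domain of `Ch`, as a vector subspace of `L²(X, m)`. -/
noncomputable def cheegerDomain (m : Measure X) : Submodule ℝ (Lp ℝ 2 m) where
  carrier := {f | cheeger m f < ∞}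
  add_mem' := fun hf hg => cheeger_add_lt_top hf hg
  zero_mem' := by
    have h := cheeger_smul (m := m) 0 0
    rw [smul_zero] at h
    have h0 : cheeger m 0 = 0 := by rw [h]; simp
    exact h0.trans_lt ENNReal.zero_lt_top
  smul_mem' := fun c f hf => by
    have h : cheeger m (c • f) < ∞ := by
      rw [cheeger_smul]
      exact ENNReal.mul_lt_top (by simp) hf
    exact h

/-- The Sobolev space `H^{1,2}(X, d, m)`, the finiteness domain of `Ch`; it is a type of its own
because its norm is not the one of `L²(X, m)`. -/
def SobolevH12 (m : Measure X) : Type _ := ↥(cheegerDomain m)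

noncomputable instance (m : Measure X) : AddCommGroup (SobolevH12 m) :=
  inferInstanceAs (AddCommGroup ↥(cheegerDomain m))

noncomputable instance (m : Measure X) : Module ℝ (SobolevH12 m) :=
  inferInstanceAs (Module ℝ ↥(cheegerDomain m))

/-- The `L²(X, m)` function underlying an element of `H^{1,2}(X, d, m)`. -/
def SobolevH12.toLp (f : SobolevH12 m) : Lp ℝ 2 m := Subtype.val f

/-- The norm of `H^{1,2}(X, d, m)`: `‖f‖² = ‖f‖²_{L²} + 2 Ch(f)`. -/
noncomputable instance (m : Measure X) : Norm (SobolevH12 m) :=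
  ⟨fun f => Real.sqrt (‖f.toLp‖ ^ 2 + 2 * (cheeger m f.toLp).toReal)⟩

theorem SobolevH12.norm_def (f : SobolevH12 m) :
    ‖f‖ = Real.sqrt (‖f.toLp‖ ^ 2 + 2 * (cheeger m f.toLp).toReal) := rfl

theorem SobolevH12.norm_core (m : Measure X) : NormedSpace.Core ℝ (SobolevH12 m) where
  norm_nonneg f := Real.sqrt_nonneg _
  norm_smul c f := by
    have h1 : (c • f).toLp = c • f.toLp := rfl
    rw [norm_def, norm_def, h1, cheeger_smul, norm_smul, ENNReal.toReal_mul, ENNReal.toReal_pow,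
      toReal_enorm, ← Real.sqrt_sq (norm_nonneg c), ← Real.sqrt_mul (by positivity),
      Real.sqrt_sq (norm_nonneg c)]
    congr 1
    ring
  norm_triangle f g := by
    have h1 : (f + g).toLp = f.toLp + g.toLp := rfl
    have hf : cheeger m f.toLp < ∞ := f.2
    have hg : cheeger m g.toLp < ∞ := g.2
    have h := ENNReal.toReal_mono (ENNReal.add_lt_top.2
      ⟨ENNReal.rpow_lt_top_of_nonneg (by norm_num) (ENNReal.mul_lt_top (by simp) hf).ne,
        ENNReal.rpow_lt_top_of_nonneg (by norm_num) (ENNReal.mul_lt_top (by simp) hg).ne⟩).ne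
      (cheeger_add_le f.toLp g.toLp)
    rw [ENNReal.toReal_add
      (ENNReal.rpow_lt_top_of_nonneg (by norm_num) (ENNReal.mul_lt_top (by simp) hf).ne).ne
      (ENNReal.rpow_lt_top_of_nonneg (by norm_num) (ENNReal.mul_lt_top (by simp) hg).ne).ne] at h
    simp only [← ENNReal.toReal_rpow, ENNReal.toReal_mul, ENNReal.toReal_ofNat,
      ← Real.sqrt_eq_rpow] at h
    have hn := norm_add_le f.toLp g.toLp
    rw [norm_def, norm_def, norm_def, h1]
    have hp : ∀ u : Lp ℝ 2 m, 2 * (cheeger m u).toReal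
        = Real.sqrt (2 * (cheeger m u).toReal) ^ 2 := fun u =>
      (Real.sq_sqrt (by positivity)).symm
    rw [hp (f.toLp + g.toLp), hp f.toLp, hp g.toLp]
    set a := ‖f.toLp‖
    set b := ‖g.toLp‖
    set p := Real.sqrt (2 * (cheeger m f.toLp).toReal)
    set q := Real.sqrt (2 * (cheeger m g.toLp).toReal)
    have ha : 0 ≤ a := norm_nonneg _
    have hb : 0 ≤ b := norm_nonneg _
    have hp0 : 0 ≤ p := Real.sqrt_nonneg _
    have hq0 : 0 ≤ q := Real.sqrt_nonneg _
    have hle : ‖f.toLp + g.toLp‖ ^ 2 + Real.sqrt (2 * (cheeger m (f.toLp + g.toLp)).toReal) ^ 2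
        ≤ (a + b) ^ 2 + (p + q) ^ 2 := by gcongr
    refine (Real.sqrt_le_sqrt hle).trans ?_
    have hcs : a * b + p * q ≤ Real.sqrt (a ^ 2 + p ^ 2) * Real.sqrt (b ^ 2 + q ^ 2) := by
      rw [← Real.sqrt_mul (show 0 ≤ a ^ 2 + p ^ 2 by positivity)]
      refine Real.le_sqrt_of_sq_le ?_
      nlinarith [sq_nonneg (a * q - b * p)]
    refine Real.sqrt_le_iff.2 ⟨by positivity, ?_⟩
    have e1 := Real.sq_sqrt (show 0 ≤ a ^ 2 + p ^ 2 by positivity)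
    have e2 := Real.sq_sqrt (show 0 ≤ b ^ 2 + q ^ 2 by positivity)
    nlinarith
  norm_eq_zero_iff f := by
    constructor
    · intro h
      rw [norm_def, Real.sqrt_eq_zero (by positivity)] at h
      have h0 : 0 ≤ 2 * (cheeger m f.toLp).toReal := by positivity
      have h1 : ‖f.toLp‖ = 0 := by
        have : ‖f.toLp‖ ^ 2 = 0 := le_antisymm (by linarith) (sq_nonneg _)
        simpa using this
      exact Subtype.ext (norm_eq_zero.1 h1)
    · rintro rfl
      have h1 : (0 : SobolevH12 m).toLp = 0 := rfl
      have h := cheeger_smul (m := m) 0 0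
      rw [smul_zero] at h
      rw [norm_def, h1, h]
      simp

noncomputable instance (m : Measure X) : NormedAddCommGroup (SobolevH12 m) :=
  NormedAddCommGroup.ofCore (SobolevH12.norm_core m)

noncomputable instance (m : Measure X) : NormedSpace ℝ (SobolevH12 m) :=
  NormedSpace.ofCore (SobolevH12.norm_core m)

/-- `H^{1,2}(X, d, m)` is reflexive: the canonical map into its bidual is onto. -/
def IsReflexiveH12 (m : Measure X) : Prop :=
  Function.Surjective (NormedSpace.inclusionInDoubleDual ℝ (SobolevH12 m))

end Sobolev

section Derivations

variable {X : Type*} [MetricSpace X] [MeasurableSpace X]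

/-- `h ∈ L¹_loc(X, m)`: integrability on bounded sets. -/
def L1Loc (m : Measure X) (h : X → ℝ) : Prop :=
  ∀ (x : X) (R : ℝ), IntegrableOn h (Metric.ball x R) m

/-- `h ≥ 0` is measurable and `|L(f)| ≤ h |Df|` `m`-a.e. in `X`, for all `f ∈ Lip_b(X)`. -/
def IsLocalityBound (m : Measure X) (L : LipB X →ₗ[ℝ] (X →ₘ[m] ℝ)) (h : X → ℝ) : Prop :=
  Measurable h ∧ (∀ x, 0 ≤ h x) ∧
    ∀ (f : LipB X) (x₀ : X) (R : ℝ) (G : X → ℝ), IsSlopeOn m f (Metric.ball x₀ R) G →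
      ∀ᵐ x ∂m, x ∈ Metric.ball x₀ R → |L f x| ≤ h x * G x

/-- Derivations on `(X, d, m)`: linear functionals `Lip_b(X) → L⁰(X, m)` with the quantitative
locality property. -/
structure Der (m : Measure X) where
  toLin : LipB X →ₗ[ℝ] (X →ₘ[m] ℝ)
  locality : ∃ h : X → ℝ, IsLocalityBound m toLin h

/-- `h` is (a representative of) the local norm `|b|`, the `m`-a.e. smallest function in the
locality inequality. -/
def Der.IsLocalNorm {m : Measure X} (b : Der m) (h : X → ℝ) : Prop :=
  IsLocalityBound m b.toLin h ∧ ∀ h', IsLocalityBound m b.toLin h' → h ≤ᵐ[m] h'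

/-- `b ∈ Der¹_loc(X, d, m)`: the local norm of `b` is in `L¹_loc(X, m)`. -/
def Der.IsL1Loc {m : Measure X} (b : Der m) : Prop :=
  ∃ h, b.IsLocalNorm h ∧ L1Loc m h

/-- `g ∈ L¹_loc(X, m)` is the divergence of `b`. -/
def Der.IsDivergence {m : Measure X} (b : Der m) (g : X → ℝ) : Prop :=
  L1Loc m g ∧ ∀ f : LipB X, IsLipBS f →
    -∫ x, b.toLin f x ∂m = ∫ x, (f : X → ℝ) x * g x ∂m

/-- The norm of `L¹(X, m) + L^∞(X, m)`, in `[0, ∞]`. -/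
noncomputable def l1PlusLinfNorm (m : Measure X) (u : X →ₘ[m] ℝ) : ℝ≥0∞ :=
  ⨅ (p : X →ₘ[m] ℝ) (q : X →ₘ[m] ℝ) (_ : p + q = u), eLpNorm p 1 m + eLpNorm q ∞ m

/-- `B` is a Borel representative on `(0,T) × X` of `(t, x) ↦ b_t(f)(x)`. -/
def IsBorelRep (T : ℝ) {m : Measure X} (b : ℝ → Der m) (f : LipB X) (B : ℝ → X → ℝ) : Prop :=
  Measurable (Function.uncurry B) ∧
    ∀ᵐ t ∂(volume.restrict (Ioo 0 T)), B t =ᵐ[m] (b t).toLin f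

/-- `(b_t)`, `t ∈ (0,T)`, is a Borel time-dependent family of derivations in `Der¹_loc(X, d, m)`.
Values of `b` outside `(0,T)` play no role. -/
def IsBorelFamily (T : ℝ) {m : Measure X} (b : ℝ → Der m) : Prop :=
  (∀ᵐ t ∂(volume.restrict (Ioo 0 T)), (b t).IsL1Loc) ∧ ∀ f : LipB X, ∃ B, IsBorelRep T b f B

/-- `f_k → f` in the `m`-flat sense. -/
def FlatTendsto (m : Measure X) (F : ℕ → LipB X) (f : LipB X) : Prop :=
  (∃ C : ℝ≥0, ∀ k, LipschitzWith C (F k : X → ℝ) ∧ ∀ x, |(F k : X → ℝ) x| ≤ C) ∧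
    ∀ᵐ x ∂m, Tendsto (fun k => (F k : X → ℝ) x) atTop (𝓝 ((f : X → ℝ) x))

/-- `m` is finite on bounded sets. -/
def FiniteOnBounded (m : Measure X) : Prop :=
  ∀ s : Set X, Bornology.IsBounded s → m s < ∞

/-- Weak convergence of measures that are finite on bounded sets, in duality with bounded
continuous functions with bounded support. -/
def WeakTendsto (μ : ℕ → Measure X) (μ₀ : Measure X) : Prop :=
  ∀ v : X →ᵇ ℝ, Bornology.IsBounded (Function.support v) →
    Tendsto (fun n => ∫ x, v x ∂(μ n)) atTop (𝓝 (∫ x, v x ∂μ₀))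

end Derivations

section Flows

variable {X : Type*} [MetricSpace X]

instance (T : ℝ) : MeasurableSpace C(Icc (0 : ℝ) T, X) := borel _

instance (T : ℝ) : BorelSpace C(Icc (0 : ℝ) T, X) := ⟨rfl⟩

/-- `γ ∈ AC([0,T]; X)`. -/
def IsAC {T : ℝ} (γ : C(Icc (0 : ℝ) T, X)) : Prop :=
  ∃ g : ℝ → ℝ, (∀ t, 0 ≤ g t) ∧ IntegrableOn g (Icc 0 T) ∧
    ∀ s t : Icc (0 : ℝ) T, s ≤ t → dist (γ s) (γ t) ≤ ∫ r in (s : ℝ)..t, g r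

variable [MeasurableSpace X]

/-- `(ev_t)_# π ≤ C m` for all `t ∈ [0,T]`. -/
def CompressionLE {T : ℝ} (m : Measure X) (π : ProbabilityMeasure C(Icc (0 : ℝ) T, X))
    (C : ℝ≥0) : Prop :=
  ∀ t : Icc (0 : ℝ) T,
    (π : Measure C(Icc (0 : ℝ) T, X)).map (fun γ => γ t) ≤ (C : ℝ≥0∞) • m

/-- `π` is a regular generalized flow relative to `b_t`. In the last condition `IccExtend` only
makes `γ` a function on `ℝ`; the derivative is taken at interior times. -/
structure IsRegularGeneralizedFlow {T : ℝ} (hT : 0 ≤ T) {m : Measure X} (b : ℝ → Der m)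
    (π : ProbabilityMeasure C(Icc (0 : ℝ) T, X)) : Prop where
  compression : ∃ C : ℝ≥0, CompressionLE m π C
  ac : ∀ᵐ γ ∂(π : Measure C(Icc (0 : ℝ) T, X)), IsAC γ
  ode : ∀ f : LipB X, IsLipBS f → ∀ B, IsBorelRep T b f B →
    ∀ᵐ p ∂((volume.restrict (Ioo 0 T)).prod (π : Measure C(Icc (0 : ℝ) T, X))),
      HasDerivAt (fun s => (f : X → ℝ) (IccExtend hT p.2 s)) (B p.1 (IccExtend hT p.2 p.1)) p.1

end Flows

end MetricFlow

set_option linter.unusedSectionVars false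

/-! The compression bound passes to the weak limit, so the substance lies in the differential
equation. Along `πn` it holds in integrated form between times `s` and `t`, and the convergence
hypothesis must carry it to the limit. That hypothesis only admits densities that are probabilities
at every time; it controls time integrals over all of `(0,T)` and cannot be localized in time
directly. Instead, take a bounded continuous `θ ≥ 1` on curves and the weight equal to `θ / ∫ θ`
during `(s,t)` and to `1` at other times. Subtracting the limit for the constant weight `1` leaves
the interval `(s,t)` alone and shows that the defect `f(γ t) - f(γ s) - ∫ b_r(f)(γ r) dr` is
uncorrelated with every such `θ` under `π`. Hence it is almost surely constant
(`ConvergesAgainstDensities.ae_defect_eq`), and for `f ∈ D` the derivative of `f` along almost every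
curve is `b_r(f)` plus a function `a r` of time alone (`HasDeterministicDefect`).

This weaker property extends from `D` to all of `Lip_b`. Along a flat limit `F k → f` one can expect
only weak convergence of `b_t(F k)`, but Mazur's lemma gives convex combinations of the tails along
which `b_t` converges almost everywhere on a ball (`flatConvexClosed`). If `H^{1,2}` is reflexive,
cutoffs of these combinations converge strongly in `H^{1,2}`, and the locality bound `|b(u)| ≤ h
|Du|` transfers this to `b`. If there is a divergence, the Leibniz rule moves the derivation from `F
k` onto the test function; this gives weak convergence in an `L²` space over space-time. The
functions `a` of the approximations need not converge, but they cancel when two curves are compared.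

Once it is deterministic for all Lipschitz functions, the defect vanishes
(`ae_hasDerivAt_of_hasDeterministicDefect`). If two curves occupy different points at time `r`, a
cutoff of `f` that equals `f` near one point and `0` near the other has a defect equal both to `a r`
and to `0`. Otherwise the law at time `r` is a Dirac mass, and its point is an atom of `m` by
bounded compression. There `b_r(f) = 0`, because `f` is a flat limit of functions constant near the
point, and the derivative along a curve is zero at almost every time spent at a given point.

The calculus of derivations rests on `exists_minimalRelaxedSlope`: the minimal relaxed slope of a
Lipschitz function with finite energy exists and is at most `Lip_a`. This makes the bound in the
definition of a derivation effective, and yields locality on open sets and the Leibniz rule. -/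

namespace MetricFlow

/-! ### Calculus of the asymptotic Lipschitz constant; Lipschitz cutoffs -/

section AsymptoticLipschitz

variable {X : Type*} [MetricSpace X]

theorem asymLip_le_of_lipschitzOnWith {f : X → ℝ} {x : X} {r : ℝ} (hr : 0 < r) {K : ℝ≥0}
    (h : LipschitzOnWith K f (Metric.ball x r)) : asymLip f x ≤ K :=
  (iInf₂_le r hr).trans (iInf₂_le K h)

theorem asymLip_le_of_lipschitzWith {f : X → ℝ} {K : ℝ≥0} (h : LipschitzWith K f) (x : X) :
    asymLip f x ≤ K :=
  asymLip_le_of_lipschitzOnWith one_pos h.lipschitzOnWith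

theorem exists_lipschitzOnWith_of_asymLip_lt {f : X → ℝ} {x : X} {a : ℝ≥0∞}
    (h : asymLip f x < a) :
    ∃ r > 0, ∃ K : ℝ≥0, (K : ℝ≥0∞) < a ∧ LipschitzOnWith K f (Metric.ball x r) := by
  obtain ⟨r, h⟩ := iInf_lt_iff.1 h
  obtain ⟨hr, h⟩ := iInf_lt_iff.1 h
  obtain ⟨K, h⟩ := iInf_lt_iff.1 h
  obtain ⟨hK, h⟩ := iInf_lt_iff.1 h
  exact ⟨r, hr, K, h, hK⟩

theorem asymLip_le_of_eventuallyEq {f g : X → ℝ} {x : X} (h : f =ᶠ[𝓝 x] g) :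
    asymLip f x ≤ asymLip g x := by
  refine le_of_forall_gt fun a ha => ?_
  obtain ⟨r, hr, K, hKa, hK⟩ := exists_lipschitzOnWith_of_asymLip_lt ha
  obtain ⟨s, hs, hfg⟩ := Metric.eventually_nhds_iff_ball.1 h
  refine lt_of_le_of_lt (asymLip_le_of_lipschitzOnWith (lt_min hr hs) (K := K) ?_) hKa
  intro y hy z hz
  rw [hfg y (Metric.ball_subset_ball (min_le_right _ _) hy),
    hfg z (Metric.ball_subset_ball (min_le_right _ _) hz)]
  exact hK (Metric.ball_subset_ball (min_le_left _ _) hy)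
    (Metric.ball_subset_ball (min_le_left _ _) hz)

theorem asymLip_congr {f g : X → ℝ} {x : X} (h : f =ᶠ[𝓝 x] g) : asymLip f x = asymLip g x :=
  le_antisymm (asymLip_le_of_eventuallyEq h) (asymLip_le_of_eventuallyEq h.symm)

theorem asymLip_const (c : ℝ) (x : X) : asymLip (fun _ => c) x = 0 :=
  le_antisymm (by simpa using asymLip_le_of_lipschitzWith (LipschitzWith.const c) x) bot_le

theorem asymLip_add_const (f : X → ℝ) (c : ℝ) (x : X) :
    asymLip (fun y => f y + c) x ≤ asymLip f x := by
  simpa [asymLip_const, Pi.add_def] using asymLip_add_le f (fun _ => c) x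

theorem asymLip_sub_const (f : X → ℝ) (c : ℝ) (x : X) :
    asymLip (fun y => f y - c) x ≤ asymLip f x := by
  simpa only [sub_eq_add_neg] using asymLip_add_const f (-c) x

/-- The Leibniz inequality for the asymptotic Lipschitz constant. -/
theorem asymLip_mul_le {f g : X → ℝ} {x : X} (hf : asymLip f x ≠ ∞) (hg : asymLip g x ≠ ∞) :
    asymLip (fun y => f y * g y) x ≤ ‖f x‖ₑ * asymLip g x + ‖g x‖ₑ * asymLip f x := by
  lift asymLip f x to ℝ≥0 using hf with a ha
  lift asymLip g x to ℝ≥0 using hg with b hb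
  -- On a small ball the Lipschitz constants and the values of `f` and `g` exceed those at `x` by at
  -- most `ε`; the resulting bound is continuous in `ε` at `0`.
  have key : ∀ ε : ℝ≥0, 0 < ε → asymLip (fun y => f y * g y) x
      ≤ (((‖f x‖₊ + ε) * (b + ε) + (‖g x‖₊ + ε) * (a + ε) : ℝ≥0) : ℝ≥0∞) := by
    intro ε hε
    have h1 : asymLip f x < ((a + ε : ℝ≥0) : ℝ≥0∞) := by
      rw [← ha]; exact_mod_cast lt_add_of_pos_right a hε
    have h2 : asymLip g x < ((b + ε : ℝ≥0) : ℝ≥0∞) := by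
      rw [← hb]; exact_mod_cast lt_add_of_pos_right b hε
    obtain ⟨r, hr, K, hK, hfK⟩ := exists_lipschitzOnWith_of_asymLip_lt h1
    obtain ⟨s, hs, L, hL, hgL⟩ := exists_lipschitzOnWith_of_asymLip_lt h2
    have cf := (hfK.continuousOn.continuousAt (Metric.ball_mem_nhds x hr)).nnnorm.eventually
      (gt_mem_nhds (lt_add_of_pos_right ‖f x‖₊ hε))
    have cg := (hgL.continuousOn.continuousAt (Metric.ball_mem_nhds x hs)).nnnorm.eventually
      (gt_mem_nhds (lt_add_of_pos_right ‖g x‖₊ hε))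
    obtain ⟨t, ht, hbd⟩ := Metric.eventually_nhds_iff_ball.1 (cf.and cg)
    have hmin : 0 < min t (min r s) := lt_min ht (lt_min hr hs)
    refine asymLip_le_of_lipschitzOnWith hmin (LipschitzOnWith.of_dist_le_mul ?_)
    intro y hy z hz
    have sub1 : Metric.ball x (min t (min r s)) ⊆ Metric.ball x r :=
      Metric.ball_subset_ball ((min_le_right _ _).trans (min_le_left _ _))
    have sub2 : Metric.ball x (min t (min r s)) ⊆ Metric.ball x s :=
      Metric.ball_subset_ball ((min_le_right _ _).trans (min_le_right _ _))
    have sub3 : Metric.ball x (min t (min r s)) ⊆ Metric.ball x t :=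
      Metric.ball_subset_ball (min_le_left _ _)
    have e1 := hfK.dist_le_mul y (sub1 hy) z (sub1 hz)
    have e2 := hgL.dist_le_mul y (sub2 hy) z (sub2 hz)
    have b1 : |f y| ≤ ‖f x‖₊ + ε := by exact_mod_cast (hbd y (sub3 hy)).1.le
    have b2 : |g z| ≤ ‖g x‖₊ + ε := by exact_mod_cast (hbd z (sub3 hz)).2.le
    have k1 : (K : ℝ) ≤ a + ε := by exact_mod_cast hK.le
    have k2 : (L : ℝ) ≤ b + ε := by exact_mod_cast hL.le
    rw [Real.dist_eq] at e1 e2 ⊢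
    calc |f y * g y - f z * g z| = |f y * (g y - g z) + g z * (f y - f z)| := by ring_nf
      _ ≤ |f y| * |g y - g z| + |g z| * |f y - f z| := by
        rw [← abs_mul, ← abs_mul]; exact abs_add_le _ _
      _ ≤ (‖f x‖₊ + ε) * ((b + ε) * dist y z) + (‖g x‖₊ + ε) * ((a + ε) * dist y z) := by
        gcongr
        · exact e2.trans (by gcongr)
        · exact e1.trans (by gcongr)
      _ = _ := by push_cast; ring
  have hlim : Tendsto (fun ε : ℝ≥0 =>
      (((‖f x‖₊ + ε) * (b + ε) + (‖g x‖₊ + ε) * (a + ε) : ℝ≥0) : ℝ≥0∞)) (𝓝[>] 0)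
      (𝓝 (((‖f x‖₊ + 0) * (b + 0) + (‖g x‖₊ + 0) * (a + 0) : ℝ≥0) : ℝ≥0∞)) := by
    refine tendsto_nhdsWithin_of_tendsto_nhds (ENNReal.tendsto_coe.2 ?_)
    exact Continuous.tendsto (by fun_prop) 0
  have := ge_of_tendsto hlim (eventually_nhdsWithin_of_forall fun ε hε => key ε hε)
  simpa [enorm_eq_nnnorm] using this

/-- The asymptotic Lipschitz constant of a convex combination with variable coefficients. -/
theorem asymLip_interpolate_le {χ f g : X → ℝ} {x : X} (hχ : ∀ y, χ y ∈ Icc (0 : ℝ) 1)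
    (hχ' : asymLip χ x ≠ ∞) (hf : asymLip f x ≠ ∞) (hg : asymLip g x ≠ ∞) :
    asymLip (fun y => χ y * f y + (1 - χ y) * g y) x
      ≤ ENNReal.ofReal (χ x) * asymLip f x + ENNReal.ofReal (1 - χ x) * asymLip g x
        + ‖f x - g x‖ₑ * asymLip χ x := by
  have h1 : asymLip (fun y => 1 - χ y) x ≤ asymLip χ x := by
    have := asymLip_add_le (fun _ : X => (1 : ℝ)) ((-1 : ℝ) • χ) x
    have h2 := asymLip_smul_le (-1 : ℝ) χ x
    rw [asymLip_const, zero_add] at this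
    simp only [enorm_neg, enorm_one, one_mul] at h2
    refine le_trans (le_of_eq ?_) (this.trans h2)
    congr 1
    funext y
    simp [sub_eq_add_neg]
  -- Subtracting the constant `g x` from both functions makes the second one vanish at `x`, so the
  -- Lipschitz constant of `χ` is multiplied only by `|f x - g x|`.
  have hf' := asymLip_sub_const f (g x) x
  have hg' := asymLip_sub_const g (g x) x
  have e : (fun y => χ y * f y + (1 - χ y) * g y)
      = fun y => ((fun y => χ y * (f y - g x)) + fun y => (1 - χ y) * (g y - g x)) y + g x := by
    funext y
    simp only [Pi.add_apply]
    ring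
  rw [e]
  refine (asymLip_add_const _ _ _).trans ((asymLip_add_le _ _ _).trans ?_)
  have m1 := asymLip_mul_le hχ' (ne_top_of_le_ne_top hf hf')
  have m2 := asymLip_mul_le (ne_top_of_le_ne_top hχ' h1) (ne_top_of_le_ne_top hg hg')
  refine (add_le_add m1 m2).trans ?_
  rw [sub_self, enorm_zero, zero_mul, add_zero, add_right_comm]
  have c1 : ‖χ x‖ₑ = ENNReal.ofReal (χ x) := Real.enorm_of_nonneg (hχ x).1
  have c2 : ‖1 - χ x‖ₑ = ENNReal.ofReal (1 - χ x) :=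
    Real.enorm_of_nonneg (sub_nonneg.2 (hχ x).2)
  rw [c1, c2]
  gcongr

theorem asymLip_lipB_ne_top (f : LipB X) (x : X) : asymLip (f : X → ℝ) x ≠ ∞ := by
  obtain ⟨⟨K, hK⟩, -⟩ := f.2
  exact ne_top_of_le_ne_top ENNReal.coe_ne_top (asymLip_le_of_lipschitzWith hK x)

theorem continuous_lipB (f : LipB X) : Continuous (f : X → ℝ) := by
  obtain ⟨⟨K, hK⟩, -⟩ := f.2
  exact hK.continuous

theorem exists_lip_bound (f : LipB X) : ∃ L : ℝ≥0, LipschitzWith L (f : X → ℝ) ∧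
    ∀ x, |(f : X → ℝ) x| ≤ L := by
  obtain ⟨⟨K, hK⟩, C, hC⟩ := f.2
  refine ⟨max K C.toNNReal, hK.weaken (le_max_left _ _), fun x => (hC x).trans ?_⟩
  exact (Real.le_coe_toNNReal C).trans (by exact_mod_cast le_max_right _ _)

/-- Bounded Lipschitz functions form an algebra. -/
def mulLip (f g : LipB X) : LipB X :=
  ⟨fun x => (f : X → ℝ) x * (g : X → ℝ) x, by
    obtain ⟨K, hK, hC⟩ := exists_lip_bound f
    obtain ⟨L, hL, hD⟩ := exists_lip_bound g
    refine ⟨⟨K * L + L * K, LipschitzWith.of_dist_le_mul fun x y => ?_⟩, K * L, fun x => ?_⟩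
    · have e1 := hK.dist_le_mul x y
      have e2 := hL.dist_le_mul x y
      rw [Real.dist_eq] at e1 e2 ⊢
      have e : (f : X → ℝ) x * (g : X → ℝ) x - (f : X → ℝ) y * (g : X → ℝ) y
          = (f : X → ℝ) x * ((g : X → ℝ) x - (g : X → ℝ) y)
            + (g : X → ℝ) y * ((f : X → ℝ) x - (f : X → ℝ) y) := by ring
      rw [e]
      refine (abs_add_le _ _).trans ?_
      rw [abs_mul, abs_mul]
      calc _ ≤ (K : ℝ) * (L * dist x y) + L * (K * dist x y) := by
            gcongr
            · exact hC x
            · exact hD y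
        _ = _ := by push_cast; ring
    · rw [abs_mul]
      exact mul_le_mul (hC x) (hD x) (abs_nonneg _) K.2⟩

@[simp]
theorem mulLip_apply (f g : LipB X) (x : X) :
    (mulLip f g : X → ℝ) x = (f : X → ℝ) x * (g : X → ℝ) x := rfl

/-- Constants are bounded Lipschitz functions. -/
def constLip (c : ℝ) : LipB X :=
  ⟨fun _ => c, ⟨0, LipschitzWith.const c⟩, |c|, fun _ => le_rfl⟩

@[simp]
theorem constLip_apply (c : ℝ) (x : X) : ((constLip c : LipB X) : X → ℝ) x = c := rfl

theorem lipschitzWith_bump (x₀ : X) {r : ℝ} (hr : 0 < r) :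
    LipschitzWith (Real.toNNReal r⁻¹) fun x => max 0 (min 1 (2 - dist x x₀ / r)) := by
  refine LipschitzWith.const_max (LipschitzWith.const_min ?_ _) _
  refine LipschitzWith.of_dist_le_mul fun x y => ?_
  rw [Real.dist_eq, Real.coe_toNNReal _ (inv_nonneg.2 hr.le)]
  have e : 2 - dist x x₀ / r - (2 - dist y x₀ / r) = r⁻¹ * (dist y x₀ - dist x x₀) := by
    field_simp
    ring
  rw [e, abs_mul, abs_of_pos (inv_pos.2 hr), dist_comm x y]
  gcongr
  exact abs_dist_sub_le y x x₀

/-- A Lipschitz cutoff function, equal to `1` on the ball `B_r(x₀)` and to `0` outside of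
`B_{2r}(x₀)`. -/
noncomputable def bump (x₀ : X) {r : ℝ} (hr : 0 < r) : LipB X :=
  ⟨fun x => max 0 (min 1 (2 - dist x x₀ / r)), ⟨_, lipschitzWith_bump x₀ hr⟩, 1, fun x => by
    rw [abs_of_nonneg (le_max_left _ _)]
    exact max_le zero_le_one (min_le_left _ _)⟩

theorem bump_mem_Icc (x₀ : X) {r : ℝ} (hr : 0 < r) (x : X) :
    (bump x₀ hr : X → ℝ) x ∈ Icc (0 : ℝ) 1 :=
  ⟨le_max_left _ _, max_le zero_le_one (min_le_left _ _)⟩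

theorem bump_eq_one {x₀ : X} {r : ℝ} (hr : 0 < r) {x : X} (hx : dist x x₀ ≤ r) :
    (bump x₀ hr : X → ℝ) x = 1 := by
  have : dist x x₀ / r ≤ 1 := (div_le_one hr).2 hx
  change max 0 (min 1 (2 - dist x x₀ / r)) = 1
  rw [min_eq_left (by linarith), max_eq_right zero_le_one]

theorem bump_eq_zero {x₀ : X} {r : ℝ} (hr : 0 < r) {x : X} (hx : 2 * r ≤ dist x x₀) :
    (bump x₀ hr : X → ℝ) x = 0 := by
  have : 2 ≤ dist x x₀ / r := (le_div_iff₀ hr).2 hx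
  change max 0 (min 1 (2 - dist x x₀ / r)) = 0
  rw [max_eq_left]
  exact (min_le_right _ _).trans (by linarith)

theorem isLipBS_mul_bump (f : LipB X) (x₀ : X) {r : ℝ} (hr : 0 < r) :
    IsLipBS (mulLip f (bump x₀ hr)) := by
  refine Metric.isBounded_ball (x := x₀) (r := 2 * r) |>.subset fun x hx => ?_
  by_contra h
  rw [Metric.mem_ball, not_lt] at h
  exact hx (by rw [mulLip_apply, bump_eq_zero hr h, mul_zero])

end AsymptoticLipschitz

/-! ### Mazur's lemma and Lipschitz approximation of closed sets -/

section Convexity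

/-- Mazur's lemma. -/
theorem mem_closure_of_forall_dual_lt {E : Type*} [NormedAddCommGroup E] [NormedSpace ℝ E]
    {A : Set E} (hA : Convex ℝ A) {u : E}
    (h : ∀ l : StrongDual ℝ E, ∀ ε > 0, ∃ v ∈ A, l v < l u + ε) : u ∈ closure A := by
  by_contra hu
  -- Separation uses a single functional, so approximation of `u` one functional at a time is
  -- enough.
  obtain ⟨l, c, h1, h2⟩ := geometric_hahn_banach_point_closed hA.closure isClosed_closure hu
  obtain ⟨v, hv, hlt⟩ := h l (c - l u) (sub_pos.2 h1)
  have := h2 v (subset_closure hv)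
  linarith

end Convexity

section Approximation

variable {X : Type*} [MetricSpace X]

/-- Thickened indicators of a closed set are Lipschitz. Together with inner regularity by closed
sets, this lets Lipschitz test functions control arbitrary Borel sets. -/
theorem exists_lipB_tendsto_indicator {C : Set X} (hC : IsClosed C) :
    ∃ χ : ℕ → LipB X, (∀ n x, (χ n : X → ℝ) x ∈ Icc (0 : ℝ) 1) ∧
      ∀ x, Tendsto (fun n => (χ n : X → ℝ) x) atTop (𝓝 (C.indicator (fun _ => 1) x)) := by
  have hpos : ∀ n : ℕ, (0 : ℝ) < 1 / ((n : ℝ) + 1) := fun n => Nat.one_div_pos_of_nat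
  have h1 : ∀ n x, ((thickenedIndicator (hpos n) C x : ℝ≥0) : ℝ) ∈ Icc (0 : ℝ) 1 := fun n x =>
    ⟨NNReal.coe_nonneg _, by exact_mod_cast thickenedIndicator_le_one (hpos n) C x⟩
  refine ⟨fun n => ⟨fun x => (thickenedIndicator (hpos n) C x : ℝ≥0), ⟨_,
    (lipschitzWith_thickenedIndicator (hpos n) C)⟩, 1, fun x => ?_⟩, h1, fun x => ?_⟩
  · rw [abs_of_nonneg (h1 n x).1]
    exact (h1 n x).2
  · have h := thickenedIndicator_tendsto_indicator_closure hpos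
      tendsto_one_div_add_atTop_nhds_zero_nat C
    have h2 := (tendsto_pi_nhds.1 h) x
    rw [hC.closure_eq] at h2
    have h3 := NNReal.tendsto_coe.2 h2
    have e : ((C.indicator (fun _ => (1 : ℝ≥0)) x : ℝ≥0) : ℝ) = C.indicator (fun _ => (1 : ℝ)) x := by
      by_cases hx : x ∈ C <;> simp [hx]
    rwa [e] at h3

theorem FiniteOnBounded.isLocallyFinite [MeasurableSpace X] {m : Measure X} (hm : FiniteOnBounded m) :
    IsLocallyFiniteMeasure m :=
  ⟨fun x => ⟨Metric.ball x 1, Metric.ball_mem_nhds x one_pos, hm _ Metric.isBounded_ball⟩⟩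

end Approximation

section RealAsymptoticLipschitz

variable {X : Type*} [MetricSpace X]

theorem asymLip_ne_top_of_mem {f : X → ℝ} (hf : f ∈ LipB X) (x : X) : asymLip f x ≠ ∞ :=
  asymLip_lipB_ne_top ⟨f, hf⟩ x

theorem toReal_asymLip_combo_le {f g : X → ℝ} (hf : f ∈ LipB X) (hg : g ∈ LipB X) {a b : ℝ}
    (ha : 0 ≤ a) (hb : 0 ≤ b) (x : X) :
    (asymLip (a • f + b • g) x).toReal
      ≤ a * (asymLip f x).toReal + b * (asymLip g x).toReal := by
  have hf' := asymLip_ne_top_of_mem hf x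
  have hg' := asymLip_ne_top_of_mem hg x
  have h : asymLip (a • f + b • g) x
      ≤ ENNReal.ofReal a * asymLip f x + ENNReal.ofReal b * asymLip g x := by
    refine (asymLip_add_le _ _ _).trans ?_
    refine (add_le_add (asymLip_smul_le _ _ _) (asymLip_smul_le _ _ _)).trans ?_
    rw [Real.enorm_of_nonneg ha, Real.enorm_of_nonneg hb]
  have h1 : ENNReal.ofReal a * asymLip f x ≠ ∞ := ENNReal.mul_ne_top ENNReal.ofReal_ne_top hf'
  have h2 : ENNReal.ofReal b * asymLip g x ≠ ∞ := ENNReal.mul_ne_top ENNReal.ofReal_ne_top hg'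
  refine (ENNReal.toReal_mono (ENNReal.add_ne_top.2 ⟨h1, h2⟩) h).trans (le_of_eq ?_)
  rw [ENNReal.toReal_add h1 h2, ENNReal.toReal_mul, ENNReal.toReal_mul,
    ENNReal.toReal_ofReal ha, ENNReal.toReal_ofReal hb]

theorem toReal_asymLip_interpolate_le {χ f g : X → ℝ} (hχ : ∀ y, χ y ∈ Icc (0 : ℝ) 1)
    {L : ℝ≥0} (hL : LipschitzWith L χ) (hf : f ∈ LipB X) (hg : g ∈ LipB X) (x : X) :
    (asymLip (fun y => χ y * f y + (1 - χ y) * g y) x).toReal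
      ≤ χ x * (asymLip f x).toReal + (1 - χ x) * (asymLip g x).toReal + L * |f x - g x| := by
  have hf' := asymLip_ne_top_of_mem hf x
  have hg' := asymLip_ne_top_of_mem hg x
  have hLx := asymLip_le_of_lipschitzWith hL x
  have h := asymLip_interpolate_le hχ (ne_top_of_le_ne_top ENNReal.coe_ne_top hLx) hf' hg'
  have h3 : ENNReal.ofReal (χ x) * asymLip f x + ENNReal.ofReal (1 - χ x) * asymLip g x
        + ‖f x - g x‖ₑ * asymLip χ x ≤ ENNReal.ofReal
      (χ x * (asymLip f x).toReal + (1 - χ x) * (asymLip g x).toReal + L * |f x - g x|) := by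
    have c1 := (hχ x).1
    have c2 := sub_nonneg.2 (hχ x).2
    rw [ENNReal.ofReal_add (by positivity) (by positivity),
      ENNReal.ofReal_add (by positivity) (by positivity), ENNReal.ofReal_mul c1,
      ENNReal.ofReal_mul c2, ENNReal.ofReal_mul L.coe_nonneg, ENNReal.ofReal_toReal hf',
      ENNReal.ofReal_toReal hg', ← Real.enorm_eq_ofReal_abs, mul_comm (ENNReal.ofReal _) ‖_‖ₑ]
    gcongr
    exact hLx.trans (by simp [ENNReal.ofReal])
  have c1 := (hχ x).1
  have c2 := sub_nonneg.2 (hχ x).2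
  exact ENNReal.toReal_le_of_le_ofReal (by positivity) (h.trans h3)

end RealAsymptoticLipschitz

/-! ### Existence of the minimal relaxed slope -/

section MinimalSlope

variable {X : Type*} [MetricSpace X] [MeasurableSpace X]

/-- The elements of `L²` larger than `Lip_a H`, for some bounded Lipschitz `H` which is `ε`-close
to `f` in `L²`. -/
def slopeUpper (m : Measure X) (f : X → ℝ) (ε : ℝ≥0∞) : Set (Lp ℝ 2 m) :=
  {v | ∃ H ∈ LipB X, MemLp H 2 m ∧ eLpNorm (H - f) 2 m ≤ ε ∧
    ∀ᵐ x ∂m, (asymLip H x).toReal ≤ v x}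

variable {m : Measure X}

/-- `H ↦ Lip_a H` is convex only as an inequality, which is why the set collects all majorants of
`Lip_a H` rather than the slopes themselves. -/
theorem convex_slopeUpper {f : X → ℝ} (hf : AEStronglyMeasurable f m) (ε : ℝ≥0∞) :
    Convex ℝ (slopeUpper m f ε) := by
  rintro v ⟨H, hH, hH2, hε, hv⟩ w ⟨K, hK, hK2, hε', hw⟩ a b ha hb hab
  refine ⟨a • H + b • K, (LipB X).add_mem ((LipB X).smul_mem a hH) ((LipB X).smul_mem b hK),
    (hH2.const_smul a).add (hK2.const_smul b), ?_, ?_⟩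
  · have e : a • H + b • K - f = a • (H - f) + b • (K - f) := by
      funext x
      simp only [Pi.sub_apply, Pi.add_apply, Pi.smul_apply, smul_eq_mul]
      linear_combination (f x) * hab
    rw [e]
    refine (eLpNorm_add_le ((hH2.1.sub hf).const_smul a) ((hK2.1.sub hf).const_smul b)
      (by norm_num)).trans ?_
    rw [eLpNorm_const_smul, eLpNorm_const_smul, Real.enorm_of_nonneg ha, Real.enorm_of_nonneg hb]
    calc _ ≤ ENNReal.ofReal a * ε + ENNReal.ofReal b * ε := by gcongr
      _ = ε := by rw [← add_mul, ← ENNReal.ofReal_add ha hb, hab, ENNReal.ofReal_one, one_mul]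
  · filter_upwards [hv, hw, Lp.coeFn_add (a • v) (b • w), Lp.coeFn_smul a v, Lp.coeFn_smul b w]
      with x h1 h2 h3 h4 h5
    rw [h3, Pi.add_apply, h4, h5]
    simp only [Pi.smul_apply, smul_eq_mul]
    refine (toReal_asymLip_combo_le hH hK ha hb x).trans ?_
    gcongr

theorem lintegral_enorm_sq_eq (v : Lp ℝ 2 m) : ∫⁻ x, ‖v x‖ₑ ^ 2 ∂m = ENNReal.ofReal (‖v‖ ^ 2) := by
  have h := eLpNorm_nnreal_pow_eq_lintegral (f := (v : X → ℝ)) (μ := m) (p := 2) (by norm_num)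
  rw [ENNReal.ofReal_pow (norm_nonneg v), Lp.norm_def, ENNReal.ofReal_toReal (Lp.eLpNorm_ne_top v)]
  simpa using h.symm

theorem lintegral_asymLip_sq_le {H : X → ℝ} (hH : H ∈ LipB X) {v : Lp ℝ 2 m}
    (h : ∀ᵐ x ∂m, (asymLip H x).toReal ≤ v x) :
    ∫⁻ x, asymLip H x ^ 2 ∂m ≤ ENNReal.ofReal (‖v‖ ^ 2) := by
  rw [← lintegral_enorm_sq_eq]
  refine lintegral_mono_ae ?_
  filter_upwards [h] with x hx
  gcongr
  rw [Real.enorm_eq_ofReal_abs, ← ENNReal.ofReal_toReal (asymLip_ne_top_of_mem hH x)]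
  exact ENNReal.ofReal_le_ofReal (hx.trans (le_abs_self _))

/-- Lower semicontinuity, as built into the relaxation: if no `ε` worked, the offending functions
`H` would converge to `f` in `L²` with energies staying below `Ch(f)`. -/
theorem exists_cheeger_le_of_slopeUpper (f : Lp ℝ 2 m) {δ : ℝ}
    (hδ : 0 < δ) :
    ∃ ε > (0 : ℝ≥0∞), ∀ v ∈ slopeUpper m f ε, 2 * (cheeger m f).toReal - δ ≤ ‖v‖ ^ 2 := by
  by_contra! hcon
  have hpos : ∀ n : ℕ, (0 : ℝ≥0∞) < ((n : ℝ≥0∞) + 1)⁻¹ := fun n => by simp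
  choose v hv hlt using fun n : ℕ => hcon _ (hpos n)
  choose H hH hH2 hε hHv using hv
  have hF : IsLipApprox m f H := by
    refine ⟨fun n => ⟨hH n, hH2 n⟩, ?_⟩
    refine tendsto_of_tendsto_of_tendsto_of_le_of_le tendsto_const_nhds ?_ (fun _ => bot_le) hε
    have := ENNReal.tendsto_inv_nat_nhds_zero.comp (tendsto_add_atTop_nat 1)
    simpa [Function.comp_def] using this
  have h1 : cheeger m f ≤ ENNReal.ofReal (2⁻¹ * (2 * (cheeger m f).toReal - δ)) := by
    refine cheeger_le hF fun n => ?_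
    rw [ENNReal.ofReal_mul (by norm_num), ENNReal.ofReal_inv_of_pos (by norm_num),
      ENNReal.ofReal_ofNat]
    gcongr
    exact (lintegral_asymLip_sq_le (hH n) (hHv n)).trans (ENNReal.ofReal_le_ofReal (hlt n).le)
  rcases le_or_gt 0 (2⁻¹ * (2 * (cheeger m f).toReal - δ)) with h0 | h0
  · have := ENNReal.toReal_le_of_le_ofReal h0 h1
    linarith
  · have hv0 := (hlt 0).trans_le' (sq_nonneg _)
    linarith

variable [BorelSpace X]

theorem memLp_toReal_asymLip {H : X → ℝ} (hH : H ∈ LipB X) (h : ∫⁻ x, asymLip H x ^ 2 ∂m < ∞) :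
    MemLp (fun x => (asymLip H x).toReal) 2 m := by
  refine ⟨(asymLip_measurable H).ennreal_toReal.aestronglyMeasurable, ?_⟩
  have h2 := eLpNorm_nnreal_pow_eq_lintegral (f := fun x => (asymLip H x).toReal) (μ := m)
    (p := 2) (by norm_num)
  have e : ∀ x, ‖(asymLip H x).toReal‖ₑ = asymLip H x := fun x => by
    rw [Real.enorm_of_nonneg ENNReal.toReal_nonneg, ENNReal.ofReal_toReal
      (asymLip_ne_top_of_mem hH x)]
  simp only [e] at h2
  by_contra hcon
  rw [not_lt, top_le_iff] at hcon
  rw [show ((2 : ℝ≥0) : ℝ≥0∞) = 2 from rfl, hcon] at h2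
  simp at h2
  exact h.ne h2.symm

theorem cheeger_toLp_le {φ : X → ℝ} (hφ : φ ∈ LipB X) (hφ2 : MemLp φ 2 m) :
    cheeger m (hφ2.toLp φ) ≤ 2⁻¹ * ∫⁻ x, asymLip φ x ^ 2 ∂m := by
  refine cheeger_le (F := fun _ => φ) ⟨fun _ => ⟨hφ, hφ2⟩, ?_⟩ fun _ => le_rfl
  have : eLpNorm (φ - (hφ2.toLp φ : X → ℝ)) 2 m = 0 := by
    rw [eLpNorm_congr_ae (g := 0) ?_, eLpNorm_zero]
    filter_upwards [hφ2.coeFn_toLp] with x hx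
    simp [hx]
  simp only [this, tendsto_const_nhds]

/-- A minimizing sequence for the Cheeger energy, whose slopes converge strongly in `L²`. -/
theorem exists_strong_approx (f : Lp ℝ 2 m) (hc : cheeger m f < ∞) :
    ∃ (F : ℕ → X → ℝ) (a : ℕ → Lp ℝ 2 m) (s : Lp ℝ 2 m), IsLipApprox m f F ∧
      (∀ n, MemLp (fun x => (asymLip (F n) x).toReal) 2 m) ∧
      (∀ n, (a n : X → ℝ) =ᵐ[m] fun x => (asymLip (F n) x).toReal) ∧
      Tendsto a atTop (𝓝 s) ∧ ‖s‖ ^ 2 ≤ 2 * (cheeger m f).toReal := by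
  set c := cheeger m f with hcdef
  have hpos : ∀ n : ℕ, (0 : ℝ≥0∞) < ((n : ℝ≥0∞) + 1)⁻¹ := fun n => by simp
  have hex : ∀ n : ℕ, ∃ F ∈ LipB X, MemLp F 2 m ∧ eLpNorm (F - (f : X → ℝ)) 2 m
      < ((n : ℝ≥0∞) + 1)⁻¹ ∧ 2⁻¹ * ∫⁻ x, asymLip F x ^ 2 ∂m < c + ((n : ℝ≥0∞) + 1)⁻¹ := by
    intro n
    obtain ⟨F, hF, hlt⟩ := exists_of_cheeger_lt (ENNReal.lt_add_right hc.ne (hpos n).ne')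
    obtain ⟨k, hk⟩ := (hF.2.eventually_lt_const (hpos n)).exists
    exact ⟨F k, (hF.1 k).1, (hF.1 k).2, hk, hlt k⟩
  choose F hF hF2 hFε hFc using hex
  have hfin : ∀ n, ∫⁻ x, asymLip (F n) x ^ 2 ∂m < ∞ := by
    intro n
    have h1 : 2⁻¹ * ∫⁻ x, asymLip (F n) x ^ 2 ∂m < ∞ :=
      (hFc n).trans_le le_top
    by_contra hcon
    rw [not_lt, top_le_iff] at hcon
    rw [hcon, ENNReal.mul_top (by simp)] at h1
    exact lt_irrefl _ h1
  have hmem := fun n => memLp_toReal_asymLip (hF n) (hfin n)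
  set a : ℕ → Lp ℝ 2 m := fun n => (hmem n).toLp _ with ha
  have haeq : ∀ n, (a n : X → ℝ) =ᵐ[m] fun x => (asymLip (F n) x).toReal :=
    fun n => (hmem n).coeFn_toLp
  have hinv : Tendsto (fun n : ℕ => ((n : ℝ≥0∞) + 1)⁻¹) atTop (𝓝 0) := by
    have := ENNReal.tendsto_inv_nat_nhds_zero.comp (tendsto_add_atTop_nat 1)
    simpa [Function.comp_def] using this
  have hup : ∀ ε > (0 : ℝ≥0∞), ∀ᶠ n in atTop, a n ∈ slopeUpper m f ε := by
    intro ε hε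
    filter_upwards [hinv.eventually_lt_const hε] with n hn
    exact ⟨F n, hF n, hF2 n, ((hFε n).trans hn).le, (haeq n).symm.le⟩
  have hnorm : ∀ n : ℕ, ‖a n‖ ^ 2 ≤ 2 * c.toReal + 2 * (1 / ((n : ℝ) + 1)) := by
    intro n
    have h1 : ENNReal.ofReal (‖a n‖ ^ 2) = ∫⁻ x, asymLip (F n) x ^ 2 ∂m := by
      rw [← lintegral_enorm_sq_eq]
      refine lintegral_congr_ae ?_
      filter_upwards [haeq n] with x hx
      rw [hx, Real.enorm_of_nonneg ENNReal.toReal_nonneg, ENNReal.ofReal_toReal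
        (asymLip_ne_top_of_mem (hF n) x)]
    have h2 := hFc n
    rw [← h1, ← ENNReal.ofReal_toReal hc.ne] at h2
    have e1 : ((n : ℝ≥0∞) + 1)⁻¹ = ENNReal.ofReal (1 / ((n : ℝ) + 1)) := by
      rw [one_div, ENNReal.ofReal_inv_of_pos (by positivity), ENNReal.ofReal_add (by positivity)
        (by norm_num), ENNReal.ofReal_natCast, ENNReal.ofReal_one]
    have e2 : (2⁻¹ : ℝ≥0∞) = ENNReal.ofReal 2⁻¹ := by
      rw [ENNReal.ofReal_inv_of_pos (by norm_num), ENNReal.ofReal_ofNat]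
    rw [e1, e2, ← ENNReal.ofReal_mul (by norm_num), ← ENNReal.ofReal_add ENNReal.toReal_nonneg
      (by positivity)] at h2
    have h3 := (ENNReal.ofReal_lt_ofReal_iff').1 h2
    linarith [h3.1]
  have hcauchy : CauchySeq a := by
    rw [Metric.cauchySeq_iff']
    intro η hη
    -- By convexity the midpoint of two late slopes is still admissible, so its squared norm is at
    -- least `2 Ch - η² / 16`. The parallelogram law then bounds the squared distance by `4 / (n +
    -- 1) + 4 / (N + 1) + η² / 4 < η²`.
    obtain ⟨ε, hε, hlow⟩ := exists_cheeger_le_of_slopeUpper f (δ := η ^ 2 / 16) (by positivity)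
    have hsmall : ∀ᶠ n : ℕ in atTop, 1 / ((n : ℝ) + 1) < η ^ 2 / 32 :=
      tendsto_one_div_add_atTop_nhds_zero_nat.eventually_lt_const (by positivity)
    obtain ⟨N, hN⟩ := eventually_atTop.1 ((hup ε hε).and hsmall)
    refine ⟨N, fun n hn => ?_⟩
    have hmid := hlow _ (convex_slopeUpper (Lp.aestronglyMeasurable f) ε (hN n hn).1
      (hN N le_rfl).1 (a := 1 / 2) (b := 1 / 2) (by norm_num) (by norm_num) (by norm_num))
    have hpar := parallelogram_law_with_norm ℝ (a n) (a N)
    rw [← smul_add, norm_smul, mul_pow] at hmid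
    norm_num at hmid
    have h1 := hnorm n
    have h2 := hnorm N
    have h3 := (hN n hn).2
    have h4 := (hN N le_rfl).2
    rw [dist_eq_norm]
    refine lt_of_pow_lt_pow_left₀ 2 hη.le ?_
    nlinarith
  obtain ⟨s, hs⟩ := cauchySeq_tendsto_of_complete hcauchy
  refine ⟨F, a, s, ⟨fun n => ⟨hF n, hF2 n⟩, ?_⟩, hmem, haeq, hs, ?_⟩
  · exact tendsto_of_tendsto_of_tendsto_of_le_of_le tendsto_const_nhds hinv (fun _ => bot_le)
      fun n => (hFε n).le
  · refine le_of_tendsto_of_tendsto (hs.norm.pow 2) ?_ (Eventually.of_forall hnorm)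
    simpa using (tendsto_one_div_add_atTop_nhds_zero_nat.const_mul (2 : ℝ)).const_add
      (2 * c.toReal)

theorem integral_mul_eq_inner (u v : Lp ℝ 2 m) : ∫ x, u x * v x ∂m = inner ℝ v u := by
  rw [L2.inner_def]
  simp

/-- By Mazur's lemma a relaxed slope is a strong limit of majorants of slopes of functions close to
`f`, to which the lower bound by the Cheeger energy applies. -/
theorem cheeger_le_norm_sq_of_isRelaxedSlope (f : Lp ℝ 2 m) {g : X → ℝ}
    (hg : IsRelaxedSlope m f g) :
    2 * (cheeger m f).toReal ≤ ‖hg.1.toLp g‖ ^ 2 := by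
  obtain ⟨hg2, F, g₀, hF, hmem, hg0, hweak, hle⟩ := hg
  have hcl : ∀ ε > (0 : ℝ≥0∞), hg2.toLp g ∈ closure (slopeUpper m f ε) := by
    intro ε hε
    refine mem_closure_of_forall_dual_lt (convex_slopeUpper (Lp.aestronglyMeasurable f) ε) ?_
    intro l η hη
    obtain ⟨ψ, hψ⟩ := (InnerProductSpace.toDual ℝ (Lp ℝ 2 m)).surjective l
    have hw := hweak ψ (Lp.memLp ψ)
    have h1 : ∀ u : Lp ℝ 2 m, l u = ∫ x, u x * ψ x ∂m := fun u => by
      rw [integral_mul_eq_inner, ← hψ, InnerProductSpace.toDual_apply_apply]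
    have e1 : ∀ n, l ((hmem n).toLp _) = ∫ x, (asymLip (F n) x).toReal * ψ x ∂m := fun n => by
      rw [h1]
      refine integral_congr_ae ?_
      filter_upwards [(hmem n).coeFn_toLp] with x hx
      rw [hx]
    have e2 : l (hg0.toLp g₀) = ∫ x, g₀ x * ψ x ∂m := by
      rw [h1]
      refine integral_congr_ae ?_
      filter_upwards [hg0.coeFn_toLp] with x hx
      rw [hx]
    simp only [← e1, ← e2] at hw
    obtain ⟨n, hn1, hn2⟩ := ((hw.eventually_lt_const (lt_add_of_pos_right _ hη)).and
      (hF.2.eventually_lt_const hε)).exists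
    -- Adding the nonnegative function `g - g₀` keeps a majorant of the slope and moves the weak
    -- limit from `g₀` to `g`.
    refine ⟨(hmem n).toLp _ + (hg2.toLp g - hg0.toLp g₀),
      ⟨F n, (hF.1 n).1, (hF.1 n).2, hn2.le, ?_⟩, ?_⟩
    · filter_upwards [(hmem n).coeFn_toLp, hg2.coeFn_toLp, hg0.coeFn_toLp, hle,
        Lp.coeFn_add ((hmem n).toLp _) (hg2.toLp g - hg0.toLp g₀),
        Lp.coeFn_sub (hg2.toLp g) (hg0.toLp g₀)] with x a1 a2 a3 a4 a5 a6
      rw [a5, Pi.add_apply, a6, Pi.sub_apply, a1, a2, a3]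
      linarith
    · rw [map_add, map_sub]
      linarith
  refine le_of_forall_pos_le_add fun δ hδ => ?_
  obtain ⟨ε, hε, hlow⟩ := exists_cheeger_le_of_slopeUpper f hδ
  have hclosed : IsClosed {v : Lp ℝ 2 m | 2 * (cheeger m f).toReal - δ ≤ ‖v‖ ^ 2} :=
    isClosed_le continuous_const (continuous_norm.pow 2)
  have := closure_minimal (fun v hv => hlow v hv) hclosed (hcl ε hε)
  linarith [show 2 * (cheeger m f).toReal - δ ≤ ‖hg2.toLp g‖ ^ 2 from this]

theorem IsLipApprox.congr {f g : X → ℝ} (h : f =ᵐ[m] g) {F : ℕ → X → ℝ}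
    (hF : IsLipApprox m f F) : IsLipApprox m g F := by
  refine ⟨hF.1, hF.2.congr fun n => eLpNorm_congr_ae ?_⟩
  filter_upwards [h] with x hx
  simp [hx]

theorem IsRelaxedSlope.congr {f f' g : X → ℝ} (h : f =ᵐ[m] f')
    (hg : IsRelaxedSlope m f g) : IsRelaxedSlope m f' g := by
  obtain ⟨h1, F, g₀, hF, h2⟩ := hg
  exact ⟨h1, F, g₀, hF.congr h, h2⟩

theorem IsMinimalRelaxedSlope.congr {f f' g : X → ℝ} (h : f =ᵐ[m] f')
    (hg : IsMinimalRelaxedSlope m f g) : IsMinimalRelaxedSlope m f' g :=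
  ⟨hg.1.congr h, fun g' hg' => hg.2 g' (hg'.congr h.symm)⟩

theorem norm_sq_eq_integral (v : Lp ℝ 2 m) : ‖v‖ ^ 2 = ∫ x, v x ^ 2 ∂m := by
  rw [← real_inner_self_eq_norm_sq, ← integral_mul_eq_inner]
  simp only [sq]

/-- The functions `χ φ + (1 - χ) F n` still converge to `f`, and their slopes exceed the
interpolated ones by at most `L |F n - f|`, which vanishes in `L²`. Hence the slope obtained by
pasting `Lip_a φ` and `s` through `χ` cannot beat the Cheeger energy. -/
theorem norm_sq_le_integral_interpolate (f : Lp ℝ 2 m) {φ : X → ℝ} (hφ : φ ∈ LipB X)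
    (hfφ : (f : X → ℝ) =ᵐ[m] φ) {F : ℕ → X → ℝ} (hF : IsLipApprox m f F) {a : ℕ → Lp ℝ 2 m}
    (ha : ∀ n, (a n : X → ℝ) =ᵐ[m] fun x => (asymLip (F n) x).toReal) {s u : Lp ℝ 2 m}
    (hs : Tendsto a atTop (𝓝 s)) (hu : (u : X → ℝ) =ᵐ[m] fun x => (asymLip φ x).toReal)
    (χ : LipB X) (hχ : ∀ x, (χ : X → ℝ) x ∈ Icc (0 : ℝ) 1) :
    2 * (cheeger m f).toReal
      ≤ ∫ x, ((χ : X → ℝ) x * u x + (1 - (χ : X → ℝ) x) * s x) ^ 2 ∂m := by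
  obtain ⟨L, hL, -⟩ := exists_lip_bound χ
  have hχm := (continuous_lipB χ).aestronglyMeasurable (μ := m)
  have mul1 : ∀ v : X → ℝ, MemLp v 2 m → MemLp (fun x => (χ : X → ℝ) x * v x) 2 m := fun v hv =>
    hv.mono (hχm.mul hv.1) (Eventually.of_forall fun x => by
      rw [norm_mul, Real.norm_of_nonneg (hχ x).1]
      exact mul_le_of_le_one_left (norm_nonneg _) (hχ x).2)
  have mul2 : ∀ v : X → ℝ, MemLp v 2 m → MemLp (fun x => (1 - (χ : X → ℝ) x) * v x) 2 m :=
    fun v hv => hv.mono ((aestronglyMeasurable_const.sub hχm).mul hv.1)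
      (Eventually.of_forall fun x => by
      rw [norm_mul, Real.norm_of_nonneg (sub_nonneg.2 (hχ x).2)]
      exact mul_le_of_le_one_left (norm_nonneg _) (by linarith [(hχ x).1]))
  have hd : ∀ n, MemLp (F n - (f : X → ℝ)) 2 m := fun n => (hF.1 n).2.sub (Lp.memLp f)
  have hv : MemLp (fun x => (χ : X → ℝ) x * u x + (1 - (χ : X → ℝ) x) * s x) 2 m :=
    (mul1 u (Lp.memLp u)).add (mul2 s (Lp.memLp s))
  have hvn : ∀ n, MemLp (fun x => (χ : X → ℝ) x * u x + (1 - (χ : X → ℝ) x) * a n x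
      + L * ‖(F n - (f : X → ℝ)) x‖) 2 m := fun n =>
    ((mul1 u (Lp.memLp u)).add (mul2 (a n) (Lp.memLp (a n)))).add ((hd n).norm.const_mul _)
  have hH : ∀ n, (fun x => (χ : X → ℝ) x * φ x + (1 - (χ : X → ℝ) x) * F n x) ∈ LipB X := fun n =>
    (LipB X).add_mem (mulLip χ ⟨φ, hφ⟩).2 (by
      have e : (fun x => (1 - (χ : X → ℝ) x) * F n x)
          = ((mulLip (constLip 1 - χ) ⟨F n, (hF.1 n).1⟩ : LipB X) : X → ℝ) := by
        funext x
        simp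
      rw [e]
      exact Subtype.property _)
  have hφ2 : MemLp φ 2 m := (memLp_congr_ae hfφ).1 (Lp.memLp f)
  have hlim : Tendsto (fun n => (hvn n).toLp _) atTop (𝓝 (hv.toLp _)) := by
    rw [Lp.tendsto_Lp_iff_tendsto_eLpNorm'']
    have hs' := (Lp.tendsto_Lp_iff_tendsto_eLpNorm' a s).1 hs
    have h2 : Tendsto (fun n => eLpNorm ((a n : X → ℝ) - (s : X → ℝ)) 2 m
        + (L : ℝ≥0∞) * eLpNorm (F n - (f : X → ℝ)) 2 m) atTop (𝓝 0) := by
      simpa using hs'.add (ENNReal.Tendsto.const_mul hF.2 (Or.inr ENNReal.coe_ne_top))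
    refine tendsto_of_tendsto_of_tendsto_of_le_of_le tendsto_const_nhds h2 (fun _ => bot_le)
      fun n => ?_
    have e : (L : ℝ≥0∞) * eLpNorm (F n - (f : X → ℝ)) 2 m
        = eLpNorm (fun x => (L : ℝ) * ‖(F n - (f : X → ℝ)) x‖) 2 m := by
      rw [← eLpNorm_norm (F n - (f : X → ℝ))]
      have := eLpNorm_const_smul (L : ℝ) (fun x => ‖(F n - (f : X → ℝ)) x‖) 2 m
      simp only [Pi.smul_def, smul_eq_mul] at this
      rw [this, Real.enorm_of_nonneg L.coe_nonneg, ENNReal.ofReal_coe_nnreal]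
    rw [e]
    have e2 : ((fun x => (χ : X → ℝ) x * u x + (1 - (χ : X → ℝ) x) * a n x
        + L * ‖(F n - (f : X → ℝ)) x‖) - fun x => (χ : X → ℝ) x * u x + (1 - (χ : X → ℝ) x) * s x)
        = (fun x => (1 - (χ : X → ℝ) x) * ((a n : X → ℝ) - (s : X → ℝ)) x)
          + fun x => (L : ℝ) * ‖(F n - (f : X → ℝ)) x‖ := by
      funext x
      simp only [Pi.sub_apply, Pi.add_apply]
      ring
    rw [e2]
    refine (eLpNorm_add_le (mul2 _ ((Lp.memLp (a n)).sub (Lp.memLp s))).1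
      ((hd n).norm.const_mul _).1 (by norm_num)).trans ?_
    gcongr
    refine eLpNorm_mono fun x => ?_
    rw [norm_mul, Real.norm_of_nonneg (sub_nonneg.2 (hχ x).2)]
    exact mul_le_of_le_one_left (norm_nonneg _) (by linarith [(hχ x).1])
  have hnorm : ∫ x, ((χ : X → ℝ) x * u x + (1 - (χ : X → ℝ) x) * s x) ^ 2 ∂m
      = ‖hv.toLp _‖ ^ 2 := by
    rw [norm_sq_eq_integral]
    refine integral_congr_ae ?_
    filter_upwards [hv.coeFn_toLp] with x hx
    rw [hx]
  rw [hnorm]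
  refine le_of_forall_pos_le_add fun δ hδ => ?_
  obtain ⟨ε, hε, hlow⟩ := exists_cheeger_le_of_slopeUpper f hδ
  have hev : ∀ᶠ n in atTop, 2 * (cheeger m f).toReal - δ ≤ ‖(hvn n).toLp _‖ ^ 2 := by
    filter_upwards [hF.2.eventually_lt_const hε] with n hn
    refine hlow _ ⟨_, hH n, (mul1 φ hφ2).add (mul2 (F n) (hF.1 n).2), ?_, ?_⟩
    · refine le_trans (eLpNorm_mono_ae ?_) hn.le
      filter_upwards [hfφ] with x hx
      simp only [Pi.sub_apply, hx]
      have e3 : (χ : X → ℝ) x * φ x + (1 - (χ : X → ℝ) x) * F n x - φ x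
          = (1 - (χ : X → ℝ) x) * (F n x - φ x) := by ring
      rw [e3, norm_mul, Real.norm_of_nonneg (sub_nonneg.2 (hχ x).2)]
      exact mul_le_of_le_one_left (norm_nonneg _) (by linarith [(hχ x).1])
    · filter_upwards [(hvn n).coeFn_toLp, hfφ, ha n, hu] with x h1 h2 h3 h4
      rw [h1]
      refine (toReal_asymLip_interpolate_le hχ hL hφ (hF.1 n).1 x).trans (le_of_eq ?_)
      rw [h3, h4, Pi.sub_apply, h2, Real.norm_eq_abs, abs_sub_comm]
  have := ge_of_tendsto (hlim.norm.pow 2) hev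
  linarith

/-- The minimal relaxed slope of a Lipschitz function exists, its norm is controlled by the
Cheeger energy, and it is smaller than the asymptotic Lipschitz constant. -/
theorem exists_minimalRelaxedSlope [SecondCountableTopology X] (hm : FiniteOnBounded m) {φ : X → ℝ} (hφ : φ ∈ LipB X)
    (hφ2 : MemLp φ 2 m) (hfin : ∫⁻ x, asymLip φ x ^ 2 ∂m < ∞) :
    ∃ s : Lp ℝ 2 m, IsMinimalRelaxedSlope m φ s ∧
      ‖s‖ ^ 2 ≤ 2 * (cheeger m (hφ2.toLp φ)).toReal ∧
      ∀ᵐ x ∂m, s x ≤ (asymLip φ x).toReal := by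
  have := hm.isLocallyFinite
  set f := hφ2.toLp φ with hf
  have hc : cheeger m f < ∞ := by
    refine (cheeger_toLp_le hφ hφ2).trans_lt (ENNReal.mul_lt_top (by simp) hfin)
  obtain ⟨F, a, s, hF, hmem, haeq, hs, hsn⟩ := exists_strong_approx f hc
  have hFφ : IsLipApprox m φ F := hF.congr hφ2.coeFn_toLp
  have hum := memLp_toReal_asymLip hφ hfin
  set u : Lp ℝ 2 m := hum.toLp _ with hu
  have hueq : (u : X → ℝ) =ᵐ[m] fun x => (asymLip φ x).toReal := hum.coeFn_toLp
  have hmin : IsMinimalRelaxedSlope m f s := by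
    refine ⟨⟨Lp.memLp s, F, s, hF, hmem, Lp.memLp s, fun ψ hψ => ?_, EventuallyLE.rfl⟩,
      fun g hg => ?_⟩
    · have h1 := (continuous_const (y := hψ.toLp ψ)).inner (𝕜 := ℝ) continuous_id |>.tendsto s
        |>.comp hs
      simp only [Function.comp_def, id_eq, ← integral_mul_eq_inner] at h1
      have e1 : ∀ n, ∫ x, a n x * hψ.toLp ψ x ∂m = ∫ x, (asymLip (F n) x).toReal * ψ x ∂m := by
        intro n
        refine integral_congr_ae ?_
        filter_upwards [haeq n, hψ.coeFn_toLp] with x h2 h3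
        rw [h2, h3]
      have e2 : ∫ x, s x * hψ.toLp ψ x ∂m = ∫ x, s x * ψ x ∂m := by
        refine integral_congr_ae ?_
        filter_upwards [hψ.coeFn_toLp] with x h3
        rw [h3]
      simpa only [e1, e2] using h1
    · have h1 := hsn.trans (cheeger_le_norm_sq_of_isRelaxedSlope f hg)
      have h2 := le_of_sq_le_sq h1 (norm_nonneg _)
      rw [Lp.norm_toLp, Lp.norm_def] at h2
      exact (ENNReal.toReal_le_toReal (Lp.eLpNorm_ne_top s) hg.1.2.ne).1 h2
  refine ⟨s, hmin.congr hφ2.coeFn_toLp, hsn, ?_⟩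
  have hsqu : Integrable (fun x => u x ^ 2) m := (Lp.memLp u).integrable_sq
  have hsqs : Integrable (fun x => s x ^ 2) m := (Lp.memLp s).integrable_sq
  -- Letting `χ` tend to the indicator of `C`: replacing `s` by `Lip_a φ` on a closed set cannot
  -- lower the norm.
  have hpaste : ∀ C : Set X, IsClosed C → ‖s‖ ^ 2
      ≤ ∫ x, (C.indicator (fun _ => (1 : ℝ)) x * u x
        + (1 - C.indicator (fun _ => (1 : ℝ)) x) * s x) ^ 2 ∂m := by
    intro C hC
    obtain ⟨χ, hχ, hlim⟩ := exists_lipB_tendsto_indicator hC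
    have hstep := fun k => norm_sq_le_integral_interpolate f hφ hφ2.coeFn_toLp hF haeq hs hueq
      (χ k) (hχ k)
    refine ge_of_tendsto (x := atTop) ?_ (Eventually.of_forall fun k => hsn.trans (hstep k))
    refine tendsto_integral_of_dominated_convergence (fun x => u x ^ 2 + s x ^ 2) (fun k => ?_)
      (hsqu.add hsqs) (fun k => Eventually.of_forall fun x => ?_)
      (Eventually.of_forall fun x => ?_)
    · have h1 := (continuous_lipB (χ k)).aestronglyMeasurable (μ := m)
      exact ((h1.mul (Lp.aestronglyMeasurable u)).add ((aestronglyMeasurable_const.sub h1).mul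
        (Lp.aestronglyMeasurable s))).pow 2
    · rw [Real.norm_of_nonneg (sq_nonneg _)]
      obtain ⟨h0, h1⟩ := hχ k x
      nlinarith [mul_nonneg (mul_nonneg h0 (sub_nonneg.2 h1)) (sq_nonneg (u x - s x)),
        mul_nonneg (sub_nonneg.2 h1) (sq_nonneg (u x)), mul_nonneg h0 (sq_nonneg (s x))]
    · exact ((((hlim x).mul_const _).add (((hlim x).const_sub 1).mul_const _)).pow 2)
  -- If `Lip_a φ < s` on a set of positive measure, that set contains a closed set of positive
  -- measure, and the replacement there would strictly lower the norm.
  by_contra hcon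
  set B := {x | (asymLip φ x).toReal < s x} with hB
  have hBm : MeasurableSet B :=
    measurableSet_lt (asymLip_measurable φ).ennreal_toReal (Lp.stronglyMeasurable s).measurable
  have hB0 : m B ≠ 0 := by
    intro h0
    refine hcon ?_
    filter_upwards [measure_eq_zero_iff_ae_notMem.1 h0] with x hx
    exact not_lt.1 hx
  obtain ⟨C, hCB, hC, hC0⟩ : ∃ C ⊆ B, IsClosed C ∧ m C ≠ 0 := by
    by_contra! hall
    refine hB0 ?_
    rw [← inter_univ B, ← iUnion_spanningSets m, inter_iUnion, measure_iUnion_null_iff]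
    intro i
    by_contra hi
    obtain ⟨C, hCs, hC, hlt⟩ := (hBm.inter (measurableSet_spanningSets m i)).exists_lt_isClosed_of_ne_top
      (measure_ne_top_of_subset inter_subset_right (measure_spanningSets_lt_top m i).ne)
      (pos_iff_ne_zero.2 hi)
    exact hlt.ne' (hall C (hCs.trans inter_subset_left) hC)
  have h1 := hpaste C hC
  rw [norm_sq_eq_integral] at h1
  have e : ∫ x, (C.indicator (fun _ => (1 : ℝ)) x * u x
        + (1 - C.indicator (fun _ => (1 : ℝ)) x) * s x) ^ 2 ∂m
      = ∫ x, s x ^ 2 ∂m - ∫ x in C, (s x ^ 2 - u x ^ 2) ∂m := by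
    rw [← integral_indicator hC.measurableSet]
    refine Eq.trans ?_ (integral_sub hsqs ((hsqs.sub hsqu).indicator hC.measurableSet))
    refine integral_congr_ae (Eventually.of_forall fun x => ?_)
    by_cases hx : x ∈ C <;> simp [hx]
  rw [e] at h1
  have hpos : ∀ᵐ x ∂m.restrict C, 0 < s x ^ 2 - u x ^ 2 := by
    rw [ae_restrict_iff' hC.measurableSet]
    filter_upwards [hueq] with x hx hxC
    have h3 : (asymLip φ x).toReal < s x := hCB hxC
    rw [hx]
    have h4 : 0 ≤ (asymLip φ x).toReal := ENNReal.toReal_nonneg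
    nlinarith
  have hz : ∫ x in C, (s x ^ 2 - u x ^ 2) ∂m = 0 :=
    le_antisymm (by linarith) (integral_nonneg_of_ae (hpos.mono fun x hx => hx.le))
  rw [integral_eq_zero_iff_of_nonneg_ae (hpos.mono fun x hx => hx.le)
    (hsqs.sub hsqu).integrableOn] at hz
  have : ∀ᵐ x ∂m.restrict C, False := by
    filter_upwards [hz, hpos] with x h5 h6
    exact h6.ne' h5
  rw [ae_iff] at this
  simp at this
  exact hC0 this

end MinimalSlope

/-! ### Lipschitz functions with bounded support -/

section BoundedSupport

variable {X : Type*} [MetricSpace X] [MeasurableSpace X] [BorelSpace X] {m : Measure X}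

theorem IsLipBS.exists_ball {φ : LipB X} (hφ : IsLipBS φ) (x₀ : X) :
    ∃ R : ℝ, ∀ x, R ≤ dist x x₀ → (φ : X → ℝ) x = 0 ∧ asymLip (φ : X → ℝ) x = 0 := by
  obtain ⟨R, hR⟩ := hφ.subset_ball x₀
  -- The extra `1` leaves a whole ball around `x` on which `φ` vanishes, so that the slope vanishes
  -- too.
  refine ⟨R + 1, fun x hx => ?_⟩
  have h0 : ∀ y, R ≤ dist y x₀ → (φ : X → ℝ) y = 0 := fun y hy => by
    by_contra hne
    exact absurd (Metric.mem_ball.1 (hR hne)) (not_lt.2 hy)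
  refine ⟨h0 x (by linarith), ?_⟩
  rw [asymLip_congr (g := fun _ => 0), asymLip_const]
  filter_upwards [Metric.ball_mem_nhds x one_pos] with y hy
  refine h0 y ?_
  have := dist_triangle x y x₀
  rw [dist_comm x y] at this
  have := Metric.mem_ball.1 hy
  linarith

theorem IsLipBS.memLp (hm : FiniteOnBounded m) {φ : LipB X} (hφ : IsLipBS φ) (p : ℝ≥0∞) :
    MemLp (φ : X → ℝ) p m := by
  obtain ⟨L, hL, hb⟩ := exists_lip_bound φ
  have hS : MeasurableSet (Function.support (φ : X → ℝ)) :=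
    measurableSet_support (continuous_lipB φ).measurable
  have h1 : MemLp (φ : X → ℝ) p (m.restrict (Function.support (φ : X → ℝ))) := by
    have : IsFiniteMeasure (m.restrict (Function.support (φ : X → ℝ))) :=
      ⟨by rw [Measure.restrict_apply_univ]; exact hm _ hφ⟩
    exact MemLp.of_bound (continuous_lipB φ).aestronglyMeasurable L
      (Eventually.of_forall fun x => hb x)
  have := (memLp_indicator_iff_restrict hS).2 h1
  rwa [indicator_support] at this

theorem IsLipBS.lintegral_asymLip_sq_lt_top [Nonempty X] (hm : FiniteOnBounded m) {φ : LipB X}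
    (hφ : IsLipBS φ) : ∫⁻ x, asymLip (φ : X → ℝ) x ^ 2 ∂m < ∞ := by
  obtain ⟨x₀⟩ := ‹Nonempty X›
  obtain ⟨R, hR⟩ := hφ.exists_ball x₀
  obtain ⟨L, hL, hb⟩ := exists_lip_bound φ
  have hle : ∀ x, asymLip (φ : X → ℝ) x ^ 2
      ≤ (Metric.ball x₀ R).indicator (fun _ => (L : ℝ≥0∞) ^ 2) x := by
    intro x
    by_cases hx : x ∈ Metric.ball x₀ R
    · rw [indicator_of_mem hx]
      gcongr
      exact asymLip_le_of_lipschitzWith hL x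
    · rw [Metric.mem_ball, not_lt] at hx
      simp [(hR x hx).2]
  refine (lintegral_mono hle).trans_lt ?_
  rw [lintegral_indicator Metric.isOpen_ball.measurableSet, setLIntegral_const]
  exact ENNReal.mul_lt_top (by simp) (hm _ Metric.isBounded_ball)

end BoundedSupport

/-! ### Locality and the Leibniz rule for derivations -/

section Derivation

variable {X : Type*} [MetricSpace X] [MeasurableSpace X] [BorelSpace X]
  [SecondCountableTopology X] {m : Measure X} {L : LipB X →ₗ[ℝ] (X →ₘ[m] ℝ)} {h : X → ℝ}

theorem coeFn_map_add (L : LipB X →ₗ[ℝ] (X →ₘ[m] ℝ)) (f g : LipB X) :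
    ∀ᵐ x ∂m, L (f + g) x = L f x + L g x := by
  rw [map_add]
  exact AEEqFun.coeFn_add _ _

theorem coeFn_map_sub (L : LipB X →ₗ[ℝ] (X →ₘ[m] ℝ)) (f g : LipB X) :
    ∀ᵐ x ∂m, L (f - g) x = L f x - L g x := by
  rw [map_sub]
  exact AEEqFun.coeFn_sub _ _

theorem coeFn_map_smul (L : LipB X →ₗ[ℝ] (X →ₘ[m] ℝ)) (c : ℝ) (f : LipB X) :
    ∀ᵐ x ∂m, L (c • f) x = c * L f x := by
  rw [map_smul]
  exact AEEqFun.coeFn_smul _ _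

/-- A derivation is bounded by the asymptotic Lipschitz constant. -/
theorem IsLocalityBound.abs_le_asymLip (hm : FiniteOnBounded m) (hh : IsLocalityBound m L h)
    (f : LipB X) : ∀ᵐ x ∂m, |L f x| ≤ h x * (asymLip (f : X → ℝ) x).toReal := by
  rcases isEmpty_or_nonempty X with hX | hX
  · exact Eventually.of_forall fun x => hX.elim x
  obtain ⟨x₀⟩ := id hX
  have hn : ∀ n : ℕ, ∀ᵐ x ∂m, x ∈ Metric.ball x₀ ((n : ℝ) + 1) →
      |L f x| ≤ h x * (asymLip (f : X → ℝ) x).toReal := by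
    intro n
    have hpos : (0 : ℝ) < (n : ℝ) + 1 := by positivity
    set φ := mulLip f (bump x₀ hpos) with hφdef
    have hφ : IsLipBS φ := isLipBS_mul_bump f x₀ hpos
    have heq : EqOn (f : X → ℝ) φ (Metric.ball x₀ ((n : ℝ) + 1)) := fun x hx => by
      rw [hφdef, mulLip_apply, bump_eq_one hpos (Metric.mem_ball.1 hx).le, mul_one]
    -- The locality bound quantifies over minimal slopes and would be empty if none existed.
    obtain ⟨s, hs, -, hle⟩ := exists_minimalRelaxedSlope hm φ.2 (hφ.memLp hm 2)
      (hφ.lintegral_asymLip_sq_lt_top hm)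
    filter_upwards [hh.2.2 f x₀ _ s ⟨φ, hφ, heq, hs⟩, hle] with x h1 h2 hx
    refine (h1 hx).trans ?_
    have e : asymLip (f : X → ℝ) x = asymLip (φ : X → ℝ) x := asymLip_congr <| by
      filter_upwards [Metric.isOpen_ball.mem_nhds hx] with y hy
      exact heq hy
    rw [e]
    exact mul_le_mul_of_nonneg_left h2 (hh.2.1 x)
  filter_upwards [ae_all_iff.2 hn] with x hx
  obtain ⟨n, hn⟩ := exists_nat_gt (dist x x₀)
  exact hx n (Metric.mem_ball.2 (by linarith))

theorem IsLocalityBound.abs_le_of_lipschitzWith (hm : FiniteOnBounded m)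
    (hh : IsLocalityBound m L h) (f : LipB X) {K : ℝ≥0} (hK : LipschitzWith K (f : X → ℝ)) :
    ∀ᵐ x ∂m, |L f x| ≤ h x * K := by
  filter_upwards [hh.abs_le_asymLip hm f] with x hx
  refine hx.trans (mul_le_mul_of_nonneg_left ?_ (hh.2.1 x))
  exact ENNReal.toReal_le_of_le_ofReal K.coe_nonneg
    (by simpa using asymLip_le_of_lipschitzWith hK x)

/-- Locality on open sets. -/
theorem IsLocalityBound.eq_zero_of_eqOn (hm : FiniteOnBounded m) (hh : IsLocalityBound m L h)
    (f : LipB X) {U : Set X} (hU : IsOpen U) {c : ℝ} (hf : ∀ x ∈ U, (f : X → ℝ) x = c) :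
    ∀ᵐ x ∂m, x ∈ U → L f x = 0 := by
  filter_upwards [hh.abs_le_asymLip hm f] with x hx hxU
  rw [asymLip_congr (g := fun _ => c), asymLip_const] at hx
  · simpa using hx
  · filter_upwards [hU.mem_nhds hxU] with y hy
    exact hf y hy

theorem IsLocalityBound.congr_of_eqOn (hm : FiniteOnBounded m) (hh : IsLocalityBound m L h)
    (f g : LipB X) {U : Set X} (hU : IsOpen U) (hfg : EqOn (f : X → ℝ) g U) :
    ∀ᵐ x ∂m, x ∈ U → L f x = L g x := by
  filter_upwards [hh.eq_zero_of_eqOn hm (f - g) hU (c := 0) fun x hx => by simp [hfg hx],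
    coeFn_map_sub L f g] with x h1 h2 hx
  have := h1 hx
  rw [h2] at this
  linarith

/-- Compare `u` with a constant `c`: `u² - 2 c u` is `(u - c)²` up to a constant, and the slope of
`(u - c)²` is at most `2 |u - c| Lip_a u`, which vanishes where `u = c`. Rational `c` keep the
exceptional set null; continuity in `c` then allows `c = u x`. -/
theorem IsLocalityBound.map_sq (hm : FiniteOnBounded m) (hh : IsLocalityBound m L h)
    (u : LipB X) : ∀ᵐ x ∂m, L (mulLip u u) x = 2 * (u : X → ℝ) x * L u x := by
  have key : ∀ c : ℚ, ∀ᵐ x ∂m, |L (mulLip u u) x - 2 * (c : ℝ) * L u x|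
      ≤ h x * (2 * |(u : X → ℝ) x - c| * (asymLip (u : X → ℝ) x).toReal) := by
    intro c
    set w : LipB X := u - constLip (c : ℝ) with hw
    have e : mulLip u u - (2 * (c : ℝ)) • u = mulLip w w - constLip ((c : ℝ) ^ 2) := by
      apply Subtype.ext
      funext x
      simp [hw]
      ring
    have hc := hh.eq_zero_of_eqOn hm (constLip ((c : ℝ) ^ 2)) isOpen_univ
      (c := (c : ℝ) ^ 2) fun x _ => rfl
    filter_upwards [hh.abs_le_asymLip hm (mulLip w w), hc,
      coeFn_map_sub L (mulLip u u) ((2 * (c : ℝ)) • u), coeFn_map_smul L (2 * (c : ℝ)) u,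
      coeFn_map_sub L (mulLip w w) (constLip ((c : ℝ) ^ 2))] with x h1 h2 h3 h4 h5
    rw [← h4, ← h3, e, h5, h2 (mem_univ x), sub_zero]
    refine h1.trans (mul_le_mul_of_nonneg_left ?_ (hh.2.1 x))
    have hwx : asymLip (w : X → ℝ) x ≤ asymLip (u : X → ℝ) x := asymLip_sub_const _ _ _
    have hm2 := asymLip_mul_le (asymLip_lipB_ne_top w x) (asymLip_lipB_ne_top w x)
    rw [← two_mul] at hm2
    have hu := asymLip_lipB_ne_top u x
    refine ENNReal.toReal_le_of_le_ofReal (by positivity) (hm2.trans ?_)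
    rw [ENNReal.ofReal_mul (by positivity), ENNReal.ofReal_mul (by positivity),
      ENNReal.ofReal_toReal hu, ← Real.enorm_eq_ofReal_abs, ENNReal.ofReal_ofNat, mul_assoc]
    exact mul_le_mul_right (mul_le_mul_right hwx _) _
  filter_upwards [ae_all_iff.2 key] with x hx
  have hall : ∀ c : ℝ, |L (mulLip u u) x - 2 * c * L u x|
      ≤ h x * (2 * |(u : X → ℝ) x - c| * (asymLip (u : X → ℝ) x).toReal) := by
    intro c
    refine Rat.denseRange_cast.induction_on (p := fun c : ℝ => |L (mulLip u u) x - 2 * c * L u x|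
      ≤ h x * (2 * |(u : X → ℝ) x - c| * (asymLip (u : X → ℝ) x).toReal)) c ?_ hx
    exact isClosed_le (by fun_prop) (by fun_prop)
  have := hall ((u : X → ℝ) x)
  simp only [sub_self, abs_zero, mul_zero, zero_mul, abs_nonpos_iff] at this
  linarith

/-- The Leibniz rule. -/
theorem IsLocalityBound.map_mul (hm : FiniteOnBounded m) (hh : IsLocalityBound m L h)
    (f g : LipB X) :
    ∀ᵐ x ∂m, L (mulLip f g) x = (f : X → ℝ) x * L g x + (g : X → ℝ) x * L f x := by
  have e : mulLip (f + g) (f + g) = mulLip f f + ((2 : ℝ) • mulLip f g + mulLip g g) := by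
    apply Subtype.ext
    funext x
    simp
    ring
  filter_upwards [hh.map_sq hm (f + g), hh.map_sq hm f, hh.map_sq hm g,
    coeFn_map_add L (mulLip f f) ((2 : ℝ) • mulLip f g + mulLip g g),
    coeFn_map_add L ((2 : ℝ) • mulLip f g) (mulLip g g), coeFn_map_smul L 2 (mulLip f g),
    coeFn_map_add L f g] with x h1 h2 h3 h4 h5 h6 h7
  rw [e, h4, h5, h6, h2, h3, h7] at h1
  simp only [Submodule.coe_add, Pi.add_apply] at h1
  linarith

end Derivation

/-! ### Density of Lipschitz functions in `L¹` -/

section Density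

variable {X : Type*} [MetricSpace X] [MeasurableSpace X] [BorelSpace X]
  [SecondCountableTopology X]

/-- Three losses of size `η`: from `s` to a closed subset, from there to a bounded closed subset
`D`, and from the indicator of `D` to a Lipschitz cutoff. The first two are measures of sets and get
multiplied by `|c|`. -/
theorem exists_lipB_eLpNorm_indicator_sub_le {μ : Measure X} (hμ : FiniteOnBounded μ) (c : ℝ)
    {s : Set X} (hs : MeasurableSet s) (hμs : μ s < ∞) {ε : ℝ≥0∞} (hε : ε ≠ 0) :
    ∃ ψ : LipB X, IsLipBS ψ ∧ eLpNorm ((ψ : X → ℝ) - s.indicator fun _ => c) 1 μ ≤ ε := by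
  have := hμ.isLocallyFinite
  rcases isEmpty_or_nonempty X with hX | hX
  · refine ⟨0, by simp [IsLipBS], ?_⟩
    rw [Subsingleton.elim μ 0]
    simp
  obtain ⟨x₀⟩ := id hX
  -- an inner closed bounded set
  obtain ⟨η, hη, hη2⟩ : ∃ η : ℝ≥0∞, η ≠ 0 ∧ ‖c‖ₑ * (η + η) + η ≤ ε := by
    have h1 : Tendsto (fun η : ℝ≥0∞ => ‖c‖ₑ * (η + η) + η) (𝓝 0) (𝓝 (‖c‖ₑ * (0 + 0) + 0)) :=
      (ENNReal.Tendsto.const_mul (tendsto_id.add tendsto_id) (Or.inr (by simp))).add tendsto_id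
    have h2 : ∀ᶠ η : ℝ≥0∞ in 𝓝[>] 0, ‖c‖ₑ * (η + η) + η < ε := by
      refine (h1.eventually_lt_const ?_).filter_mono nhdsWithin_le_nhds
      simpa using pos_iff_ne_zero.2 hε
    obtain ⟨η, h3, h4⟩ := (h2.and self_mem_nhdsWithin).exists
    exact ⟨η, (mem_Ioi.1 h4).ne', h3.le⟩
  obtain ⟨C, hCs, hC, hCμ⟩ := hs.exists_isClosed_sdiff_lt hμs.ne hη
  have htail : Tendsto (fun n : ℕ => μ (C \ Metric.closedBall x₀ ((n : ℝ) + 1))) atTop (𝓝 0) := by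
    have h1 := tendsto_measure_iInter_atTop (μ := μ)
      (s := fun n : ℕ => C \ Metric.closedBall x₀ ((n : ℝ) + 1))
      (fun n => (hC.measurableSet.diff Metric.isClosed_closedBall.measurableSet).nullMeasurableSet)
      (fun i j hij => sdiff_subset_sdiff_right (Metric.closedBall_subset_closedBall
        (by have : (i : ℝ) ≤ j := by exact_mod_cast hij
            linarith)))
      ⟨0, ((measure_mono (sdiff_subset.trans hCs)).trans_lt hμs).ne⟩
    have h2 : ⋂ n : ℕ, C \ Metric.closedBall x₀ ((n : ℝ) + 1) = ∅ := by
      refine eq_empty_of_forall_notMem fun x hx => ?_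
      obtain ⟨n, hn⟩ := exists_nat_gt (dist x x₀)
      exact (mem_iInter.1 hx n).2 (Metric.mem_closedBall.2 (by linarith))
    rwa [h2, measure_empty] at h1
  obtain ⟨n, hn⟩ := (htail.eventually_lt_const (pos_iff_ne_zero.2 hη)).exists
  have hpos : (0 : ℝ) < (n : ℝ) + 1 := by positivity
  set D := C ∩ Metric.closedBall x₀ ((n : ℝ) + 1) with hD
  have hDc : IsClosed D := hC.inter Metric.isClosed_closedBall
  obtain ⟨χ, hχ, hlim⟩ := exists_lipB_tendsto_indicator hDc
  have hψ : ∀ k, IsLipBS (c • mulLip (χ k) (bump x₀ hpos)) := fun k =>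
    (isLipBS_mul_bump (χ k) x₀ hpos).subset fun x hx h0 => hx (by
      have h0' : (mulLip (χ k) (bump x₀ hpos) : X → ℝ) x = 0 := h0
      simp only [Submodule.coe_smul, Pi.smul_apply, h0', smul_zero])
  have hconv : Tendsto (fun k => ∫⁻ x, ‖((c • mulLip (χ k) (bump x₀ hpos) : LipB X) : X → ℝ) x
      - D.indicator (fun _ => c) x‖ₑ ∂μ) atTop (𝓝 0) := by
    have hb : ∀ k, (fun x => ‖((c • mulLip (χ k) (bump x₀ hpos) : LipB X) : X → ℝ) x
        - D.indicator (fun _ => c) x‖ₑ) ≤ᵐ[μ]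
        (Metric.ball x₀ (2 * ((n : ℝ) + 1))).indicator fun _ => ‖c‖ₑ := by
      intro k
      refine Eventually.of_forall fun x => ?_
      have e : ((c • mulLip (χ k) (bump x₀ hpos) : LipB X) : X → ℝ) x
        - D.indicator (fun _ => c) x
        = c * ((χ k : X → ℝ) x * (bump x₀ hpos : X → ℝ) x - D.indicator (fun _ => 1) x) := by
        by_cases hx : x ∈ D <;> simp [hx]
        ring
      simp only [e]
      by_cases hx : x ∈ Metric.ball x₀ (2 * ((n : ℝ) + 1))
      · rw [indicator_of_mem hx, enorm_mul]
        refine mul_le_of_le_one_right (by simp) ?_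
        have c1 := hχ k x
        have c2 := bump_mem_Icc x₀ hpos x
        have c3 : D.indicator (fun _ => (1 : ℝ)) x ∈ Icc (0 : ℝ) 1 := by
          by_cases hx : x ∈ D <;> simp [hx]
        have c4 := mul_le_one₀ c1.2 c2.1 c2.2
        have c5 := mul_nonneg c1.1 c2.1
        rw [Real.enorm_eq_ofReal_abs, ← ENNReal.ofReal_one]
        refine ENNReal.ofReal_le_ofReal (abs_le.2 ⟨by linarith [c3.2], by linarith [c3.1]⟩)
      · rw [indicator_of_notMem hx]
        rw [Metric.mem_ball, not_lt] at hx
        have hxD : x ∉ D := fun h => by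
          have := Metric.mem_closedBall.1 h.2
          linarith
        simp [bump_eq_zero hpos hx, hxD]
    have hmeas : ∀ k, Measurable fun x => ‖((c • mulLip (χ k) (bump x₀ hpos) : LipB X) : X → ℝ) x
        - D.indicator (fun _ => c) x‖ₑ := fun k =>
      ((continuous_lipB _).measurable.sub
        (measurable_const.indicator hDc.measurableSet)).enorm
    have h0 : ∫⁻ _x, (0 : ℝ≥0∞) ∂μ = 0 := by simp
    rw [← h0]
    refine tendsto_lintegral_of_dominated_convergence _ hmeas hb ?_ ?_
    · rw [lintegral_indicator Metric.isOpen_ball.measurableSet, setLIntegral_const]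
      exact ENNReal.mul_ne_top (by simp) (hμ _ Metric.isBounded_ball).ne
    · refine Eventually.of_forall fun x => ?_
      have h1 : Tendsto (fun k => c * ((χ k : X → ℝ) x * (bump x₀ hpos : X → ℝ) x)
          - D.indicator (fun _ => c) x) atTop (𝓝 0) := by
        have h2 := (((hlim x).mul_const ((bump x₀ hpos : X → ℝ) x)).const_mul c).sub_const
          (D.indicator (fun _ => c) x)
        have e : c * (D.indicator (fun _ => 1) x * (bump x₀ hpos : X → ℝ) x)
            - D.indicator (fun _ => c) x = 0 := by
          by_cases hx : x ∈ D
          · simp [hx, bump_eq_one hpos (Metric.mem_closedBall.1 hx.2)]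
          · simp [hx]
        rwa [e] at h2
      have h3 := h1.enorm
      rw [enorm_zero] at h3
      exact h3
  obtain ⟨k, hk⟩ := (hconv.eventually_lt_const (pos_iff_ne_zero.2 hη)).exists
  refine ⟨_, hψ k, ?_⟩
  have hdiff : μ (s \ D) ≤ η + η := by
    refine (measure_mono (t := (s \ C) ∪ (C \ Metric.closedBall x₀ ((n : ℝ) + 1))) ?_).trans
      ((measure_union_le _ _).trans (add_le_add hCμ.le hn.le))
    rintro x ⟨hxs, hxD⟩
    by_cases hxC : x ∈ C
    · exact Or.inr ⟨hxC, fun h => hxD ⟨hxC, h⟩⟩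
    · exact Or.inl ⟨hxs, hxC⟩
  refine le_trans ?_ hη2
  rw [eLpNorm_one_eq_lintegral_enorm]
  have hDs : D ⊆ s := inter_subset_left.trans hCs
  calc ∫⁻ x, ‖(((c • mulLip (χ k) (bump x₀ hpos) : LipB X) : X → ℝ) - s.indicator fun _ => c) x‖ₑ ∂μ
      ≤ ∫⁻ x, ((s \ D).indicator (fun _ => ‖c‖ₑ) x
        + ‖((c • mulLip (χ k) (bump x₀ hpos) : LipB X) : X → ℝ) x
          - D.indicator (fun _ => c) x‖ₑ) ∂μ := by
        refine lintegral_mono fun x => ?_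
        by_cases hxD : x ∈ D
        · simp [hxD, hDs hxD]
        · by_cases hxs : x ∈ s
          · have hmem : x ∈ s \ D := ⟨hxs, hxD⟩
            rw [Pi.sub_apply, indicator_of_mem hmem, indicator_of_mem hxs,
              indicator_of_notMem hxD, sub_zero]
            exact enorm_sub_le.trans (add_comm _ _).le
          · simp [hxD, hxs]
    _ = ‖c‖ₑ * μ (s \ D) + _ := by
        rw [lintegral_add_left (measurable_const.indicator (hs.diff hDc.measurableSet)),
          lintegral_indicator (hs.diff hDc.measurableSet), setLIntegral_const]
    _ ≤ _ := by gcongr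

/-- Density of the Lipschitz functions with bounded support in `L¹`. -/
theorem exists_lipB_integral_sub_le {μ : Measure X} (hμ : FiniteOnBounded μ) {w : X → ℝ}
    (hw : Integrable w μ) {ε : ℝ} (hε : 0 < ε) :
    ∃ ψ : LipB X, IsLipBS ψ ∧ ∫ x, |w x - (ψ : X → ℝ) x| ∂μ ≤ ε := by
  obtain ⟨g, hg, ψ, hψ, rfl⟩ := MemLp.induction_dense (μ := μ) (p := 1) (by simp)
    (fun g : X → ℝ => ∃ ψ : LipB X, IsLipBS ψ ∧ (ψ : X → ℝ) = g)
    (fun c s hs hμs ε hε => by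
      obtain ⟨ψ, hψ, h⟩ := exists_lipB_eLpNorm_indicator_sub_le hμ c hs hμs hε
      exact ⟨_, h, ψ, hψ, rfl⟩)
    (by
      rintro _ _ ⟨φ, hφ, rfl⟩ ⟨ψ, hψ, rfl⟩
      exact ⟨φ + ψ, (hφ.union hψ).subset (Function.support_add _ _), rfl⟩)
    (by
      rintro _ ⟨φ, hφ, rfl⟩
      exact (continuous_lipB φ).aestronglyMeasurable)
    (memLp_one_iff_integrable.2 hw) (ε := ENNReal.ofReal ε) (by simpa using hε)
  refine ⟨ψ, hψ, ?_⟩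
  rw [eLpNorm_one_eq_lintegral_enorm] at hg
  have h1 : AEStronglyMeasurable (fun x => w x - (ψ : X → ℝ) x) μ :=
    hw.1.sub (continuous_lipB ψ).aestronglyMeasurable
  have h2 := integral_norm_eq_lintegral_enorm h1
  simp only [Real.norm_eq_abs] at h2
  rw [h2]
  exact ENNReal.toReal_le_of_le_ofReal hε.le hg

end Density

/-! ### Weak continuity of derivations with divergence -/

section Divergence

variable {X : Type*} [MetricSpace X] [MeasurableSpace X] [BorelSpace X]
  [SecondCountableTopology X] {m : Measure X} {L : LipB X →ₗ[ℝ] (X →ₘ[m] ℝ)} {h : X → ℝ}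

theorem IsLocalityBound.integrable_mul_isLipBS [Nonempty X] (hm : FiniteOnBounded m)
    (hh : IsLocalityBound m L h) (hl : L1Loc m h) (f : LipB X) {ψ : LipB X} (hψ : IsLipBS ψ) :
    Integrable (fun x => (ψ : X → ℝ) x * L f x) m := by
  obtain ⟨x₀⟩ := ‹Nonempty X›
  obtain ⟨R, hR⟩ := hψ.exists_ball x₀
  obtain ⟨K, hK, -⟩ := exists_lip_bound f
  obtain ⟨C, -, hC⟩ := exists_lip_bound ψ
  have hi := ((integrable_indicator_iff Metric.isOpen_ball.measurableSet).2 (hl x₀ R)).mul_const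
    ((C : ℝ) * K)
  refine hi.mono' ((continuous_lipB ψ).aestronglyMeasurable.mul (L f).aestronglyMeasurable) ?_
  filter_upwards [hh.abs_le_of_lipschitzWith hm f hK] with x hx
  by_cases hxR : x ∈ Metric.ball x₀ R
  · rw [indicator_of_mem hxR, norm_mul, Real.norm_eq_abs, Real.norm_eq_abs]
    calc _ ≤ (C : ℝ) * (h x * K) := by gcongr; exact hC x
      _ = _ := by ring
  · rw [Metric.mem_ball, not_lt] at hxR
    have h1 : x ∉ Metric.ball x₀ R := by simpa using hxR
    simp [(hR x hxR).1, h1]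

theorem IsLocalityBound.integrable_of_isLipBS [Nonempty X] (hm : FiniteOnBounded m)
    (hh : IsLocalityBound m L h) (hl : L1Loc m h) {ψ : LipB X} (hψ : IsLipBS ψ) :
    Integrable (L ψ) m := by
  obtain ⟨x₀⟩ := ‹Nonempty X›
  obtain ⟨R, hR⟩ := hψ.exists_ball x₀
  obtain ⟨K, hK, -⟩ := exists_lip_bound ψ
  have hi := ((integrable_indicator_iff Metric.isOpen_ball.measurableSet).2 (hl x₀ R)).mul_const
    (K : ℝ)
  refine hi.mono' (L ψ).aestronglyMeasurable ?_
  filter_upwards [hh.abs_le_asymLip hm ψ, hh.abs_le_of_lipschitzWith hm ψ hK] with x hx hx2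
  by_cases hxR : x ∈ Metric.ball x₀ R
  · rwa [indicator_of_mem hxR, Real.norm_eq_abs]
  · rw [Metric.mem_ball, not_lt] at hxR
    rw [(hR x hxR).2] at hx
    have h1 : x ∉ Metric.ball x₀ R := by simpa using hxR
    simpa [h1] using hx

/-- Continuity, under flat convergence, of a derivation with divergence, tested against Lipschitz
functions with bounded support. -/
theorem IsLocalityBound.tendsto_integral_mul_isLipBS [Nonempty X] (hm : FiniteOnBounded m)
    (hh : IsLocalityBound m L h) (hl : L1Loc m h) {g : X → ℝ} (hg : L1Loc m g)
    (hdiv : ∀ f : LipB X, IsLipBS f → -∫ x, L f x ∂m = ∫ x, (f : X → ℝ) x * g x ∂m)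
    {F : ℕ → LipB X} {f : LipB X} (hF : FlatTendsto m F f) {ψ : LipB X} (hψ : IsLipBS ψ) :
    Tendsto (fun k => ∫ x, (ψ : X → ℝ) x * L (F k) x ∂m) atTop
      (𝓝 (∫ x, (ψ : X → ℝ) x * L f x ∂m)) := by
  obtain ⟨x₀⟩ := id ‹Nonempty X›
  obtain ⟨R, hR⟩ := hψ.exists_ball x₀
  obtain ⟨C, -, hC⟩ := exists_lip_bound ψ
  obtain ⟨⟨B, hB⟩, hlim⟩ := hF
  have hgi : Integrable (fun x => (ψ : X → ℝ) x * g x) m := by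
    have hi := ((integrable_indicator_iff Metric.isOpen_ball.measurableSet).2 (hg x₀ R)).bdd_mul
      (f := (ψ : X → ℝ)) (c := C) (continuous_lipB ψ).aestronglyMeasurable
      (Eventually.of_forall hC)
    refine hi.congr (Eventually.of_forall fun x => ?_)
    by_cases hxR : x ∈ Metric.ball x₀ R
    · simp [hxR]
    · have h1 := hxR
      rw [Metric.mem_ball, not_lt] at hxR
      simp [h1, (hR x hxR).1]
  have hLi := hh.integrable_of_isLipBS hm hl hψ
  have hbs : ∀ u : LipB X, IsLipBS (mulLip u ψ) := fun u => hψ.subset fun x hx h0 => hx (by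
    simp [h0])
  -- The Leibniz rule and the divergence move the derivation off `u`. What remains are integrals of
  -- `u` against fixed integrable functions, which pass to flat limits by dominated convergence.
  have key : ∀ u : LipB X, ∫ x, (ψ : X → ℝ) x * L u x ∂m
      = -(∫ x, (u : X → ℝ) x * ((ψ : X → ℝ) x * g x) ∂m) - ∫ x, (u : X → ℝ) x * L ψ x ∂m := by
    intro u
    obtain ⟨K, -, hK⟩ := exists_lip_bound u
    have h1 : Integrable (fun x => (u : X → ℝ) x * L ψ x) m :=
      hLi.bdd_mul (c := K) (continuous_lipB u).aestronglyMeasurable (Eventually.of_forall hK)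
    have h2 := hh.integrable_mul_isLipBS hm hl u hψ
    have h3 := hdiv (mulLip u ψ) (hbs u)
    have h4 : ∫ x, L (mulLip u ψ) x ∂m
        = ∫ x, (u : X → ℝ) x * L ψ x ∂m + ∫ x, (ψ : X → ℝ) x * L u x ∂m := by
      rw [← integral_add h1 h2]
      exact integral_congr_ae (hh.map_mul hm u ψ)
    simp only [mulLip_apply, mul_assoc] at h3
    linarith
  have lim : ∀ w : X → ℝ, Integrable w m →
      Tendsto (fun k => ∫ x, (F k : X → ℝ) x * w x ∂m) atTop (𝓝 (∫ x, (f : X → ℝ) x * w x ∂m)) := by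
    intro w hw
    refine tendsto_integral_of_dominated_convergence (fun x => B * ‖w x‖)
      (fun k => (continuous_lipB (F k)).aestronglyMeasurable.mul hw.1) (hw.norm.const_mul _)
      (fun k => Eventually.of_forall fun x => ?_) ?_
    · rw [norm_mul]
      gcongr
      exact (hB k).2 x
    · filter_upwards [hlim] with x hx
      exact hx.mul_const _
  simp only [key]
  exact (lim _ hgi).neg.sub (lim _ hLi)

/-- Weak continuity, under flat convergence, of a derivation with divergence. -/
theorem IsLocalityBound.tendsto_integral_mul [Nonempty X] (hm : FiniteOnBounded m)
    (hh : IsLocalityBound m L h) (hl : L1Loc m h) {g : X → ℝ} (hg : L1Loc m g)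
    (hdiv : ∀ f : LipB X, IsLipBS f → -∫ x, L f x ∂m = ∫ x, (f : X → ℝ) x * g x ∂m)
    {F : ℕ → LipB X} {f : LipB X} (hF : FlatTendsto m F f) {H : X → ℝ≥0} (hH : Measurable H)
    (hFH : ∀ k, ∀ᵐ x ∂m, |L (F k) x| ≤ H x) (hfH : ∀ᵐ x ∂m, |L f x| ≤ H x) {c : ℝ}
    (hHh : ∀ᵐ x ∂m, H x ≤ c * h x) {w : X → ℝ} (hw : Integrable (fun x => H x * w x) m) :
    Tendsto (fun k => ∫ x, w x * L (F k) x ∂m) atTop (𝓝 (∫ x, w x * L f x ∂m)) := by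
  -- For the measure `H m`, the bound `|L u| ≤ H` makes `w ↦ ∫ w L u` continuous on `L¹`, uniformly
  -- in `u`. So it suffices to approximate `w` there by Lipschitz functions with bounded support; `H
  -- ≤ c h` makes this measure finite on bounded sets.
  set μ := m.withDensity fun x => (H x : ℝ≥0∞) with hμ
  have hμb : FiniteOnBounded μ := by
    intro s hs
    obtain ⟨x₀⟩ := id ‹Nonempty X›
    obtain ⟨R, hR⟩ := hs.subset_ball x₀
    refine (measure_mono hR).trans_lt ?_
    rw [hμ, withDensity_apply _ Metric.isOpen_ball.measurableSet]
    refine (lintegral_mono_ae (g := fun x => ‖c * h x‖ₑ) ?_).trans_lt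
      ((hl x₀ R).const_mul c).2
    filter_upwards [ae_restrict_of_ae hHh] with x hx
    rw [Real.enorm_eq_ofReal_abs, ← ENNReal.ofReal_coe_nnreal]
    exact ENNReal.ofReal_le_ofReal (hx.trans (le_abs_self _))
  have hint : ∀ v : X → ℝ, Integrable v μ ↔ Integrable (fun x => H x * v x) m := fun v =>
    integrable_withDensity_iff_integrable_coe_smul hH
  have hwμ : Integrable w μ := (hint w).2 hw
  have prod : ∀ u : LipB X, (∀ᵐ x ∂m, |L u x| ≤ H x) → ∀ v : X → ℝ, Integrable v μ →
      Integrable (fun x => v x * L u x) m ∧ |∫ x, v x * L u x ∂m| ≤ ∫ x, |v x| ∂μ := by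
    intro u hu v hv
    have h1 := (hint v).1 hv
    have hle : ∀ᵐ x ∂m, ‖v x * L u x‖ ≤ H x * |v x| := by
      filter_upwards [hu] with x hx
      rw [norm_mul, mul_comm, Real.norm_eq_abs, Real.norm_eq_abs]
      gcongr
    have h2 : Integrable (fun x => (H x : ℝ) * |v x|) m := by
      simpa [abs_mul] using h1.abs
    have h3 : AEStronglyMeasurable (fun x => v x * L u x) m := by
      -- Integrability for `H m` gives measurability of `H v` only; where `H = 0` the factor `L u`
      -- vanishes.
      have e : (fun x => v x * L u x) =ᵐ[m] fun x => (H x * v x) * (L u x / H x) := by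
        filter_upwards [hu] with x hx
        by_cases h0 : H x = 0
        · rw [h0, NNReal.coe_zero] at hx
          simp [h0, abs_nonpos_iff.1 hx]
        · have : (H x : ℝ) ≠ 0 := by exact_mod_cast h0
          field_simp
      exact (h1.1.mul ((L u).aestronglyMeasurable.mul
        hH.coe_nnreal_real.inv.aestronglyMeasurable)).congr e.symm
    refine ⟨h2.mono' h3 hle, ?_⟩
    rw [hμ, integral_withDensity_eq_integral_smul hH]
    refine (abs_integral_le_integral_abs).trans ?_
    refine integral_mono_of_nonneg (Eventually.of_forall fun x => abs_nonneg _) h2 ?_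
    filter_upwards [hle] with x hx
    exact hx
  rw [Metric.tendsto_atTop]
  intro ε hε
  obtain ⟨ψ, hψ, hψε⟩ := exists_lipB_integral_sub_le hμb hwμ (ε := ε / 4) (by positivity)
  have hψμ : Integrable (ψ : X → ℝ) μ := memLp_one_iff_integrable.1 (hψ.memLp hμb 1)
  obtain ⟨N, hN⟩ := Metric.tendsto_atTop.1
    (hh.tendsto_integral_mul_isLipBS hm hl hg hdiv hF hψ) (ε / 4) (by positivity)
  refine ⟨N, fun k hk => ?_⟩
  have est : ∀ u : LipB X, (∀ᵐ x ∂m, |L u x| ≤ H x) →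
      |∫ x, w x * L u x ∂m - ∫ x, (ψ : X → ℝ) x * L u x ∂m| ≤ ε / 4 := by
    intro u hu
    rw [← integral_sub (prod u hu w hwμ).1 (prod u hu ψ hψμ).1]
    simp only [← sub_mul]
    exact (prod u hu _ (hwμ.sub hψμ)).2.trans hψε
  have e1 := est (F k) (hFH k)
  have e2 := est f hfH
  have e3 := hN k hk
  rw [Real.dist_eq] at e3 ⊢
  rw [abs_le] at e1 e2
  rw [abs_lt] at e3 ⊢
  constructor <;> linarith [e1.1, e1.2, e2.1, e2.2, e3.1, e3.2]

end Divergence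

/-! ### Weak compactness and almost everywhere convergence -/

section FunctionalAnalysis

/-- In a reflexive space, a bounded sequence has a point which lies in the closed convex hull of
all its tails. -/
theorem exists_mem_closure_convexHull_of_reflexive {E : Type*} [NormedAddCommGroup E]
    [NormedSpace ℝ E] (hE : Function.Surjective (NormedSpace.inclusionInDoubleDual ℝ E))
    {u : ℕ → E} {M : ℝ} (hu : ∀ k, ‖u k‖ ≤ M) :
    ∃ v, ∀ N, v ∈ closure (convexHull ℝ (u '' Ici N)) := by
  have hmem : ∀ k, StrongDual.toWeakDual (NormedSpace.inclusionInDoubleDual ℝ E (u k))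
      ∈ (WeakDual.toStrongDual : WeakDual ℝ (StrongDual ℝ E) → _) ⁻¹' Metric.closedBall 0 M := by
    intro k
    refine (mem_closedBall_zero_iff (E := StrongDual ℝ (StrongDual ℝ E))).2 ?_
    exact (NormedSpace.double_dual_bound ℝ E (u k)).trans (hu k)
  -- Banach–Alaoglu in the bidual. A cluster point suffices in place of a convergent subsequence:
  -- each functional comes frequently within `ε` of its value at that point.
  obtain ⟨Φ, -, hΦ⟩ := (WeakDual.isCompact_closedBall (𝕜 := ℝ) (E := StrongDual ℝ E) 0 M)
    |>.exists_mapClusterPt_of_frequently (l := atTop)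
      (Eventually.of_forall hmem).frequently
  obtain ⟨v, hv⟩ := hE (WeakDual.toStrongDual Φ)
  refine ⟨v, fun N => mem_closure_of_forall_dual_lt (convex_convexHull ℝ _) fun l ε hε => ?_⟩
  have hl := MapClusterPt.continuousAt_comp
    (WeakDual.eval_continuous (𝕜 := ℝ) (E := StrongDual ℝ E) l).continuousAt hΦ
  have hΦl : Φ l = l v := by
    have := congrArg (fun ψ : StrongDual ℝ (StrongDual ℝ E) => ψ l) hv
    exact this.symm
  have hlt : Φ l < l v + ε := by rw [hΦl]; linarith
  have hfr := hl.frequently (gt_mem_nhds hlt)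
  obtain ⟨n, hn, hlt⟩ := (frequently_atTop.1 hfr) N
  exact ⟨u n, subset_convexHull ℝ _ (mem_image_of_mem _ hn), hlt⟩

/-- The series of the squared functions has finite integral, so its terms vanish in the limit almost
everywhere. A geometric rate thus replaces the passage to a subsequence. -/
theorem ae_tendsto_zero_of_norm_le {α : Type*} [MeasurableSpace α] {μ : Measure α}
    {v : ℕ → Lp ℝ 2 μ} (hv : ∀ j, ‖v j‖ ≤ (1 / 2 : ℝ) ^ j) :
    ∀ᵐ x ∂μ, Tendsto (fun j => v j x) atTop (𝓝 0) := by
  have hmeas : ∀ j, AEMeasurable (fun x => ‖v j x‖ₑ ^ 2) μ := fun j =>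
    (Lp.aestronglyMeasurable (v j)).enorm.pow_const 2
  have hsum : ∫⁻ x, ∑' j, ‖v j x‖ₑ ^ 2 ∂μ ≠ ∞ := by
    rw [lintegral_tsum hmeas]
    have hle : ∀ j, ∫⁻ x, ‖v j x‖ₑ ^ 2 ∂μ ≤ (2⁻¹ : ℝ≥0∞) ^ j := by
      intro j
      have h := eLpNorm_nnreal_pow_eq_lintegral (f := (v j : α → ℝ)) (μ := μ) (p := 2)
        (by norm_num)
      have h2 : eLpNorm (v j) 2 μ ≤ (2⁻¹ : ℝ≥0∞) ^ j := by
        have h3 := hv j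
        rw [Lp.norm_def] at h3
        rw [← ENNReal.ofReal_toReal (Lp.eLpNorm_ne_top (v j))]
        refine (ENNReal.ofReal_le_ofReal h3).trans (le_of_eq ?_)
        rw [ENNReal.ofReal_pow (by norm_num), one_div, ENNReal.ofReal_inv_of_pos (by norm_num),
          ENNReal.ofReal_ofNat]
      have h4 : (2⁻¹ : ℝ≥0∞) ^ j ≤ 1 := pow_le_one₀ bot_le (by simp)
      have h5 : ∫⁻ x, ‖v j x‖ₑ ^ 2 ∂μ = eLpNorm (v j) 2 μ ^ 2 := by simpa using h.symm
      rw [h5, sq]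
      calc _ ≤ (2⁻¹ : ℝ≥0∞) ^ j * 1 := mul_le_mul' h2 (h2.trans h4)
        _ = _ := mul_one _
    refine ((ENNReal.tsum_le_tsum hle).trans_lt ?_).ne
    rw [ENNReal.tsum_geometric]
    simp
  filter_upwards [ae_lt_top' (AEMeasurable.tsum hmeas) hsum] with x hx
  have h1 := ENNReal.tendsto_atTop_zero_of_tsum_ne_top hx.ne
  rw [ENNReal.tendsto_nhds_zero] at h1
  rw [Metric.tendsto_atTop]
  intro ε hε
  obtain ⟨N, hN⟩ := eventually_atTop.1 (h1 (ENNReal.ofReal ((ε / 2) ^ 2)) (by positivity))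
  refine ⟨N, fun n hn => ?_⟩
  have h2 := hN n hn
  rw [ENNReal.ofReal_pow (by positivity), ENNReal.pow_le_pow_left_iff (by norm_num),
    Real.enorm_eq_ofReal_abs, ENNReal.ofReal_le_ofReal_iff (by positivity)] at h2
  rw [Real.dist_eq, sub_zero]
  linarith

end FunctionalAnalysis

/-! ### Flat limits when `H^{1,2}` is reflexive -/

section Reflexive

variable {X : Type*} [MetricSpace X] [MeasurableSpace X] [BorelSpace X]
  [SecondCountableTopology X] {m : Measure X}

theorem cheeger_toLp_lt_top [Nonempty X] (hm : FiniteOnBounded m) {φ : LipB X} (hφ : IsLipBS φ) :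
    cheeger m ((hφ.memLp hm 2).toLp (φ : X → ℝ)) < ∞ :=
  (cheeger_toLp_le φ.2 (hφ.memLp hm 2)).trans_lt
    (ENNReal.mul_lt_top (by simp) (hφ.lintegral_asymLip_sq_lt_top hm))

/-- Multiplication by a cutoff, as a map into the Sobolev space. -/
noncomputable def cutoffH12 [Nonempty X] (hm : FiniteOnBounded m) (x₀ : X) {R : ℝ} (hR : 0 < R) :
    LipB X →ₗ[ℝ] SobolevH12 m where
  toFun f := ⟨((isLipBS_mul_bump f x₀ hR).memLp hm 2).toLp _,
    cheeger_toLp_lt_top hm (isLipBS_mul_bump f x₀ hR)⟩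
  map_add' f g := by
    apply Subtype.ext
    change ((isLipBS_mul_bump (f + g) x₀ hR).memLp hm 2).toLp _
      = ((isLipBS_mul_bump f x₀ hR).memLp hm 2).toLp _
      + ((isLipBS_mul_bump g x₀ hR).memLp hm 2).toLp _
    rw [← MemLp.toLp_add]
    exact MemLp.toLp_congr _ _ (Eventually.of_forall fun x => by simp [add_mul])
  map_smul' c f := by
    apply Subtype.ext
    change ((isLipBS_mul_bump (c • f) x₀ hR).memLp hm 2).toLp _
      = c • ((isLipBS_mul_bump f x₀ hR).memLp hm 2).toLp _
    rw [← MemLp.toLp_const_smul]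
    exact MemLp.toLp_congr _ _ (Eventually.of_forall fun x => by simp [mul_assoc])

theorem cutoffH12_toLp [Nonempty X] (hm : FiniteOnBounded m) (x₀ : X) {R : ℝ} (hR : 0 < R)
    (f : LipB X) : (cutoffH12 hm x₀ hR f).toLp
      = ((isLipBS_mul_bump f x₀ hR).memLp hm 2).toLp _ := rfl

theorem norm_toLp_le (u : SobolevH12 m) : ‖u.toLp‖ ≤ ‖u‖ := by
  rw [SobolevH12.norm_def]
  refine Real.le_sqrt_of_sq_le ?_
  have : 0 ≤ 2 * (cheeger m u.toLp).toReal := by positivity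
  linarith

theorem two_mul_cheeger_le (u : SobolevH12 m) : 2 * (cheeger m u.toLp).toReal ≤ ‖u‖ ^ 2 := by
  rw [SobolevH12.norm_def, Real.sq_sqrt (by positivity)]
  linarith [sq_nonneg ‖u.toLp‖]

/-- The bound depends on the sup norm and Lipschitz constant only, hence is uniform along a flat
convergent sequence. -/
theorem exists_norm_cutoffH12_le [Nonempty X] (hm : FiniteOnBounded m) (x₀ : X) {R : ℝ}
    (hR : 0 < R) (C : ℝ≥0) :
    ∃ M : ℝ, ∀ f : LipB X, LipschitzWith C (f : X → ℝ) → (∀ x, |(f : X → ℝ) x| ≤ C) →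
      ‖cutoffH12 hm x₀ hR f‖ ≤ M := by
  set S := Metric.ball x₀ (2 * R + 1) with hS
  -- Leibniz bound for the slope: `C` from `f`, and the sup norm `C` times the Lipschitz constant `1
  -- / R` of the cutoff. It also bounds the cut-off function itself.
  set D : ℝ≥0 := C + C * Real.toNNReal R⁻¹ with hD
  have hSfin : m S < ∞ := hm _ Metric.isBounded_ball
  set A : ℝ≥0∞ := (D : ℝ≥0∞) ^ 2 * m S with hA
  have hAfin : A < ∞ := ENNReal.mul_lt_top (by simp) hSfin
  refine ⟨Real.sqrt (A.toReal + A.toReal), fun f hf hfC => ?_⟩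
  set φ := mulLip f (bump x₀ hR) with hφ
  have hbs := isLipBS_mul_bump f x₀ hR
  have hfar : ∀ x, x ∉ S → (φ : X → ℝ) x = 0 ∧ asymLip (φ : X → ℝ) x = 0 := by
    intro x hx
    rw [hS, Metric.mem_ball, not_lt] at hx
    refine ⟨by rw [hφ, mulLip_apply, bump_eq_zero hR (by linarith), mul_zero], ?_⟩
    rw [asymLip_congr (g := fun _ => 0), asymLip_const]
    filter_upwards [Metric.ball_mem_nhds x one_pos] with y hy
    have h1 := dist_triangle x y x₀
    rw [dist_comm x y] at h1
    have h2 := Metric.mem_ball.1 hy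
    rw [hφ, mulLip_apply, bump_eq_zero hR (by linarith), mul_zero]
  have bound : ∀ q : X → ℝ≥0∞, (∀ x, q x ≤ D) → (∀ x, x ∉ S → q x = 0) →
      ∫⁻ x, q x ^ 2 ∂m ≤ A := by
    intro q hq hq0
    rw [hA, ← setLIntegral_const, ← lintegral_indicator Metric.isOpen_ball.measurableSet]
    refine lintegral_mono fun x => ?_
    by_cases hx : x ∈ S
    · rw [indicator_of_mem hx]
      gcongr
      exact hq x
    · simp [hq0 x hx]
  have hb1 : ∀ x, ‖(bump x₀ hR : X → ℝ) x‖ₑ ≤ 1 := fun x => by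
    rw [Real.enorm_of_nonneg (bump_mem_Icc x₀ hR x).1, ← ENNReal.ofReal_one]
    exact ENNReal.ofReal_le_ofReal (bump_mem_Icc x₀ hR x).2
  have hfe : ∀ x, ‖(f : X → ℝ) x‖ₑ ≤ C := fun x => by
    rw [Real.enorm_eq_ofReal_abs, ← ENNReal.ofReal_coe_nnreal]
    exact ENNReal.ofReal_le_ofReal (hfC x)
  have i1 : ∫⁻ x, ‖(φ : X → ℝ) x‖ₑ ^ 2 ∂m ≤ A := by
    refine bound _ (fun x => ?_) fun x hx => by simp [(hfar x hx).1]
    rw [hφ, mulLip_apply, enorm_mul]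
    calc _ ≤ (C : ℝ≥0∞) * 1 := mul_le_mul' (hfe x) (hb1 x)
      _ ≤ D := by rw [mul_one]; exact_mod_cast le_self_add
  have i2 : ∫⁻ x, asymLip (φ : X → ℝ) x ^ 2 ∂m ≤ A := by
    refine bound _ (fun x => ?_) fun x hx => (hfar x hx).2
    refine (asymLip_mul_le (asymLip_lipB_ne_top f x) (asymLip_lipB_ne_top _ x)).trans ?_
    calc _ ≤ (C : ℝ≥0∞) * (Real.toNNReal R⁻¹ : ℝ≥0) + 1 * C := by
          gcongr
          · exact hfe x
          · exact asymLip_le_of_lipschitzWith (lipschitzWith_bump x₀ hR) x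
          · exact hb1 x
          · exact asymLip_le_of_lipschitzWith hf x
      _ = D := by rw [hD, one_mul, add_comm]; push_cast; rfl
  rw [SobolevH12.norm_def, cutoffH12_toLp]
  refine Real.sqrt_le_sqrt (add_le_add ?_ ?_)
  · have h1 := lintegral_enorm_sq_eq ((hbs.memLp hm 2).toLp (φ : X → ℝ))
    have h2 : ∫⁻ x, ‖((hbs.memLp hm 2).toLp (φ : X → ℝ)) x‖ₑ ^ 2 ∂m
        = ∫⁻ x, ‖(φ : X → ℝ) x‖ₑ ^ 2 ∂m := by
      refine lintegral_congr_ae ?_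
      filter_upwards [(hbs.memLp hm 2).coeFn_toLp] with x hx
      rw [hx]
    rw [h2] at h1
    exact (ENNReal.ofReal_le_iff_le_toReal hAfin.ne).1 (h1.symm.le.trans i1)
  · have h1 := (cheeger_toLp_le φ.2 (hbs.memLp hm 2)).trans (mul_le_mul_right i2 2⁻¹)
    have h2 := ENNReal.toReal_mono (ENNReal.mul_lt_top (by simp) hAfin).ne h1
    rw [ENNReal.toReal_mul] at h2
    simp only [ENNReal.toReal_inv, ENNReal.toReal_ofNat] at h2
    linarith

/-- Strong `L²` convergence identifies the weak limit that reflexivity produces in the Sobolev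
space. -/
theorem tendsto_cutoffH12_toLp [Nonempty X] (hm : FiniteOnBounded m) (x₀ : X) {R : ℝ}
    (hR : 0 < R) {F : ℕ → LipB X} {f : LipB X} (hF : FlatTendsto m F f) :
    Tendsto (fun k => ‖(cutoffH12 hm x₀ hR (F k)).toLp - (cutoffH12 hm x₀ hR f).toLp‖) atTop
      (𝓝 0) := by
  obtain ⟨⟨C, hC⟩, hlim⟩ := hF
  obtain ⟨K, -, hK⟩ := exists_lip_bound f
  have hsq : Tendsto (fun k => ‖(cutoffH12 hm x₀ hR (F k)).toLp
      - (cutoffH12 hm x₀ hR f).toLp‖ ^ 2) atTop (𝓝 0) := by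
    have e : ∀ k, ‖(cutoffH12 hm x₀ hR (F k)).toLp - (cutoffH12 hm x₀ hR f).toLp‖ ^ 2
        = ∫ x, (((F k : X → ℝ) x - (f : X → ℝ) x) * (bump x₀ hR : X → ℝ) x) ^ 2 ∂m := by
      intro k
      rw [norm_sq_eq_integral, cutoffH12_toLp, cutoffH12_toLp]
      refine integral_congr_ae ?_
      filter_upwards [Lp.coeFn_sub (((isLipBS_mul_bump (F k) x₀ hR).memLp hm 2).toLp _)
        (((isLipBS_mul_bump f x₀ hR).memLp hm 2).toLp _),
        ((isLipBS_mul_bump (F k) x₀ hR).memLp hm 2).coeFn_toLp,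
        ((isLipBS_mul_bump f x₀ hR).memLp hm 2).coeFn_toLp] with x h1 h2 h3
      rw [h1, Pi.sub_apply, h2, h3, mulLip_apply, mulLip_apply, sub_mul]
    simp only [e]
    have h0 : ∫ _x, (0 : ℝ) ∂m = 0 := by simp
    rw [← h0]
    refine tendsto_integral_of_dominated_convergence
      ((Metric.ball x₀ (2 * R)).indicator fun _ => ((C : ℝ) + K) ^ 2) (fun k => ?_) ?_
      (fun k => Eventually.of_forall fun x => ?_) ?_
    · exact ((((continuous_lipB (F k)).sub (continuous_lipB f)).mul
        (continuous_lipB (bump x₀ hR))).pow 2).aestronglyMeasurable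
    · exact (integrable_indicator_iff Metric.isOpen_ball.measurableSet).2
        (integrableOn_const (hm _ Metric.isBounded_ball).ne)
    · rw [Real.norm_of_nonneg (sq_nonneg _)]
      by_cases hx : x ∈ Metric.ball x₀ (2 * R)
      · rw [indicator_of_mem hx, ← sq_abs, abs_mul, abs_of_nonneg (bump_mem_Icc x₀ hR x).1]
        have h1 : |(F k : X → ℝ) x - (f : X → ℝ) x| ≤ (C : ℝ) + K :=
          (abs_sub _ _).trans (add_le_add ((hC k).2 x) (hK x))
        exact pow_le_pow_left₀ (mul_nonneg (abs_nonneg _) (bump_mem_Icc x₀ hR x).1)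
          ((mul_le_of_le_one_right (abs_nonneg _) (bump_mem_Icc x₀ hR x).2).trans h1) 2
      · have hx' := hx
        rw [Metric.mem_ball, not_lt] at hx
        simp [bump_eq_zero hR hx, hx']
    · filter_upwards [hlim] with x hx
      simpa using ((hx.sub_const ((f : X → ℝ) x)).mul_const ((bump x₀ hR : X → ℝ) x)).pow 2
  have := hsq.sqrt
  simpa [Real.sqrt_sq (norm_nonneg _)] using this

/-- If `H^{1,2}` is reflexive and `F k → f` in the flat sense, then convex combinations of the
tails of `F` converge so strongly that all derivations pass to the limit. -/
theorem exists_convexHull_tendsto_of_reflexive [Nonempty X] (hm : FiniteOnBounded m)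
    (hrefl : IsReflexiveH12 m) {F : ℕ → LipB X} {f : LipB X} (hF : FlatTendsto m F f) (x₀ : X)
    {R : ℝ} (hR : 0 < R) :
    ∃ G : ℕ → LipB X, (∀ j, G j ∈ convexHull ℝ (F '' Ici j)) ∧
      ∀ b : Der m, ∀ᵐ x ∂m, x ∈ Metric.ball x₀ R →
        Tendsto (fun j => b.toLin (G j) x) atTop (𝓝 (b.toLin f x)) := by
  set Λ := cutoffH12 hm x₀ hR with hΛ
  obtain ⟨C, hC⟩ := hF.1
  obtain ⟨M, hM⟩ := exists_norm_cutoffH12_le hm x₀ hR C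
  obtain ⟨v, hv⟩ := exists_mem_closure_convexHull_of_reflexive hrefl
    (u := fun k => Λ (F k)) (fun k => hM (F k) (hC k).1 (hC k).2)
  have hlim := tendsto_cutoffH12_toLp hm x₀ hR hF
  have hvf : v = Λ f := by
    apply Subtype.ext
    change v.toLp = (Λ f).toLp
    rw [← sub_eq_zero, ← norm_le_zero_iff]
    refine le_of_forall_pos_le_add fun ε hε => ?_
    rw [zero_add]
    -- The `L²` ball of radius `ε` around the expected limit is convex and closed in `H^{1,2}`; it
    -- contains a tail of the sequence, hence also `v`.
    obtain ⟨N, hN⟩ := eventually_atTop.1 (hlim.eventually_le_const hε)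
    have hconv : Convex ℝ {w : SobolevH12 m | ‖w.toLp - (Λ f).toLp‖ ≤ ε} := by
      have h1 := convex_closedBall (Λ f).toLp ε
      intro w hw z hz a b ha hb hab
      have h2 := h1 (mem_closedBall_iff_norm.2 hw) (mem_closedBall_iff_norm.2 hz) ha hb hab
      exact mem_closedBall_iff_norm.1 h2
    have hclosed : IsClosed {w : SobolevH12 m | ‖w.toLp - (Λ f).toLp‖ ≤ ε} := by
      refine isClosed_le (Continuous.norm (Continuous.sub ?_ continuous_const)) continuous_const
      refine LipschitzWith.continuous (K := 1) (LipschitzWith.of_dist_le_mul fun w z => ?_)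
      rw [dist_eq_norm, dist_eq_norm, NNReal.coe_one, one_mul]
      exact norm_toLp_le (w - z)
    refine closure_minimal (convexHull_min ?_ hconv) hclosed (hv N)
    rintro _ ⟨k, hk, rfl⟩
    exact hN k hk
  -- The cutoff map is linear, so convex combinations in the Sobolev space come from convex
  -- combinations of the `F k`. They are chosen before any derivation, so the same ones serve every
  -- time `t`.
  have hex : ∀ j : ℕ, ∃ G ∈ convexHull ℝ (F '' Ici j), ‖Λ (G - f)‖ < (1 / 2 : ℝ) ^ j := by
    intro j
    obtain ⟨w, hw, hd⟩ := Metric.mem_closure_iff.1 (hv j) ((1 / 2 : ℝ) ^ j) (by positivity)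
    have himg : (fun k => Λ (F k)) '' Ici j = Λ '' (F '' Ici j) := by
      rw [image_image]
    rw [himg, ← LinearMap.image_convexHull] at hw
    obtain ⟨G, hG, rfl⟩ := hw
    refine ⟨G, hG, ?_⟩
    rwa [map_sub, ← hvf, ← dist_eq_norm, dist_comm]
  choose G hG hGn using hex
  refine ⟨G, hG, fun b => ?_⟩
  have hbs := fun j => isLipBS_mul_bump (G j - f) x₀ hR
  choose s hs hsn _ using fun j => exists_minimalRelaxedSlope hm (mulLip (G j - f) (bump x₀ hR)).2
    ((hbs j).memLp hm 2) ((hbs j).lintegral_asymLip_sq_lt_top hm)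
  have hs0 := ae_tendsto_zero_of_norm_le (v := s) fun j => by
    have h1 := (hsn j).trans (two_mul_cheeger_le (Λ (G j - f)))
    exact (le_of_sq_le_sq h1 (norm_nonneg _)).trans (hGn j).le
  obtain ⟨h, hh⟩ := b.locality
  have hbd : ∀ j, ∀ᵐ x ∂m, x ∈ Metric.ball x₀ R →
      |b.toLin (G j) x - b.toLin f x| ≤ h x * s j x := by
    intro j
    have heq : EqOn ((G j - f : LipB X) : X → ℝ) (mulLip (G j - f) (bump x₀ hR))
        (Metric.ball x₀ R) := fun x hx => by
      rw [mulLip_apply, bump_eq_one hR (Metric.mem_ball.1 hx).le, mul_one]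
    filter_upwards [hh.2.2 (G j - f) x₀ R (s j) ⟨_, hbs j, heq, hs j⟩,
      coeFn_map_sub b.toLin (G j) f] with x h1 h2 hx
    rw [← h2]
    exact h1 hx
  filter_upwards [ae_all_iff.2 hbd, hs0] with x h1 h2 hx
  have h3 : Tendsto (fun j => h x * s j x) atTop (𝓝 0) := by simpa using h2.const_mul (h x)
  rw [tendsto_iff_norm_sub_tendsto_zero]
  exact squeeze_zero (fun j => norm_nonneg _) (fun j => h1 j hx) h3

end Reflexive

/-! ### Flat limits when there is a divergence -/

section DivergenceFamily

variable {X : Type*} [MetricSpace X] [MeasurableSpace X] [BorelSpace X]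
  [SecondCountableTopology X] {m : Measure X} {T : ℝ} {b : ℝ → Der m}

theorem lipschitzWith_abs_le_of_mem_convexHull {S : Set (LipB X)} {C : ℝ≥0}
    (hS : ∀ F ∈ S, LipschitzWith C (F : X → ℝ) ∧ ∀ x, |(F : X → ℝ) x| ≤ C) {G : LipB X}
    (hG : G ∈ convexHull ℝ S) : LipschitzWith C (G : X → ℝ) ∧ ∀ x, |(G : X → ℝ) x| ≤ C := by
  have hconv : Convex ℝ {G : LipB X | LipschitzWith C (G : X → ℝ) ∧
      ∀ x, |(G : X → ℝ) x| ≤ C} := by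
    rintro u ⟨hu, hu'⟩ v ⟨hv, hv'⟩ a c ha hc hac
    refine ⟨LipschitzWith.of_dist_le_mul fun x y => ?_, fun x => ?_⟩
    · have h1 := hu.dist_le_mul x y
      have h2 := hv.dist_le_mul x y
      rw [Real.dist_eq] at h1 h2 ⊢
      simp only [Submodule.coe_add, Submodule.coe_smul, Pi.add_apply, Pi.smul_apply, smul_eq_mul]
      calc _ = |a * ((u : X → ℝ) x - (u : X → ℝ) y) + c * ((v : X → ℝ) x - (v : X → ℝ) y)| := by
            ring_nf
        _ ≤ a * (C * dist x y) + c * (C * dist x y) := by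
            refine (abs_add_le _ _).trans ?_
            rw [abs_mul, abs_mul, abs_of_nonneg ha, abs_of_nonneg hc]
            gcongr
        _ = _ := by rw [← add_mul, hac, one_mul]
    · simp only [Submodule.coe_add, Submodule.coe_smul, Pi.add_apply, Pi.smul_apply, smul_eq_mul]
      calc _ ≤ a * C + c * C := by
            refine (abs_add_le _ _).trans ?_
            rw [abs_mul, abs_mul, abs_of_nonneg ha, abs_of_nonneg hc]
            gcongr
            · exact hu' x
            · exact hv' x
        _ = _ := by rw [← add_mul, hac, one_mul]
  exact convexHull_min hS hconv hG

/-- Borel representatives of derivations are uniformly dominated along flat convergent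
sequences. -/
theorem exists_dominating [Nonempty X] (hm : FiniteOnBounded m) (hb : IsBorelFamily T b)
    {B : ℕ → ℝ → X → ℝ} {F : ℕ → LipB X} {B₀ : ℝ → X → ℝ} {f : LipB X}
    (hB : ∀ k, IsBorelRep T b (F k) (B k)) (hB₀ : IsBorelRep T b f B₀) {C : ℝ≥0}
    (hF : ∀ k, LipschitzWith C (F k : X → ℝ)) :
    ∃ H : ℝ → X → ℝ≥0, Measurable (Function.uncurry H) ∧
      ∀ᵐ t ∂(volume.restrict (Ioo 0 T)), ∃ h, IsLocalityBound m (b t).toLin h ∧ L1Loc m h ∧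
        (∀ᵐ x ∂m, (∀ k, |(b t).toLin (F k) x| ≤ H t x) ∧ |(b t).toLin f x| ≤ H t x) ∧
        ∃ c : ℝ, ∀ᵐ x ∂m, H t x ≤ c * h x := by
  obtain ⟨K, hK, -⟩ := exists_lip_bound f
  -- A countable supremum of Borel representatives is jointly measurable, whereas the local norms
  -- are given separately for each `t`, with no measurability in time.
  set S : ℝ × X → ℝ≥0∞ := fun p => (⨆ k, ‖B k p.1 p.2‖ₑ) + ‖B₀ p.1 p.2‖ₑ with hS
  have hSm : Measurable S :=
    (Measurable.iSup fun k => (hB k).1.enorm).add hB₀.1.enorm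
  refine ⟨fun t x => (S (t, x)).toNNReal, hSm.ennreal_toNNReal, ?_⟩
  filter_upwards [hb.1, ae_all_iff.2 fun k => (hB k).2, hB₀.2] with t ht h1 h2
  obtain ⟨h, hh, hl⟩ := ht
  refine ⟨h, hh.1, hl, ?_⟩
  have key : ∀ᵐ x ∂m, S (t, x) ≤ ENNReal.ofReal (((C : ℝ) + K) * h x) ∧
      (∀ k, B k t x = (b t).toLin (F k) x) ∧ B₀ t x = (b t).toLin f x := by
    filter_upwards [ae_all_iff.2 fun k => hh.1.abs_le_of_lipschitzWith hm (F k) (hF k),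
      hh.1.abs_le_of_lipschitzWith hm f hK, ae_all_iff.2 h1, h2] with x a1 a2 a3 a4
    refine ⟨?_, a3, a4⟩
    have hx := hh.1.2.1 x
    rw [add_mul, ENNReal.ofReal_add (by positivity) (by positivity)]
    refine add_le_add (iSup_le fun k => ?_) ?_
    · rw [Real.enorm_eq_ofReal_abs, a3 k, mul_comm]
      exact ENNReal.ofReal_le_ofReal (a1 k)
    · rw [Real.enorm_eq_ofReal_abs, a4, mul_comm]
      exact ENNReal.ofReal_le_ofReal a2
  refine ⟨?_, (C : ℝ) + K, ?_⟩
  · filter_upwards [key] with x hx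
    have hfin : S (t, x) ≠ ∞ := ne_top_of_le_ne_top ENNReal.ofReal_ne_top hx.1
    have conv : ∀ r : ℝ, ‖r‖ₑ ≤ S (t, x) → |r| ≤ (S (t, x)).toNNReal := by
      intro r hr
      have := ENNReal.toReal_mono hfin hr
      rwa [toReal_enorm, Real.norm_eq_abs] at this
    refine ⟨fun k => ?_, ?_⟩
    · rw [← hx.2.1 k]
      exact conv _ ((le_iSup (fun k => ‖B k t x‖ₑ) k).trans le_self_add)
    · rw [← hx.2.2]
      exact conv _ le_add_self
  · filter_upwards [key] with x hx
    have := hh.1.2.1 x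
    exact ENNReal.toReal_le_of_le_ofReal (by positivity) hx.1

/-- Mazur's lemma at each fixed time would give combinations depending on `t`; applied in an `L²`
space over space-time it gives one sequence for almost every time. Division by `1 + H` makes the
functions bounded and the density `ρ` makes the measure finite, so they lie in `L²`; both factors
are positive and do not affect convergence almost everywhere. -/
theorem exists_convexHull_tendsto_of_divergence [Nonempty X] (hm : FiniteOnBounded m)
    (hb : IsBorelFamily T b) {g : ℝ → X → ℝ}
    (hg : ∀ᵐ t ∂(volume.restrict (Ioo 0 T)), (b t).IsDivergence (g t))
    {F : ℕ → LipB X} {f : LipB X} (hF : FlatTendsto m F f) :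
    ∃ G : ℕ → LipB X, (∀ j, G j ∈ convexHull ℝ (F '' Ici j)) ∧
      ∀ᵐ t ∂(volume.restrict (Ioo 0 T)), ∀ᵐ x ∂m,
        Tendsto (fun j => (b t).toLin (G j) x) atTop (𝓝 ((b t).toLin f x)) := by
  have := hm.isLocallyFinite
  choose B hB using fun k => hb.2 (F k)
  obtain ⟨B₀, hB₀⟩ := hb.2 f
  obtain ⟨C, hC⟩ := id hF.1
  obtain ⟨H, hHm, hH⟩ := exists_dominating hm hb hB hB₀ fun k => (hC k).1
  set ν := (volume.restrict (Ioo 0 T)).prod m with hν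
  obtain ⟨ρ, hρ0, hρm, hρ⟩ := exists_pos_lintegral_lt_of_sigmaFinite ν (ε := 1) one_ne_zero
  set μ := ν.withDensity fun p => (ρ p : ℝ≥0∞) with hμ
  have hμfin : IsFiniteMeasure μ := ⟨by
    rw [hμ, withDensity_apply _ MeasurableSet.univ, Measure.restrict_univ]
    exact hρ.trans ENNReal.one_lt_top⟩
  have hνμ : ν ≪ μ := withDensity_absolutelyContinuous' hρm.coe_nnreal_ennreal.aemeasurable
    (Eventually.of_forall fun p => by simpa using (hρ0 p).ne')
  have hμν : μ ≪ ν := withDensity_absolutelyContinuous _ _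
  have hlift : ∀ {p : ℝ × X → Prop}, (∀ᵐ z ∂μ, p z) →
      ∀ᵐ t ∂(volume.restrict (Ioo 0 T)), ∀ᵐ x ∂m, p (t, x) := fun hp =>
    Measure.ae_ae_of_ae_prod (hνμ.ae_le hp)
  -- the normalized representatives
  have hnorm : ∀ (A : ℝ → X → ℝ) (u : LipB X), IsBorelRep T b u A →
      (∀ᵐ t ∂(volume.restrict (Ioo 0 T)), ∀ᵐ x ∂m, |(b t).toLin u x| ≤ H t x) →
      ∃ v : Lp ℝ 2 μ, (∀ᵐ t ∂(volume.restrict (Ioo 0 T)), ∀ᵐ x ∂m,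
        v (t, x) = (1 + (H t x : ℝ))⁻¹ * (b t).toLin u x) ∧
        ∀ᵐ z ∂μ, v z = (1 + (H z.1 z.2 : ℝ))⁻¹ * A z.1 z.2 := by
    intro A u hA hu
    have hmeas : Measurable fun z : ℝ × X => (1 + (H z.1 z.2 : ℝ))⁻¹ * A z.1 z.2 :=
      ((measurable_const.add hHm.coe_nnreal_real).inv).mul hA.1
    have hmem : MemLp (fun z : ℝ × X => (1 + (H z.1 z.2 : ℝ))⁻¹ * A z.1 z.2) 2 μ := by
      refine MemLp.of_bound hmeas.aestronglyMeasurable 1 (hμν.ae_le ?_)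
      refine (Measure.ae_prod_iff_ae_ae (measurableSet_le hmeas.norm measurable_const)).2 ?_
      filter_upwards [hA.2, hu] with t h1 h2
      filter_upwards [h1, h2] with x h3 h4
      rw [h3, norm_mul, norm_inv, Real.norm_of_nonneg (by positivity), Real.norm_eq_abs,
        inv_mul_le_iff₀ (by positivity)]
      linarith
    refine ⟨hmem.toLp _, ?_, hmem.coeFn_toLp⟩
    filter_upwards [hlift hmem.coeFn_toLp, hA.2] with t h1 h2
    filter_upwards [h1, h2] with x h3 h4
    rw [h3, h4]
  have hHk : ∀ k, ∀ᵐ t ∂(volume.restrict (Ioo 0 T)), ∀ᵐ x ∂m,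
      |(b t).toLin (F k) x| ≤ H t x := fun k => by
    filter_upwards [hH] with t ⟨h, _, _, h1, _⟩
    filter_upwards [h1] with x hx using hx.1 k
  have hH0 : ∀ᵐ t ∂(volume.restrict (Ioo 0 T)), ∀ᵐ x ∂m,
      |(b t).toLin f x| ≤ H t x := by
    filter_upwards [hH] with t ⟨h, _, _, h1, _⟩
    filter_upwards [h1] with x hx using hx.2
  choose v hv hvB using fun k => hnorm (B k) (F k) (hB k) (hHk k)
  obtain ⟨v₀, hv₀, hvB₀⟩ := hnorm B₀ f hB₀ hH0
  set A : ℕ → Set (Lp ℝ 2 μ) := fun j => {w | ∃ G ∈ convexHull ℝ (F '' Ici j),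
    ∀ᵐ t ∂(volume.restrict (Ioo 0 T)), ∀ᵐ x ∂m,
      w (t, x) = (1 + (H t x : ℝ))⁻¹ * (b t).toLin G x} with hA
  have hAconv : ∀ j, Convex ℝ (A j) := by
    rintro j w ⟨G, hG, hw⟩ w' ⟨G', hG', hw'⟩ a c ha hc hac
    refine ⟨a • G + c • G', convex_convexHull ℝ _ hG hG' ha hc hac, ?_⟩
    filter_upwards [hw, hw', hlift (Lp.coeFn_add (a • w) (c • w')), hlift (Lp.coeFn_smul a w),
      hlift (Lp.coeFn_smul c w')] with t h1 h2 h3 h4 h5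
    filter_upwards [h1, h2, h3, h4, h5, coeFn_map_add (b t).toLin (a • G) (c • G'),
      coeFn_map_smul (b t).toLin a G, coeFn_map_smul (b t).toLin c G'] with x e1 e2 e3 e4 e5 e6 e7 e8
    rw [e3, Pi.add_apply, e4, e5, e6, e7, e8, Pi.smul_apply, Pi.smul_apply, e1, e2]
    simp only [smul_eq_mul]
    ring
  have hweak : ∀ ψ : Lp ℝ 2 μ, Tendsto (fun k => ∫ z, v k z * ψ z ∂μ) atTop
      (𝓝 (∫ z, v₀ z * ψ z ∂μ)) := by
    intro ψ
    have hψm : Measurable (ψ : ℝ × X → ℝ) := (Lp.stronglyMeasurable ψ).measurable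
    have hψi : Integrable (fun z => (ρ z : ℝ) * ψ z) ν :=
      (integrable_withDensity_iff_integrable_coe_smul hρm).1 ((Lp.memLp ψ).integrable (by norm_num))
    set W : ℝ → X → ℝ := fun t x => (1 + (H t x : ℝ))⁻¹ * (ρ (t, x) * ψ (t, x)) with hW
    have repr : ∀ (A : ℝ → X → ℝ) (u : LipB X) (w : Lp ℝ 2 μ), IsBorelRep T b u A →
        (∀ᵐ z ∂μ, w z = (1 + (H z.1 z.2 : ℝ))⁻¹ * A z.1 z.2) →
        Integrable (fun t => ∫ x, W t x * (b t).toLin u x ∂m) (volume.restrict (Ioo 0 T)) ∧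
        ∫ z, w z * ψ z ∂μ = ∫ t in Ioo 0 T, ∫ x, W t x * (b t).toLin u x ∂m := by
      intro A u w hA hw
      have h1 : Integrable (fun z => w z * ψ z) μ := (Lp.memLp w).integrable_mul (Lp.memLp ψ)
      have e1 : (fun z => w z * ψ z) =ᵐ[μ] fun z => (1 + (H z.1 z.2 : ℝ))⁻¹ * A z.1 z.2 * ψ z := by
        filter_upwards [hw] with z hz
        rw [hz]
      have h2 := (integrable_withDensity_iff_integrable_coe_smul hρm).1 (h1.congr e1)
      have e2 : (fun z : ℝ × X => (ρ z : ℝ) • ((1 + (H z.1 z.2 : ℝ))⁻¹ * A z.1 z.2 * ψ z))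
          = fun z => W z.1 z.2 * A z.1 z.2 := by
        funext z
        simp only [hW, smul_eq_mul]
        ring
      rw [e2] at h2
      have e3 : (fun t => ∫ x, W t x * A t x ∂m) =ᵐ[volume.restrict (Ioo 0 T)]
          fun t => ∫ x, W t x * (b t).toLin u x ∂m := by
        filter_upwards [hA.2] with t ht
        refine integral_congr_ae ?_
        filter_upwards [ht] with x hx
        rw [hx]
      refine ⟨h2.integral_prod_left.congr e3, ?_⟩
      rw [integral_congr_ae e1]
      refine (integral_withDensity_eq_integral_smul hρm _).trans ?_
      have e4 : ∀ z : ℝ × X, ρ z • ((1 + (H z.1 z.2 : ℝ))⁻¹ * A z.1 z.2 * ψ z)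
          = W z.1 z.2 * A z.1 z.2 := fun z => congrFun e2 z
      simp only [e4]
      rw [integral_prod _ h2, integral_congr_ae e3]
    simp only [(repr _ _ _ (hB _) (hvB _)).2, (repr _ _ _ hB₀ hvB₀).2]
    -- Convergence at almost every fixed time comes from the divergence at that time. Since `|b_t(F
    -- k)| ≤ 1 + H`, the integrals in `x` are dominated by those of `|ρ ψ|`, integrable in time.
    refine tendsto_integral_of_dominated_convergence (fun t => ∫ x, |(ρ (t, x) : ℝ) * ψ (t, x)| ∂m)
      (fun k => (repr _ _ _ (hB k) (hvB k)).1.1) hψi.abs.integral_prod_left (fun k => ?_) ?_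
    · filter_upwards [hHk k, hψi.abs.prod_right_ae] with t h1 h2
      refine (norm_integral_le_integral_norm _).trans
        (integral_mono_of_nonneg (Eventually.of_forall fun x => norm_nonneg _) h2 ?_)
      filter_upwards [h1] with x hx
      simp only [hW, norm_mul, norm_inv, Real.norm_eq_abs, abs_mul]
      rw [abs_of_nonneg (by positivity : (0 : ℝ) ≤ 1 + H t x)]
      have h3 : (1 + (H t x : ℝ))⁻¹ * |(b t).toLin (F k) x| ≤ 1 := by
        rw [inv_mul_le_iff₀ (by positivity)]
        linarith
      calc _ = ((1 + (H t x : ℝ))⁻¹ * |(b t).toLin (F k) x|) * (|(ρ (t, x) : ℝ)| * |ψ (t, x)|) := by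
            ring
        _ ≤ _ := mul_le_of_le_one_left (by positivity) h3
    · filter_upwards [hH, hg, hψi.prod_right_ae] with t ⟨h, hh, hl, h1, c, hc⟩ h2 h3
      refine hh.tendsto_integral_mul hm hl h2.1 h2.2 hF (H := H t)
        (hHm.comp measurable_prodMk_left) (fun k => ?_) ?_ hc ?_
      · filter_upwards [h1] with x hx using hx.1 k
      · filter_upwards [h1] with x hx using hx.2
      · refine (h3.bdd_mul (f := fun x => (H t x : ℝ) * (1 + (H t x : ℝ))⁻¹) (c := 1) ?_ ?_).congr
          (Eventually.of_forall fun x => ?_)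
        · have h4 : Measurable fun x => (H t x : ℝ) :=
            (hHm.comp measurable_prodMk_left).coe_nnreal_real
          exact (h4.mul (measurable_const.add h4).inv).aestronglyMeasurable
        · refine Eventually.of_forall fun x => ?_
          rw [Real.norm_of_nonneg (by positivity), mul_inv_le_iff₀ (by positivity)]
          linarith
        · simp only [hW]
          ring
  have hcl : ∀ j, v₀ ∈ closure (A j) := by
    intro j
    refine mem_closure_of_forall_dual_lt (hAconv j) fun l ε hε => ?_
    obtain ⟨ψ, hψ⟩ := (InnerProductSpace.toDual ℝ (Lp ℝ 2 μ)).surjective l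
    have h1 : ∀ u : Lp ℝ 2 μ, l u = ∫ z, u z * ψ z ∂μ := fun u => by
      rw [← hψ, InnerProductSpace.toDual_apply_apply, L2.inner_def]
      simp
    have hw := hweak ψ
    simp only [← h1] at hw
    obtain ⟨n, hn1, hn2⟩ := ((hw.eventually_lt_const (lt_add_of_pos_right _ hε)).and
      (eventually_ge_atTop j)).exists
    exact ⟨v n, ⟨F n, subset_convexHull ℝ _ (mem_image_of_mem _ hn2), hv n⟩, hn1⟩
  have hex : ∀ j : ℕ, ∃ w ∈ A j, ‖w - v₀‖ ≤ (1 / 2 : ℝ) ^ j := by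
    intro j
    obtain ⟨w, hw, hd⟩ := Metric.mem_closure_iff.1 (hcl j) ((1 / 2 : ℝ) ^ j) (by positivity)
    refine ⟨w, hw, ?_⟩
    rw [← dist_eq_norm, dist_comm]
    exact hd.le
  choose w hwA hwn using hex
  choose G hG hGw using hwA
  refine ⟨G, hG, ?_⟩
  have hz := ae_tendsto_zero_of_norm_le (v := fun j => w j - v₀) hwn
  have hsub := ae_all_iff.2 fun j => Lp.coeFn_sub (w j) v₀
  filter_upwards [hlift (hz.and hsub), ae_all_iff.2 hGw, hv₀] with t h1 h2 h3
  filter_upwards [h1, ae_all_iff.2 h2, h3] with x ⟨e1, e2⟩ e3 e4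
  simp only [e2, Pi.sub_apply, e3, e4] at e1
  have hpos : (1 + (H t x : ℝ)) ≠ 0 := by positivity
  have h5 := (e1.const_mul (1 + (H t x : ℝ))).add_const ((b t).toLin f x)
  rw [mul_zero, zero_add] at h5
  refine h5.congr fun j => ?_
  field_simp
  ring

end DivergenceFamily

/-! ### Absolutely continuous curves and derivatives along them -/

section Curves

variable {X : Type*} [MetricSpace X] {T : ℝ}

theorem continuous_IccExtend_eval (hT : 0 ≤ T) :
    Continuous (fun p : ℝ × C(Icc (0 : ℝ) T, X) => IccExtend hT p.2 p.1) := by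
  change Continuous (fun p : ℝ × C(Icc (0 : ℝ) T, X) => p.2 (projIcc 0 T hT p.1))
  have : Continuous (projIcc 0 T hT) := continuous_projIcc
  fun_prop

theorem continuous_IccExtend_coe (hT : 0 ≤ T) (γ : C(Icc (0 : ℝ) T, X)) :
    Continuous (IccExtend hT γ) :=
  γ.continuous.Icc_extend'

theorem IsAC.dist_le (hT : 0 ≤ T) {γ : C(Icc (0 : ℝ) T, X)} {g : ℝ → ℝ}
    (hd : ∀ s t : Icc (0 : ℝ) T, s ≤ t → dist (γ s) (γ t) ≤ ∫ r in (s : ℝ)..t, g r)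
    {s t : ℝ} (hs : s ∈ Icc 0 T) (ht : t ∈ Icc 0 T) :
    dist (IccExtend hT γ s) (IccExtend hT γ t) ≤ |∫ r in s..t, g r| := by
  rw [IccExtend_of_mem hT γ hs, IccExtend_of_mem hT γ ht]
  rcases le_total s t with h | h
  · exact (hd ⟨s, hs⟩ ⟨t, ht⟩ h).trans (le_abs_self _)
  · rw [dist_comm, intervalIntegral.integral_symm, abs_neg]
    exact (hd ⟨t, ht⟩ ⟨s, hs⟩ h).trans (le_abs_self _)

/-- The increments are at most `L` times those of a primitive of `g`, which is absolutely
continuous. -/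
theorem IsAC.absolutelyContinuousOnInterval (hT : 0 ≤ T) {γ : C(Icc (0 : ℝ) T, X)} (hγ : IsAC γ)
    {f : X → ℝ} {L : ℝ≥0} (hf : LipschitzWith L f) :
    AbsolutelyContinuousOnInterval (fun s => f (IccExtend hT γ s)) 0 T := by
  obtain ⟨g, hg0, hgi, hd⟩ := hγ
  have hgI : IntervalIntegrable g volume 0 T := by
    rw [intervalIntegrable_iff_integrableOn_Icc_of_le hT]
    exact hgi
  have hac := hgI.absolutelyContinuousOnInterval_intervalIntegral (c := 0) (by simp)
  have hac' : Tendsto _ _ _ := hac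
  have hlim := hac'.const_mul (L : ℝ)
  rw [mul_zero] at hlim
  refine squeeze_zero' ?_ ?_ hlim
  · filter_upwards with E
    exact Finset.sum_nonneg (fun _ _ => dist_nonneg)
  · have : ∀ᶠ E : ℕ × (ℕ → ℝ × ℝ) in AbsolutelyContinuousOnInterval.totalLengthFilter ⊓
        𝓟 (AbsolutelyContinuousOnInterval.disjWithin 0 T),
        E ∈ AbsolutelyContinuousOnInterval.disjWithin 0 T :=
      eventually_inf_principal.mpr (by simp)
    filter_upwards [this] with E hE
    rw [Finset.mul_sum]
    refine Finset.sum_le_sum fun i hi => ?_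
    have h1 := (hE.1 i hi).1
    have h2 := (hE.1 i hi).2
    rw [uIcc_of_le hT] at h1 h2
    refine (hf.dist_le_mul _ _).trans (mul_le_mul_of_nonneg_left ?_ L.2)
    refine (IsAC.dist_le hT hd h1 h2).trans (le_of_eq ?_)
    have hi' : ∀ u ∈ Icc 0 T, IntervalIntegrable g volume 0 u := fun u hu =>
      hgI.mono_set (by rw [uIcc_of_le hT, uIcc_of_le hu.1]; exact Icc_subset_Icc le_rfl hu.2)
    rw [Real.dist_eq, ← intervalIntegral.integral_interval_sub_left (hi' _ h2) (hi' _ h1), abs_sub_comm]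

/-- One `g` serves all Lipschitz functions, so it can dominate the derivatives of a whole sequence.
-/
theorem IsAC.exists_speed (hT : 0 ≤ T) {γ : C(Icc (0 : ℝ) T, X)} (hγ : IsAC γ) :
    ∃ g : ℝ → ℝ, IntegrableOn g (Ioo 0 T) ∧ ∀ (f : X → ℝ) (L : ℝ≥0), LipschitzWith L f →
      ∀ᵐ r ∂(volume.restrict (Ioo 0 T)), |deriv (fun s => f (IccExtend hT γ s)) r| ≤ L * g r := by
  have hac := fun (f : X → ℝ) (L : ℝ≥0) (hf : LipschitzWith L f) =>
    hγ.absolutelyContinuousOnInterval hT hf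
  obtain ⟨g, hg0, hgi, hd⟩ := hγ
  have hgI : IntervalIntegrable g volume 0 T := by
    rw [intervalIntegrable_iff_integrableOn_Icc_of_le hT]
    exact hgi
  refine ⟨g, hgi.mono_set Ioo_subset_Icc_self, fun f L hf => ?_⟩
  rw [ae_restrict_iff' measurableSet_Ioo]
  filter_upwards [(hac f L hf).ae_differentiableAt, hgI.ae_hasDerivAt_integral] with r h1 h2 hr
  have hr' : r ∈ uIcc 0 T := by rw [uIcc_of_le hT]; exact Ioo_subset_Icc_self hr
  have h3 := (h1 hr').hasDerivAt
  have h4 := h2 hr' r hr'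
  have h3' := h3.tendsto_slope
  have h4' := (h4.tendsto_slope.abs).const_mul (L : ℝ)
  rw [abs_of_nonneg (hg0 r)] at h4'
  refine le_of_tendsto_of_tendsto h3'.abs h4' ?_
  filter_upwards [self_mem_nhdsWithin, mem_nhdsWithin_of_mem_nhds (Ioo_mem_nhds hr.1 hr.2)]
    with u hu hu'
  simp only [slope_def_field, intervalIntegral.integral_same, sub_zero, abs_div]
  rw [← mul_div_assoc]
  refine div_le_div_of_nonneg_right ?_ (abs_nonneg _)
  rw [← Real.dist_eq, dist_comm]
  exact (hf.dist_le_mul _ _).trans (mul_le_mul_of_nonneg_left (IsAC.dist_le hT hd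
    (Ioo_subset_Icc_self hr) (Ioo_subset_Icc_self hu')) L.2)

/-- On a level set of a curve the derivative along the curve vanishes almost everywhere. -/
theorem ae_deriv_eq_zero_of_eq {w : ℝ → ℝ} {S : Set ℝ} {c : ℝ} (hw : ∀ r ∈ S, w r = c)
    {μ : Measure ℝ} [NullSingletonClass μ] : ∀ᵐ r ∂μ, r ∈ S → deriv w r = 0 := by
  -- Only countably many points of `S` are isolated from the right in `S`. At any other point of `S`
  -- the slopes towards points of `S` vanish, which forces a derivative, if there is one, to be `0`.
  have hc := (countable_setOfPred_isolated_right_within (s := S)).ae_notMem μ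
  filter_upwards [hc] with r hr hrS
  by_contra hne
  have hdiff : DifferentiableAt ℝ w r := by
    by_contra h
    exact hne (deriv_zero_of_not_differentiableAt h)
  have hbot : (𝓝[S ∩ Ioi r] r).NeBot := by
    refine ⟨fun h => hr ⟨hrS, h⟩⟩
  have h1 := hdiff.hasDerivAt.tendsto_slope
  have hle : 𝓝[S ∩ Ioi r] r ≤ 𝓝[≠] r :=
    nhdsWithin_mono _ fun y hy => ne_of_gt hy.2
  have h2 : Tendsto (slope w r) (𝓝[S ∩ Ioi r] r) (𝓝 0) := by
    refine tendsto_const_nhds.congr' ?_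
    filter_upwards [self_mem_nhdsWithin] with y hy
    simp [slope_def_field, hw y hy.1, hw r hrS]
  exact hne (tendsto_nhds_unique (h1.mono_left hle) h2)

/-- A continuous function whose increments between rational times are integrals of `q` has
derivative `q` almost everywhere. -/
theorem ae_hasDerivAt_of_rat_increments {w q : ℝ → ℝ} (hw : Continuous w)
    (hq : IntegrableOn q (Ioo 0 T))
    (h : ∀ s t : ℚ, 0 < (s : ℝ) → (s : ℝ) < t → (t : ℝ) < T →
      w t - w s = ∫ r in (s : ℝ)..t, q r) :
    ∀ᵐ r ∂(volume.restrict (Ioo 0 T)), HasDerivAt w (q r) r := by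
  rcases le_or_gt T 0 with hT | hT
  · rw [Ioo_eq_empty (not_lt.2 hT)]; simp
  have hqI : IntervalIntegrable q volume 0 T := by
    rwa [intervalIntegrable_iff_integrableOn_Ioo_of_le hT.le]
  set W : ℝ → ℝ := fun t => ∫ r in (0 : ℝ)..t, q r with hW
  have hi' : ∀ u ∈ Icc 0 T, IntervalIntegrable q volume 0 u := fun u hu =>
      hqI.mono_set (by rw [uIcc_of_le hT.le, uIcc_of_le hu.1]; exact Icc_subset_Icc le_rfl hu.2)
  obtain ⟨s₀, hs0, hsT⟩ := exists_rat_btwn hT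
  have hrat : ∀ t : ℚ, (t : ℝ) ∈ Ioo 0 T → w t - W t = w s₀ - W s₀ := by
    intro t ht
    rcases lt_trichotomy (t : ℝ) s₀ with hlt | heq | hlt
    · have := h t s₀ ht.1 hlt hsT
      rw [← intervalIntegral.integral_interval_sub_left (hi' _ ⟨hs0.le, hsT.le⟩)
        (hi' _ (Ioo_subset_Icc_self ht))] at this
      simp only [hW]; linarith
    · rw [heq]
    · have := h s₀ t hs0 hlt ht.2
      rw [← intervalIntegral.integral_interval_sub_left (hi' _ (Ioo_subset_Icc_self ht))
        (hi' _ ⟨hs0.le, hsT.le⟩)] at this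
      simp only [hW]; linarith
  have hWc : ContinuousOn W (Ioo 0 T) := by
    have := intervalIntegral.continuousOn_primitive_interval' hqI (a := 0) (by simp)
    rw [uIcc_of_le hT.le] at this
    exact this.mono Ioo_subset_Icc_self
  have hall : ∀ t ∈ Ioo 0 T, w t - W t = w s₀ - W s₀ := by
    intro t ht
    have hc : ContinuousAt (fun t => w t - W t) t :=
      hw.continuousAt.sub (hWc.continuousAt (Ioo_mem_nhds ht.1 ht.2))
    have hd : t ∈ closure (range ((↑) : ℚ → ℝ)) := Rat.denseRange_cast t
    have hd' := mem_closure_iff_nhdsWithin_neBot.1 hd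
    refine tendsto_nhds_unique (hc.tendsto.mono_left
      (nhdsWithin_le_nhds (s := range ((↑) : ℚ → ℝ)))) (tendsto_const_nhds.congr' ?_)
    filter_upwards [self_mem_nhdsWithin, mem_nhdsWithin_of_mem_nhds (Ioo_mem_nhds ht.1 ht.2)]
      with u hu hu'
    obtain ⟨u, rfl⟩ := hu
    exact (hrat u hu').symm
  rw [ae_restrict_iff' measurableSet_Ioo]
  filter_upwards [hqI.ae_hasDerivAt_integral] with r hr hrI
  have h1 := hr (by rw [uIcc_of_le hT.le]; exact Ioo_subset_Icc_self hrI) 0 (by simp)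
  have h2 := h1.add_const (w s₀ - W s₀)
  refine h2.congr_of_eventuallyEq ?_
  filter_upwards [Ioo_mem_nhds hrI.1 hrI.2] with u hu
  have := hall u hu
  simp only [hW] at this ⊢
  linarith

end Curves

/-! ### From statements on the space to statements along curves -/

section Transfer

variable {X : Type*} [MetricSpace X] [SecondCountableTopology X] [MeasurableSpace X]
  [BorelSpace X] {T : ℝ} {m : Measure X} {C : ℝ≥0}
  {π : ProbabilityMeasure C(Icc (0 : ℝ) T, X)}

theorem measurable_IccExtend_eval (hT : 0 ≤ T) :
    Measurable (fun p : ℝ × C(Icc (0 : ℝ) T, X) => IccExtend hT p.2 p.1) :=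
  (continuous_IccExtend_eval hT).measurable

theorem measurable_eval_prod (hT : 0 ≤ T) {B : ℝ → X → ℝ} (hB : Measurable (Function.uncurry B)) :
    Measurable (fun p : ℝ × C(Icc (0 : ℝ) T, X) => B p.1 (IccExtend hT p.2 p.1)) :=
  hB.comp (measurable_fst.prodMk (measurable_IccExtend_eval hT))

theorem CompressionLE.map_le (hT : 0 ≤ T) (hC : CompressionLE m π C) (t : ℝ) :
    (π : Measure C(Icc (0 : ℝ) T, X)).map (fun γ : C(Icc (0 : ℝ) T, X) => IccExtend hT γ t) ≤ (C : ℝ≥0∞) • m :=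
  hC (projIcc 0 T hT t)

theorem measurable_eval_const (hT : 0 ≤ T) (t : ℝ) :
    Measurable (fun γ : C(Icc (0 : ℝ) T, X) => IccExtend hT γ t) :=
  (measurable_IccExtend_eval hT).comp measurable_prodMk_left

theorem CompressionLE.ae_eval (hT : 0 ≤ T) (hC : CompressionLE m π C) (t : ℝ) {p : X → Prop}
    (h : ∀ᵐ x ∂m, p x) :
    ∀ᵐ γ : C(Icc (0 : ℝ) T, X) ∂(π : Measure C(Icc (0 : ℝ) T, X)), p (IccExtend hT γ t) := by
  refine ae_of_ae_map (measurable_eval_const hT t).aemeasurable ?_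
  exact (Measure.absolutelyContinuous_of_le_smul (hC.map_le hT t)).ae_le h

/-- Bounded compression sends null sets of `m` to null sets of curves at each time; the
measurability of `P` then allows time and curve to be exchanged. -/
theorem CompressionLE.ae_ae_eval (hT : 0 ≤ T) (hC : CompressionLE m π C) {μ : Measure ℝ}
    [SFinite μ] {P : ℝ → X → Prop} (hP : MeasurableSet {p : ℝ × X | P p.1 p.2})
    (h : ∀ᵐ t ∂μ, ∀ᵐ x ∂m, P t x) :
    ∀ᵐ γ : C(Icc (0 : ℝ) T, X) ∂(π : Measure C(Icc (0 : ℝ) T, X)), ∀ᵐ t ∂μ, P t (IccExtend hT γ t) := by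
  have hm : MeasurableSet {p : ℝ × C(Icc (0 : ℝ) T, X) | P p.1 (IccExtend hT p.2 p.1)} :=
    (measurable_fst.prodMk (measurable_IccExtend_eval hT)) hP
  refine (Measure.ae_ae_comm (p := fun t (γ : C(Icc (0 : ℝ) T, X)) => P t (IccExtend hT γ t)) hm).1 ?_
  filter_upwards [h] with t ht
  exact hC.ae_eval hT t ht

/-- The `L¹` part is paid by the density bound `C`, the `L^∞` part by the total mass, which is at
most `1`. -/
theorem lintegral_enorm_le_l1PlusLinfNorm {ν : Measure X} (hν : ν ≤ (C : ℝ≥0∞) • m)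
    (hν1 : ν univ ≤ 1) (u : X →ₘ[m] ℝ) :
    ∫⁻ x, ‖u x‖ₑ ∂ν ≤ max C 1 * l1PlusLinfNorm m u := by
  rw [l1PlusLinfNorm, ENNReal.mul_iInf_of_ne (by simp) (by simp)]
  refine le_iInf fun p => ?_
  rw [ENNReal.mul_iInf_of_ne (by simp) (by simp)]
  refine le_iInf fun q => ?_
  rw [ENNReal.mul_iInf_of_ne (by simp) (by simp)]
  refine le_iInf fun hpq => ?_
  have hac : ν ≪ m := Measure.absolutelyContinuous_of_le_smul hν
  have h1 : ∀ᵐ x ∂ν, ‖u x‖ₑ ≤ ‖p x‖ₑ + eLpNorm q ∞ m := by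
    have h2 := AEEqFun.coeFn_add p q
    rw [hpq] at h2
    have h3 : ∀ᵐ x ∂m, ‖q x‖ₑ ≤ eLpNorm q ∞ m := by
      rw [eLpNorm_exponent_top]
      exact enorm_ae_le_eLpNormEssSup q m
    filter_upwards [hac.ae_le h2, hac.ae_le h3] with x hx hx'
    rw [hx]
    exact (enorm_add_le _ _).trans (by gcongr)
  calc ∫⁻ x, ‖u x‖ₑ ∂ν ≤ ∫⁻ x, (‖p x‖ₑ + eLpNorm q ∞ m) ∂ν := lintegral_mono_ae h1
    _ = ∫⁻ x, ‖p x‖ₑ ∂ν + eLpNorm q ∞ m * ν univ := by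
        rw [lintegral_add_right _ measurable_const, lintegral_const]
    _ ≤ ∫⁻ x, ‖p x‖ₑ ∂((C : ℝ≥0∞) • m) + eLpNorm q ∞ m * 1 := by
        gcongr
    _ = C * eLpNorm p 1 m + 1 * eLpNorm q ∞ m := by
        rw [lintegral_smul_measure, eLpNorm_one_eq_lintegral_enorm, mul_one, one_mul, smul_eq_mul]
    _ ≤ max C 1 * (eLpNorm p 1 m + eLpNorm q ∞ m) := by
        rw [mul_add]
        gcongr
        · exact_mod_cast le_max_left C 1
        · exact_mod_cast le_max_right C 1

/-- Integrability of `b_t(f)` along the curves of a measure with bounded compression. -/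
theorem CompressionLE.integrable_eval (hT : 0 ≤ T) (hC : CompressionLE m π C) {b : ℝ → Der m}
    {f : LipB X} {B : ℝ → X → ℝ} (hB : IsBorelRep T b f B)
    (hint : ∫⁻ t in Ioo 0 T, l1PlusLinfNorm m ((b t).toLin f) < ∞) :
    Integrable (fun p : ℝ × C(Icc (0 : ℝ) T, X) => B p.1 (IccExtend hT p.2 p.1))
      ((volume.restrict (Ioo 0 T)).prod (π : Measure C(Icc (0 : ℝ) T, X))) := by
  have hme := measurable_eval_prod hT hB.1
  refine ⟨hme.aestronglyMeasurable, ?_⟩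
  rw [hasFiniteIntegral_iff_enorm, lintegral_prod _ hme.enorm.aemeasurable]
  have hle : ∀ᵐ t ∂(volume.restrict (Ioo 0 T)),
      ∫⁻ γ : C(Icc (0 : ℝ) T, X), ‖B t (IccExtend hT γ t)‖ₑ ∂(π : Measure C(Icc (0 : ℝ) T, X))
        ≤ max C 1 * l1PlusLinfNorm m ((b t).toLin f) := by
    filter_upwards [hB.2] with t ht
    have h1 := hC.map_le hT t
    refine le_trans (le_of_eq ?_) (lintegral_enorm_le_l1PlusLinfNorm h1 ?_ _)
    · rw [← lintegral_map (f := fun x => ‖B t x‖ₑ) (hB.1.comp measurable_prodMk_left).enorm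
        (measurable_eval_const hT t)]
      refine lintegral_congr_ae ?_
      filter_upwards [(Measure.absolutelyContinuous_of_le_smul h1).ae_le ht] with x hx
      rw [hx]
    · rw [Measure.map_apply (measurable_eval_const hT t) MeasurableSet.univ]
      exact prob_le_one
  refine (lintegral_mono_ae hle).trans_lt ?_
  rw [lintegral_const_mul' _ _ (by simp)]
  exact ENNReal.mul_lt_top (by simp) hint

theorem CompressionLE.ae_integrableOn_eval (hT : 0 ≤ T) (hC : CompressionLE m π C) {b : ℝ → Der m}
    {f : LipB X} {B : ℝ → X → ℝ} (hB : IsBorelRep T b f B)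
    (hint : ∫⁻ t in Ioo 0 T, l1PlusLinfNorm m ((b t).toLin f) < ∞) :
    ∀ᵐ γ : C(Icc (0 : ℝ) T, X) ∂(π : Measure C(Icc (0 : ℝ) T, X)),
      IntegrableOn (fun t => B t (IccExtend hT γ t)) (Ioo 0 T) :=
  (hC.integrable_eval hT hB hint).prod_left_ae

theorem measurable_deriv_eval (hT : 0 ≤ T) {f : X → ℝ} (hf : Continuous f) :
    Measurable (fun p : ℝ × C(Icc (0 : ℝ) T, X) =>
      deriv (fun s => f (IccExtend hT p.2 s)) p.1) := by
  have h := measurable_deriv_with_param (𝕜 := ℝ)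
    (f := fun (γ : C(Icc (0 : ℝ) T, X)) s => f (IccExtend hT γ s))
    (hf.comp ((continuous_IccExtend_eval hT).comp continuous_swap))
  exact h.comp measurable_swap

end Transfer

/-! ### Closure under flat limits; derivations at a point -/

section FlatClosure

variable {X : Type*} [MetricSpace X] [SecondCountableTopology X] [MeasurableSpace X]
  [BorelSpace X] {T : ℝ} {m : Measure X}

/-- Flat limits are reached by convex combinations along which `b_t` converges almost everywhere
on bounded sets. -/
def FlatConvexClosed (T : ℝ) (b : ℝ → Der m) : Prop :=
  ∀ (F : ℕ → LipB X) (f : LipB X), FlatTendsto m F f → ∀ (x₀ : X) (R : ℝ), 0 < R →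
    ∃ G : ℕ → LipB X, (∀ j, G j ∈ convexHull ℝ (F '' Ici j)) ∧
      ∀ᵐ t ∂(volume.restrict (Ioo 0 T)), ∀ᵐ x ∂m, x ∈ Metric.ball x₀ R →
        Tendsto (fun j => (b t).toLin (G j) x) atTop (𝓝 ((b t).toLin f x))

theorem flatConvexClosed [CompleteSpace X] [Nonempty X] (hm : FiniteOnBounded m) {b : ℝ → Der m}
    (hb : IsBorelFamily T b)
    (hiv : IsReflexiveH12 m ∨ ∃ g : ℝ → X → ℝ,
      ∀ᵐ t ∂(volume.restrict (Ioo 0 T)), (b t).IsDivergence (g t)) : FlatConvexClosed T b := by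
  intro F f hF x₀ R hR
  rcases hiv with hrefl | ⟨g, hg⟩
  · obtain ⟨G, hG, h⟩ := exists_convexHull_tendsto_of_reflexive hm hrefl hF x₀ hR
    exact ⟨G, hG, Eventually.of_forall fun t => h (b t)⟩
  · obtain ⟨G, hG, h⟩ := exists_convexHull_tendsto_of_divergence hm hb hg hF
    refine ⟨G, hG, ?_⟩
    filter_upwards [h] with t ht
    filter_upwards [ht] with x hx _
    exact hx

/-- `f` made constant where `|f - f p| ≤ ε`, at the cost of a uniform error `ε`. -/
noncomputable def flattenAt (f : LipB X) (p : X) (ε : ℝ) : X → ℝ :=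
  fun x => (f : X → ℝ) p + (max ((f : X → ℝ) x - ((f : X → ℝ) p + ε)) 0
    + min ((f : X → ℝ) x - ((f : X → ℝ) p - ε)) 0)

theorem abs_flattenAt_sub_le (f : LipB X) (p x : X) {ε : ℝ} (hε : 0 ≤ ε) :
    |flattenAt f p ε x - (f : X → ℝ) x| ≤ ε := by
  simp only [flattenAt, abs_le]
  rcases max_cases ((f : X → ℝ) x - ((f : X → ℝ) p + ε)) 0 with h | h <;>
  rcases min_cases ((f : X → ℝ) x - ((f : X → ℝ) p - ε)) 0 with h' | h' <;>
  constructor <;> linarith [h.1, h.2, h'.1, h'.2]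

theorem lipschitzWith_flattenAt (f : LipB X) (p : X) (ε : ℝ) {L : ℝ≥0}
    (hf : LipschitzWith L (f : X → ℝ)) : LipschitzWith (2 * L) (flattenAt f p ε) := by
  have h : ∀ c : ℝ, LipschitzWith L (fun x => (f : X → ℝ) x - c) := fun c => by
    simpa using hf.sub (LipschitzWith.const c)
  have := (LipschitzWith.const ((f : X → ℝ) p)).add
    (((h ((f : X → ℝ) p + ε)).max_const 0).add ((h ((f : X → ℝ) p - ε)).min_const 0))
  rw [zero_add, ← two_mul] at this
  exact this

/-- `f` is a flat limit of functions constant near `p`, on which `b_t` vanishes at `p` by locality,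
and this survives convex combinations and limits. The statement has content only when `p` is an atom
of `m`. -/
theorem FlatConvexClosed.eq_zero_of_eq [Nonempty X] (hm : FiniteOnBounded m) {b : ℝ → Der m}
    (hK : FlatConvexClosed T b) (f : LipB X) (p : X) :
    ∀ᵐ t ∂(volume.restrict (Ioo 0 T)), ∀ᵐ x ∂m, x = p → (b t).toLin f x = 0 := by
  obtain ⟨L, hL, hLb⟩ := exists_lip_bound f
  have hεpos : ∀ k : ℕ, (0 : ℝ) < 1 / ((k : ℝ) + 1) := fun k => by positivity
  have hbd : ∀ (k : ℕ) x, |flattenAt f p (1 / ((k : ℝ) + 1)) x| ≤ ((2 * L + 1 : ℝ≥0) : ℝ) := by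
    intro k x
    have h1 := abs_flattenAt_sub_le f p x (hεpos k).le
    have h2 : 1 / ((k : ℝ) + 1) ≤ 1 := by
      rw [div_le_one (by positivity)]; linarith [Nat.cast_nonneg (α := ℝ) k]
    have h3 := hLb x
    have h4 := abs_sub_abs_le_abs_sub (flattenAt f p (1 / ((k : ℝ) + 1)) x) ((f : X → ℝ) x)
    push_cast
    linarith [L.2, show (L : ℝ) = L.1 from rfl]
  let F : ℕ → LipB X := fun k => ⟨flattenAt f p (1 / ((k : ℝ) + 1)),
    ⟨⟨2 * L, lipschitzWith_flattenAt f p _ hL⟩, _, hbd k⟩⟩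
  have hF : FlatTendsto m F f := by
    refine ⟨⟨2 * L + 1, fun k => ⟨(lipschitzWith_flattenAt f p _ hL).weaken (by simp), hbd k⟩⟩, ?_⟩
    refine Eventually.of_forall fun x => ?_
    rw [tendsto_iff_norm_sub_tendsto_zero]
    refine squeeze_zero (fun _ => norm_nonneg _)
      (fun k => abs_flattenAt_sub_le f p x (hεpos k).le) tendsto_one_div_add_atTop_nhds_zero_nat
  have hF0 : ∀ t k, ∀ᵐ x ∂m, x = p → (b t).toLin (F k) x = 0 := by
    intro t k
    obtain ⟨h, hh⟩ := (b t).locality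
    have hU : IsOpen {x | |(f : X → ℝ) x - (f : X → ℝ) p| < 1 / ((k : ℝ) + 1)} :=
      isOpen_lt ((continuous_lipB f).sub continuous_const).abs continuous_const
    have hE : ∀ x ∈ {x | |(f : X → ℝ) x - (f : X → ℝ) p| < 1 / ((k : ℝ) + 1)},
        (F k : X → ℝ) x = (f : X → ℝ) p := by
      intro x hx
      have hx' := abs_lt.1 (mem_ofPred_eq ▸ hx :)
      change flattenAt f p _ x = _
      simp only [flattenAt]
      rw [max_eq_right (by linarith), min_eq_right (by linarith)]
      ring
    filter_upwards [hh.eq_zero_of_eqOn hm (F k) hU hE] with x hx hxp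
    exact hx (by subst hxp; simpa using hεpos k)
  obtain ⟨G, hG, hlim⟩ := hK F f hF p 1 one_pos
  have hG0 : ∀ t j, ∀ᵐ x ∂m, x = p → (b t).toLin (G j) x = 0 := by
    intro t j
    have hconv : Convex ℝ {H : LipB X | ∀ᵐ x ∂m, x = p → (b t).toLin H x = 0} := by
      intro H₁ h₁ H₂ h₂ α β _ _ _
      filter_upwards [h₁, h₂, coeFn_map_add (b t).toLin (α • H₁) (β • H₂),
        coeFn_map_smul (b t).toLin α H₁, coeFn_map_smul (b t).toLin β H₂] with x a1 a2 a3 a4 a5 hxp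
      rw [a3, a4, a5, a1 hxp, a2 hxp]
      simp
    refine convexHull_min ?_ hconv (hG j)
    rintro _ ⟨k, -, rfl⟩
    exact hF0 t k
  filter_upwards [hlim] with t ht
  filter_upwards [ht, ae_all_iff.2 (hG0 t)] with x hx hx0 hxp
  refine tendsto_nhds_unique (hx (by rw [hxp]; simp)) (tendsto_const_nhds.congr fun j => ?_)
  exact (hx0 j hxp).symm

end FlatClosure

/-! ### The compression bound in the weak limit -/

section Compression

variable {X : Type*} [MetricSpace X] [SecondCountableTopology X] [MeasurableSpace X]
  [BorelSpace X] {T : ℝ} {m : Measure X}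

/-- A finite measure is bounded by `C m` once it is so on Lipschitz functions with bounded
support. -/
theorem measure_le_of_forall_isLipBS [Nonempty X] (hm : FiniteOnBounded m) {ν : Measure X}
    [IsFiniteMeasure ν] {C : ℝ≥0}
    (h : ∀ v : LipB X, IsLipBS v → (∀ x, (v : X → ℝ) x ∈ Icc (0 : ℝ) 1) →
      ∫ x, (v : X → ℝ) x ∂ν ≤ C * ∫ x, (v : X → ℝ) x ∂m) : ν ≤ (C : ℝ≥0∞) • m := by
  obtain ⟨x₀⟩ := ‹Nonempty X›
  have hbdd : ∀ (K : Set X) (k : ℕ), IsClosed K → K ⊆ Metric.closedBall x₀ k →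
      ν K ≤ C * m K := by
    intro K k hK hKk
    have hk : (0 : ℝ) < (k : ℝ) + 1 := by positivity
    obtain ⟨χ, hχ, hlim⟩ := exists_lipB_tendsto_indicator hK
    let v : ℕ → LipB X := fun n => mulLip (χ n) (bump x₀ hk)
    have hv01 : ∀ n x, (v n : X → ℝ) x ∈ Icc (0 : ℝ) 1 := fun n x => by
      have h1 := hχ n x
      have h2 := bump_mem_Icc x₀ hk x
      simp only [v, mulLip_apply]
      exact ⟨mul_nonneg h1.1 h2.1, mul_le_one₀ h1.2 h2.1 h2.2⟩
    have hvlim : ∀ x, Tendsto (fun n => (v n : X → ℝ) x) atTop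
        (𝓝 (K.indicator (fun _ => (1 : ℝ)) x)) := by
      intro x
      have h2 : Tendsto (fun n => (χ n : X → ℝ) x * ((bump x₀ hk : LipB X) : X → ℝ) x) atTop
        (𝓝 (K.indicator (fun _ => (1 : ℝ)) x * ((bump x₀ hk : LipB X) : X → ℝ) x)) :=
        (hlim x).mul_const _
      have h3 : K.indicator (fun _ => (1 : ℝ)) x * ((bump x₀ hk : LipB X) : X → ℝ) x
          = K.indicator (fun _ => (1 : ℝ)) x := by
        by_cases hx : x ∈ K
        · have := Metric.mem_closedBall.1 (hKk hx)
          rw [bump_eq_one hk (by linarith), mul_one]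
        · simp [hx]
      rw [h3] at h2
      exact h2
    have hdom : ∀ μ : Measure X, FiniteOnBounded μ →
        Tendsto (fun n => ∫ x, (v n : X → ℝ) x ∂μ) atTop (𝓝 (μ.real K)) := by
      intro μ hμ
      have hS : MeasurableSet (Metric.ball x₀ (2 * ((k : ℝ) + 1))) := Metric.isOpen_ball.measurableSet
      rw [← integral_indicator_one hK.measurableSet]
      refine tendsto_integral_of_dominated_convergence
        ((Metric.ball x₀ (2 * ((k : ℝ) + 1))).indicator fun _ => (1 : ℝ))
        (fun n => (continuous_lipB (v n)).aestronglyMeasurable) ?_ ?_ ?_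
      · exact (integrable_indicator_iff hS).2
          (integrableOn_const (hμ _ Metric.isBounded_ball).ne)
      · refine fun n => Eventually.of_forall fun x => ?_
        rw [Real.norm_of_nonneg (hv01 n x).1]
        by_cases hx : x ∈ Metric.ball x₀ (2 * ((k : ℝ) + 1))
        · rw [indicator_of_mem hx]
          exact (hv01 n x).2
        · rw [indicator_of_notMem hx]
          simp only [v, mulLip_apply]
          rw [bump_eq_zero hk (not_lt.1 fun hh => hx hh), mul_zero]
      · exact Eventually.of_forall fun x => hvlim x
    have h1 := hdom ν (fun s _ => measure_lt_top ν s)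
    have h2 := (hdom m hm).const_mul (C : ℝ)
    have h3 := le_of_tendsto_of_tendsto' h1 h2
      fun n => h (v n) (isLipBS_mul_bump (χ n) x₀ hk) (hv01 n)
    have hmK : m K ≠ ∞ := (hm K (Metric.isBounded_closedBall.subset hKk)).ne
    rw [measureReal_def, measureReal_def, ← ENNReal.coe_toReal, ← ENNReal.toReal_mul] at h3
    exact (ENNReal.toReal_le_toReal (measure_ne_top ν K)
      (ENNReal.mul_ne_top ENNReal.coe_ne_top hmK)).1 h3
  have hcl : ∀ K : Set X, IsClosed K → ν K ≤ C * m K := by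
    intro K hK
    have hU : K = ⋃ k : ℕ, K ∩ Metric.closedBall x₀ k := by
      rw [← inter_iUnion, Metric.iUnion_closedBall_nat, inter_univ]
    have hmono : Monotone fun k : ℕ => K ∩ Metric.closedBall x₀ (k : ℝ) := fun a b hab =>
      inter_subset_inter_right _ (Metric.closedBall_subset_closedBall (by exact_mod_cast hab))
    conv_lhs => rw [hU]
    rw [hmono.measure_iUnion]
    refine iSup_le fun k => ?_
    refine (hbdd _ k (hK.inter Metric.isClosed_closedBall) inter_subset_right).trans ?_
    gcongr
    exact inter_subset_left
  -- Inner regularity by closed sets is needed only for the finite measure `ν`.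
  refine Measure.le_iff.2 fun A hA => ?_
  refine le_of_forall_lt fun r hr => ?_
  obtain ⟨K, hKA, hK, hr'⟩ := hA.exists_lt_isClosed_of_ne_top (measure_ne_top ν A) hr
  refine hr'.trans_le ((hcl K hK).trans ?_)
  rw [Measure.smul_apply, smul_eq_mul]
  gcongr

/-- The bounded continuous function underlying a bounded Lipschitz function. -/
noncomputable def toBCF (f : LipB X) : X →ᵇ ℝ :=
  BoundedContinuousFunction.ofNormedAddCommGroup (f : X → ℝ) (continuous_lipB f)
    (exists_lip_bound f).choose fun x => (exists_lip_bound f).choose_spec.2 x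

@[simp]
theorem toBCF_apply (f : LipB X) (x : X) : toBCF f x = (f : X → ℝ) x := rfl

/-- Composition of a bounded continuous function with an evaluation map. -/
noncomputable def evalBCF (hT : 0 ≤ T) (v : X →ᵇ ℝ) (t : ℝ) : C(Icc (0 : ℝ) T, X) →ᵇ ℝ :=
  v.compContinuous ⟨fun γ => IccExtend hT γ t,
    (continuous_IccExtend_eval hT).comp (Continuous.prodMk_right t)⟩

@[simp]
theorem evalBCF_apply (hT : 0 ≤ T) (v : X →ᵇ ℝ) (t : ℝ) (γ : C(Icc (0 : ℝ) T, X)) :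
    evalBCF hT v t γ = v (IccExtend hT γ t) := rfl

theorem tendsto_integral_bcf {π : ProbabilityMeasure C(Icc (0 : ℝ) T, X)}
    {πn : ℕ → ProbabilityMeasure C(Icc (0 : ℝ) T, X)} (hπ : Tendsto πn atTop (𝓝 π))
    (ψ : C(Icc (0 : ℝ) T, X) →ᵇ ℝ) :
    Tendsto (fun n => ∫ γ, ψ γ ∂(πn n : Measure C(Icc (0 : ℝ) T, X))) atTop
      (𝓝 (∫ γ, ψ γ ∂(π : Measure C(Icc (0 : ℝ) T, X)))) :=
  (ProbabilityMeasure.tendsto_iff_forall_integral_tendsto.1 hπ) ψ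

/-- For `v` with bounded support, `v` is admissible for the convergence of `mn`, and its composition
with an evaluation is admissible for that of `πn`; the inequality of integrals passes to the limit.
-/
theorem CompressionLE.of_tendsto (hT : 0 ≤ T) [Nonempty X] (hm : FiniteOnBounded m)
    {mn : ℕ → Measure X} (hmn : ∀ n, FiniteOnBounded (mn n)) (hmm : WeakTendsto mn m)
    {π : ProbabilityMeasure C(Icc (0 : ℝ) T, X)}
    {πn : ℕ → ProbabilityMeasure C(Icc (0 : ℝ) T, X)} (hπ : Tendsto πn atTop (𝓝 π)) {C : ℝ≥0}
    (hC : ∀ n, CompressionLE (mn n) (πn n) C) : CompressionLE m π C := by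
  intro t
  have hmeas : Measurable (fun γ : C(Icc (0 : ℝ) T, X) => γ t) :=
    (by fun_prop : Continuous (fun γ : C(Icc (0 : ℝ) T, X) => γ t)).measurable
  have hle : ∀ n, (πn n : Measure C(Icc (0 : ℝ) T, X)).map (fun γ => γ t) ≤ (C : ℝ≥0∞) • mn n :=
    fun n => hC n t
  have : IsFiniteMeasure ((π : Measure C(Icc (0 : ℝ) T, X)).map (fun γ => γ t)) := inferInstance
  refine measure_le_of_forall_isLipBS hm fun v hv hv01 => ?_
  have h1 := tendsto_integral_bcf hπ (evalBCF hT (toBCF v) t)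
  have h2 := (hmm (toBCF v) hv).const_mul (C : ℝ)
  rw [integral_map hmeas.aemeasurable (continuous_lipB v).aestronglyMeasurable]
  simp only [evalBCF_apply, toBCF_apply, IccExtend_val] at h1 h2
  refine le_of_tendsto_of_tendsto' h1 h2 fun n => ?_
  rw [← integral_map (φ := fun γ : C(Icc (0 : ℝ) T, X) => γ t) hmeas.aemeasurable
    (continuous_lipB v).aestronglyMeasurable]
  have h3 : ∫ x, (v : X → ℝ) x ∂((C : ℝ≥0∞) • mn n) = C * ∫ x, (v : X → ℝ) x ∂(mn n) := by
    rw [integral_smul_measure]; simp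
  rw [← h3]
  refine integral_mono_measure (hle n) (Eventually.of_forall fun x => (hv01 x).1) ?_
  refine Integrable.smul_measure ?_ ENNReal.coe_ne_top
  exact memLp_one_iff_integrable.1 (hv.memLp (hmn n) 1)

end Compression

/-! ### Densities of time marginals -/

section Densities

variable {X : Type*} [MetricSpace X] [SecondCountableTopology X] [MeasurableSpace X]
  [BorelSpace X] {T : ℝ} {m : Measure X}

open ProbabilityTheory in
/-- Jointly measurable densities of the time marginals of a measure on curves. -/
theorem exists_density (hT : 0 ≤ T) [SigmaFinite m] {P : Measure C(Icc (0 : ℝ) T, X)}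
    [IsFiniteMeasure P] {K : ℝ≥0}
    (hP : ∀ t : ℝ, P.map (fun γ : C(Icc (0 : ℝ) T, X) => IccExtend hT γ t) ≤ (K : ℝ≥0∞) • m) :
    ∃ v : ℝ → X → ℝ≥0, Measurable (Function.uncurry v) ∧ (∀ t x, v t x ≤ K) ∧
      ∀ t : ℝ, m.withDensity (fun x => (v t x : ℝ≥0∞))
        = P.map (fun γ : C(Icc (0 : ℝ) T, X) => IccExtend hT γ t) := by
  have hev := measurable_IccExtend_eval (X := X) hT
  let κ : Kernel ℝ X :=
    { toFun := fun t => P.map (fun γ : C(Icc (0 : ℝ) T, X) => IccExtend hT γ t)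
      measurable' := by
        refine Measure.measurable_of_measurable_coe _ fun s hs => ?_
        have : ∀ t, P.map (fun γ : C(Icc (0 : ℝ) T, X) => IccExtend hT γ t) s
            = P (Prod.mk t ⁻¹' ((fun p : ℝ × C(Icc (0 : ℝ) T, X) => IccExtend hT p.2 p.1) ⁻¹' s)) :=
          fun t => Measure.map_apply (measurable_eval_const hT t) hs
        simp only [this]
        exact measurable_measure_prodMk_left (hev hs) }
  have hκ : ∀ t, κ t = P.map (fun γ : C(Icc (0 : ℝ) T, X) => IccExtend hT γ t) := fun t => rfl
  have : IsFiniteKernel κ := ⟨⟨P univ, measure_lt_top P _, fun t => by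
    rw [hκ, Measure.map_apply (measurable_eval_const hT t) MeasurableSet.univ, preimage_univ]⟩⟩
  -- The Radon–Nikodym derivative of kernels gives joint measurability in `(t, x)`. It is taken
  -- against the finite measure `ρ m`, which has the same null sets as `m`.
  obtain ⟨ρ, hρ0, hρm, hρ1⟩ := exists_pos_lintegral_lt_of_sigmaFinite m one_ne_zero
  have : IsFiniteMeasure (m.withDensity fun x => (ρ x : ℝ≥0∞)) :=
    isFiniteMeasure_withDensity (hρ1.trans ENNReal.one_lt_top).ne
  let η : Kernel ℝ X := Kernel.const ℝ (m.withDensity fun x => (ρ x : ℝ≥0∞))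
  have hρ' : Measurable fun x => (ρ x : ℝ≥0∞) := hρm.coe_nnreal_ennreal
  have hac : ∀ t, κ t ≪ η t := fun t =>
    (Measure.absolutelyContinuous_of_le_smul (hP t)).trans
      (withDensity_absolutelyContinuous' hρ'.aemeasurable
        (Eventually.of_forall fun x => by simpa using (hρ0 x).ne'))
  let w : ℝ → X → ℝ≥0∞ := fun t x => ρ x * Kernel.rnDeriv κ η t x
  have hwm : Measurable (Function.uncurry w) :=
    (hρ'.comp measurable_snd).mul (Kernel.measurable_rnDeriv κ η)
  have hwt : ∀ t, Measurable (w t) := fun t => hwm.comp measurable_prodMk_left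
  have hw : ∀ t, m.withDensity (w t) = κ t := by
    intro t
    rw [← Kernel.withDensity_rnDeriv_eq (hac t), Kernel.withDensity_apply _
      (Kernel.measurable_rnDeriv κ η)]
    exact withDensity_mul m hρ' (Kernel.measurable_rnDeriv_right κ η t)
  have hwK : ∀ t, ∀ᵐ x ∂m, w t x ≤ K := by
    intro t
    refine ae_le_of_forall_setLIntegral_le_of_sigmaFinite (hwt t) fun s hs _ => ?_
    rw [← withDensity_apply _ hs, hw t, setLIntegral_const]
    exact hP t s
  -- The truncation changes nothing almost everywhere, and gives the bound at every point, as the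
  -- convergence hypothesis requires.
  refine ⟨fun t x => (min (w t x) K).toNNReal, (hwm.min measurable_const).ennreal_toNNReal,
    fun t x => ?_, fun t => ?_⟩
  · have := ENNReal.toNNReal_mono ENNReal.coe_ne_top (min_le_right (w t x) (K : ℝ≥0∞))
    simpa using this
  · rw [← hκ, ← hw]
    refine withDensity_congr_ae ?_
    filter_upwards [hwK t] with x hx
    rw [min_eq_left hx, ENNReal.coe_toNNReal (ne_top_of_le_ne_top ENNReal.coe_ne_top hx)]

end Densities

section WeightedDensities

variable {X : Type*} [MetricSpace X] [SecondCountableTopology X] [MeasurableSpace X]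
  [BorelSpace X] {T : ℝ} {m : Measure X}

/-- Densities of the marginals of `Θ π`, for a bounded weight `Θ ≥ 0`. -/
theorem CompressionLE.exists_weighted_density (hT : 0 ≤ T) [SigmaFinite m]
    {π : ProbabilityMeasure C(Icc (0 : ℝ) T, X)} {C : ℝ≥0} (hC : CompressionLE m π C)
    {Θ : C(Icc (0 : ℝ) T, X) → ℝ} (hΘ : Measurable Θ) (h0 : ∀ γ, 0 ≤ Θ γ) {M : ℝ≥0}
    (hM : ∀ γ, Θ γ ≤ M) :
    ∃ v : ℝ → X → ℝ≥0, Measurable (Function.uncurry v) ∧ (∀ t x, v t x ≤ M * C) ∧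
      (∀ t, (m.withDensity fun x => (v t x : ℝ≥0∞)) univ
        = ENNReal.ofReal (∫ γ, Θ γ ∂(π : Measure C(Icc (0 : ℝ) T, X)))) ∧
      ∀ (t : ℝ) (ψ : X → ℝ), AEStronglyMeasurable ψ m → ∫ x, ψ x * v t x ∂m
        = ∫ γ : C(Icc (0 : ℝ) T, X), Θ γ * ψ (IccExtend hT γ t)
          ∂(π : Measure C(Icc (0 : ℝ) T, X)) := by
  set P : Measure C(Icc (0 : ℝ) T, X) :=
    (π : Measure C(Icc (0 : ℝ) T, X)).withDensity fun γ => ((Θ γ).toNNReal : ℝ≥0∞) with hPdef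
  have hΘn : Measurable fun γ => (Θ γ).toNNReal := hΘ.real_toNNReal
  have hPle : P ≤ (M : ℝ≥0∞) • (π : Measure C(Icc (0 : ℝ) T, X)) := by
    rw [← withDensity_const]
    refine withDensity_mono (Eventually.of_forall fun γ => ?_)
    simp only [ENNReal.coe_le_coe]
    exact Real.toNNReal_le_iff_le_coe.2 (hM γ)
  have hPu : P univ = ENNReal.ofReal (∫ γ, Θ γ ∂(π : Measure C(Icc (0 : ℝ) T, X))) := by
    rw [hPdef, withDensity_apply _ MeasurableSet.univ, Measure.restrict_univ,
      ofReal_integral_eq_lintegral_ofReal ?_ (Eventually.of_forall h0)]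
    · rfl
    · refine Integrable.of_bound hΘ.aestronglyMeasurable (M : ℝ) (Eventually.of_forall fun γ => ?_)
      rw [Real.norm_of_nonneg (h0 γ)]
      exact hM γ
  have hPf : IsFiniteMeasure P := ⟨by rw [hPu]; exact ENNReal.ofReal_lt_top⟩
  have hPm : ∀ t : ℝ, P.map (fun γ : C(Icc (0 : ℝ) T, X) => IccExtend hT γ t)
      ≤ ((M * C : ℝ≥0) : ℝ≥0∞) • m := by
    intro t
    refine (Measure.map_mono hPle (measurable_eval_const hT t)).trans ?_
    rw [Measure.map_smul, ENNReal.coe_mul, mul_smul]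
    refine Measure.le_iff'.2 fun s => ?_
    rw [Measure.smul_apply, Measure.smul_apply]
    exact mul_le_mul_right ((hC.map_le hT t) s) (M : ℝ≥0∞)
  obtain ⟨v, hvm, hvb, hv⟩ := exists_density hT hPm
  refine ⟨v, hvm, hvb, fun t => ?_, fun t ψ hψ => ?_⟩
  · rw [hv, Measure.map_apply (measurable_eval_const hT t) MeasurableSet.univ, preimage_univ, hPu]
  · have h1 := integral_withDensity_eq_integral_smul (μ := m) (f := v t)
      (hvm.comp measurable_prodMk_left) ψ
    rw [hv t, integral_map (measurable_eval_const hT t).aemeasurable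
      (hψ.mono_ac (Measure.absolutelyContinuous_of_le_smul (hPm t))), hPdef,
      integral_withDensity_eq_integral_smul hΘn] at h1
    calc ∫ x, ψ x * v t x ∂m = ∫ x, v t x • ψ x ∂m :=
          integral_congr_ae (Eventually.of_forall fun x => by
            simp only [NNReal.smul_def, smul_eq_mul]; ring)
      _ = _ := h1.symm
      _ = _ := integral_congr_ae (Eventually.of_forall fun γ => by
            simp only [NNReal.smul_def, smul_eq_mul, Real.coe_toNNReal _ (h0 γ)])

end WeightedDensities

/-! ### Uncorrelated variables and Fubini for time weights -/

section Constancy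

/-- An integrable variable uncorrelated with every bounded continuous observable is constant. -/
theorem ae_eq_integral_of_uncorrelated {Ω : Type*} [MetricSpace Ω] [MeasurableSpace Ω]
    [BorelSpace Ω] {μ : Measure Ω} [IsProbabilityMeasure μ] {Z : Ω → ℝ} (hZ : Integrable Z μ)
    (h : ∀ θ : Ω →ᵇ ℝ, (∀ ω, 1 ≤ θ ω) → ∫ ω, θ ω * Z ω ∂μ = (∫ ω, θ ω ∂μ) * ∫ ω, Z ω ∂μ) :
    ∀ᵐ ω ∂μ, Z ω = ∫ ω, Z ω ∂μ := by
  set c := ∫ ω, Z ω ∂μ with hc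
  have hW : Integrable (fun ω => Z ω - c) μ := hZ.sub (integrable_const c)
  have key : (fun ω => Z ω - c) =ᵐ[μ] 0 := by
    refine ae_eq_zero_of_forall_setIntegral_isClosed_eq_zero hW fun S hS => ?_
    obtain ⟨χ, hχ, hlim⟩ := exists_lipB_tendsto_indicator hS
    have hzero : ∀ n, ∫ ω, (χ n : Ω → ℝ) ω * (Z ω - c) ∂μ = 0 := by
      intro n
      let χb : Ω →ᵇ ℝ := BoundedContinuousFunction.ofNormedAddCommGroup (χ n : Ω → ℝ)
        (continuous_lipB (χ n)) 1 fun ω => by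
          rw [Real.norm_of_nonneg (hχ n ω).1]; exact (hχ n ω).2
      have hχi : Integrable (χ n : Ω → ℝ) μ := χb.integrable μ
      have hχZ : Integrable (fun ω => (χ n : Ω → ℝ) ω * Z ω) μ :=
        hZ.bdd_mul (c := 1) (continuous_lipB (χ n)).aestronglyMeasurable
          (Eventually.of_forall fun ω => by rw [Real.norm_of_nonneg (hχ n ω).1]; exact (hχ n ω).2)
      -- Only `θ ≥ 1` may be tested. With `θ = 1 + χ` the contribution of `1` cancels from both
      -- sides, leaving the identity for the cutoff `χ` alone.
      have h1 := h (BoundedContinuousFunction.const Ω 1 + χb) fun ω => by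
        have := (hχ n ω).1
        change 1 ≤ 1 + (χ n : Ω → ℝ) ω
        linarith
      have e1 : ∀ ω, (BoundedContinuousFunction.const Ω (1 : ℝ) + χb) ω
          = 1 + (χ n : Ω → ℝ) ω := fun ω => rfl
      simp only [e1, add_mul, one_mul] at h1
      rw [integral_add hZ hχZ, integral_add (integrable_const _) hχi] at h1
      simp only [integral_const, probReal_univ, one_smul] at h1
      simp only [mul_sub]
      rw [integral_sub hχZ (hχi.mul_const c), integral_mul_const]
      rw [← hc] at h1
      linarith
    have hT : Tendsto (fun n => ∫ ω, (χ n : Ω → ℝ) ω * (Z ω - c) ∂μ) atTop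
        (𝓝 (∫ ω, S.indicator (fun ω => Z ω - c) ω ∂μ)) := by
      refine tendsto_integral_of_dominated_convergence (fun ω => ‖Z ω - c‖)
        (fun n => (continuous_lipB (χ n)).aestronglyMeasurable.mul hW.1) hW.norm
        (fun n => Eventually.of_forall fun ω => ?_) (Eventually.of_forall fun ω => ?_)
      · rw [norm_mul, Real.norm_of_nonneg (hχ n ω).1]
        exact mul_le_of_le_one_left (norm_nonneg _) (hχ n ω).2
      · have := (hlim ω).mul_const (Z ω - c)
        have e : S.indicator (fun _ => (1 : ℝ)) ω * (Z ω - c)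
            = S.indicator (fun ω => Z ω - c) ω := by
          by_cases hω : ω ∈ S <;> simp [hω]
        rwa [e] at this
    simp only [hzero] at hT
    rw [integral_indicator hS.measurableSet] at hT
    exact (tendsto_nhds_unique hT tendsto_const_nhds)
  filter_upwards [key] with ω hω
  have : Z ω - c = 0 := hω
  linarith

end Constancy

section Fubini

variable {Ω : Type*} [MeasurableSpace Ω] {μ : Measure Ω} [IsFiniteMeasure μ] {T s t : ℝ}
  {q : ℝ → Ω → ℝ}

theorem setIntegral_indicator_mul_eq (hs : 0 ≤ s) (hst : s ≤ t) (ht : t ≤ T) (h : ℝ → ℝ) :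
    ∫ r in Ioo 0 T, (Ioo s t).indicator (fun _ => (1 : ℝ)) r * h r = ∫ r in s..t, h r := by
  have e : ∀ r, (Ioo s t).indicator (fun _ => (1 : ℝ)) r * h r = (Ioo s t).indicator h r := by
    intro r
    by_cases hr : r ∈ Ioo s t <;> simp [hr]
  simp only [e]
  rw [setIntegral_indicator measurableSet_Ioo, inter_eq_right.2 (Ioo_subset_Ioo hs ht),
    intervalIntegral.integral_of_le hst, integral_Ioc_eq_integral_Ioo]

theorem integrable_indicator_mul
    (hq : Integrable (Function.uncurry q) ((volume.restrict (Ioo 0 T)).prod μ)) :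
    Integrable (fun p : ℝ × Ω => (Ioo s t).indicator (fun _ => (1 : ℝ)) p.1 * q p.1 p.2)
      ((volume.restrict (Ioo 0 T)).prod μ) := by
  refine hq.bdd_mul (c := 1) ?_ (Eventually.of_forall fun p => ?_)
  · exact ((measurable_const.indicator measurableSet_Ioo).comp measurable_fst).aestronglyMeasurable
  · by_cases hr : p.1 ∈ Ioo s t <;> simp [hr]

theorem integrable_intervalIntegral (hs : 0 ≤ s) (hst : s ≤ t) (ht : t ≤ T)
    (hq : Integrable (Function.uncurry q) ((volume.restrict (Ioo 0 T)).prod μ)) :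
    Integrable (fun ω => ∫ r in s..t, q r ω) μ := by
  have h := (integrable_indicator_mul (s := s) (t := t) hq).integral_prod_right
  refine h.congr (Eventually.of_forall fun ω => ?_)
  exact setIntegral_indicator_mul_eq hs hst ht fun r => q r ω

/-- The weight differs from `1` only during `(s,t)`, so the integral over `(0,T)` splits into one
over `(s,t)` and a part independent of `W`. -/
theorem setIntegral_integral_weight (hs : 0 ≤ s) (hst : s ≤ t) (ht : t ≤ T)
    (hq : Integrable (Function.uncurry q) ((volume.restrict (Ioo 0 T)).prod μ))
    {W : Ω → ℝ} (hW : Measurable W) {M : ℝ} (hM : ∀ ω, |W ω| ≤ M) :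
    ∫ r in Ioo 0 T, ∫ ω, (if r ∈ Ioo s t then W ω else 1) * q r ω ∂μ
      = ∫ ω, (W ω - 1) * (∫ r in s..t, q r ω) ∂μ + ∫ r in Ioo 0 T, ∫ ω, q r ω ∂μ := by
  have hK : Integrable (fun p : ℝ × Ω => (W p.2 - 1) *
      ((Ioo s t).indicator (fun _ => (1 : ℝ)) p.1 * q p.1 p.2))
      ((volume.restrict (Ioo 0 T)).prod μ) := by
    refine (integrable_indicator_mul hq).bdd_mul (c := M + 1)
      ((hW.comp measurable_snd).sub_const 1).aestronglyMeasurable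
      (Eventually.of_forall fun p => ?_)
    rw [Real.norm_eq_abs]
    refine (abs_sub _ _).trans ?_
    have := hM p.2
    simp only [abs_one]
    linarith
  have e : ∀ r ω, (if r ∈ Ioo s t then W ω else 1) * q r ω
      = (W ω - 1) * ((Ioo s t).indicator (fun _ => (1 : ℝ)) r * q r ω) + q r ω := by
    intro r ω
    by_cases hr : r ∈ Ioo s t
    · simp [hr]; ring
    · simp [hr]
  have h1 := integral_prod _ (hK.add hq)
  simp only [Pi.add_apply, Function.uncurry_apply_pair] at h1
  simp only [e]
  rw [← h1, integral_add hK hq, integral_prod_symm _ hK, integral_prod _ hq]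
  simp only [Function.uncurry_apply_pair]
  congr 1
  refine integral_congr_ae (Eventually.of_forall fun ω => ?_)
  simp only
  rw [integral_const_mul, setIntegral_indicator_mul_eq hs hst ht fun r => q r ω]

end Fubini

/-! ### The differential equation for all bounded Lipschitz functions -/

section LipschitzOde

variable {X : Type*} [MetricSpace X] [SecondCountableTopology X] [MeasurableSpace X]
  [BorelSpace X] {T : ℝ} {m : Measure X}

/-- The differential equation of a regular generalized flow holds for all bounded Lipschitz
functions. -/
theorem IsRegularGeneralizedFlow.ae_hasDerivAt [Nonempty X] (hT : 0 ≤ T) (hm : FiniteOnBounded m)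
    {b : ℝ → Der m} (hb : IsBorelFamily T b) {π : ProbabilityMeasure C(Icc (0 : ℝ) T, X)}
    (hflow : IsRegularGeneralizedFlow hT b π) {f : LipB X} {B : ℝ → X → ℝ}
    (hB : IsBorelRep T b f B) :
    ∀ᵐ γ : C(Icc (0 : ℝ) T, X) ∂(π : Measure C(Icc (0 : ℝ) T, X)),
      ∀ᵐ r ∂(volume.restrict (Ioo 0 T)),
        HasDerivAt (fun s => (f : X → ℝ) (IccExtend hT γ s)) (B r (IccExtend hT γ r)) r := by
  obtain ⟨x₀⟩ := ‹Nonempty X›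
  obtain ⟨C, hC⟩ := hflow.compression
  have hk : ∀ k : ℕ, (0 : ℝ) < (k : ℝ) + 1 := fun k => by positivity
  let φ : ℕ → LipB X := fun k => mulLip f (bump x₀ (hk k))
  have hφ : ∀ (k : ℕ), EqOn (f : X → ℝ) (φ k : X → ℝ) (Metric.ball x₀ ((k : ℝ) + 1)) := by
    intro k x hx
    simp only [φ, mulLip_apply]
    rw [bump_eq_one (hk k) (Metric.mem_ball.1 hx).le, mul_one]
  choose Bk hBk using fun k => hb.2 (φ k)
  have h1 : ∀ᵐ γ : C(Icc (0 : ℝ) T, X) ∂(π : Measure C(Icc (0 : ℝ) T, X)),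
      ∀ k, ∀ᵐ r ∂(volume.restrict (Ioo 0 T)),
        HasDerivAt (fun s => (φ k : X → ℝ) (IccExtend hT γ s)) (Bk k r (IccExtend hT γ r)) r := by
    refine ae_all_iff.2 fun k => ?_
    have := hflow.ode (φ k) (isLipBS_mul_bump f x₀ (hk k)) (Bk k) (hBk k)
    rw [← Measure.prod_swap] at this
    have h2 := ae_of_ae_map measurable_swap.aemeasurable this
    exact Measure.ae_ae_of_ae_prod h2
  have h2 : ∀ᵐ γ : C(Icc (0 : ℝ) T, X) ∂(π : Measure C(Icc (0 : ℝ) T, X)),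
      ∀ k : ℕ, ∀ᵐ r ∂(volume.restrict (Ioo 0 T)),
        IccExtend hT γ r ∈ Metric.ball x₀ ((k : ℝ) + 1) →
          B r (IccExtend hT γ r) = Bk k r (IccExtend hT γ r) := by
    refine ae_all_iff.2 fun k => ?_
    refine hC.ae_ae_eval hT (P := fun r x => x ∈ Metric.ball x₀ ((k : ℝ) + 1) →
      B r x = Bk k r x) ?_ ?_
    · refine MeasurableSet.imp ?_ ?_
      · exact measurable_snd Metric.isOpen_ball.measurableSet
      · exact measurableSet_eq_fun hB.1 (hBk k).1
    · filter_upwards [hB.2, (hBk k).2] with r hr hr'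
      obtain ⟨h, hh⟩ := (b r).locality
      filter_upwards [hr, hr', hh.congr_of_eqOn hm f (φ k) Metric.isOpen_ball (hφ k)]
        with x a1 a2 a3 hx
      rw [a1, a2, a3 hx]
  filter_upwards [h1, h2] with γ hγ1 hγ2
  -- A curve has compact range, so for `k` large the cutoff does not alter `f` along it.
  have hbdd : Bornology.IsBounded (range (IccExtend hT γ)) := by
    rw [IccExtend_range]
    exact (isCompact_range γ.continuous).isBounded
  obtain ⟨R, hR⟩ := hbdd.subset_ball x₀
  obtain ⟨k, hk'⟩ := exists_nat_ge R
  have hin : ∀ r, IccExtend hT γ r ∈ Metric.ball x₀ ((k : ℝ) + 1) := fun r =>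
    Metric.ball_subset_ball (by linarith) (hR (mem_range_self r))
  filter_upwards [hγ1 k, hγ2 k] with r hr1 hr2
  rw [hr2 (hin r)]
  have e : (fun s => (f : X → ℝ) (IccExtend hT γ s))
      = fun s => (φ k : X → ℝ) (IccExtend hT γ s) := funext fun s => hφ k (hin s)
  rw [e]
  exact hr1

theorem IsAC.sub_eq_integral (hT : 0 ≤ T) {γ : C(Icc (0 : ℝ) T, X)} (hγ : IsAC γ) (f : LipB X)
    {q : ℝ → ℝ} (hq : ∀ᵐ r ∂(volume.restrict (Ioo 0 T)),
      HasDerivAt (fun s => (f : X → ℝ) (IccExtend hT γ s)) (q r) r)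
    {s t : ℝ} (hs : 0 < s) (hst : s ≤ t) (ht : t < T) :
    (f : X → ℝ) (IccExtend hT γ t) - (f : X → ℝ) (IccExtend hT γ s) = ∫ r in s..t, q r := by
  obtain ⟨L, hL, -⟩ := exists_lip_bound f
  have hac := (hγ.absolutelyContinuousOnInterval hT hL).mono (c := s) (d := t) (by
    rw [uIcc_of_le hst, uIcc_of_le hT]; exact Icc_subset_Icc hs.le ht.le)
  rw [← hac.integral_deriv_eq_sub]
  refine intervalIntegral.integral_congr_ae ?_
  rw [ae_restrict_iff' measurableSet_Ioo] at hq
  filter_upwards [hq] with r hr hrI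
  rw [uIoc_of_le hst] at hrI
  exact (hr ⟨hs.trans hrI.1, hrI.2.trans_lt ht⟩).deriv

end LipschitzOde

/-! ### Passing to the limit with weights: the defect is constant -/

section WeightedConvergence

variable {X : Type*} [MetricSpace X] [SecondCountableTopology X] [MeasurableSpace X]
  [BorelSpace X] {T : ℝ} {m : Measure X}

/-- Convergence of `b_{n,t}(f)` to `b_t(f)` against weakly converging probability densities that
are uniformly bounded. -/
def ConvergesAgainstDensities (T : ℝ) {mn : ℕ → Measure X} {m : Measure X}
    (bn : (n : ℕ) → ℝ → Der (mn n)) (b : ℝ → Der m) (f : LipB X) : Prop :=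
  ∀ (vn : ℕ → ℝ → X → ℝ≥0) (v : ℝ → X → ℝ≥0) (C : ℝ≥0),
    (∀ n, Measurable (Function.uncurry (vn n))) → Measurable (Function.uncurry v) →
    (∀ t ∈ Set.Ioo 0 T,
      (∀ n x, vn n t x ≤ C) ∧
      (∀ n, IsProbabilityMeasure ((mn n).withDensity fun x => (vn n t x : ℝ≥0∞))) ∧
      IsProbabilityMeasure (m.withDensity fun x => (v t x : ℝ≥0∞)) ∧
      WeakTendsto (fun n => (mn n).withDensity fun x => (vn n t x : ℝ≥0∞))
        (m.withDensity fun x => (v t x : ℝ≥0∞))) →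
    Tendsto (fun n => ∫ t in Set.Ioo 0 T, ∫ x, (bn n t).toLin f x * vn n t x ∂(mn n)) atTop
      (𝓝 (∫ t in Set.Ioo 0 T, ∫ x, (b t).toLin f x * v t x ∂m))

/-- The weight `θ / ∫ θ` during `(s,t)`, and `1` at other times. -/
noncomputable def timeWeight (s t : ℝ) {Ω : Type*} [MeasurableSpace Ω] (μ : Measure Ω) (θ : Ω → ℝ)
    (r : ℝ) (ω : Ω) : ℝ :=
  if r ∈ Ioo s t then θ ω / ∫ ω, θ ω ∂μ else 1

/-- Keeps the normalization away from `0`: the weights `θ / ∫ θ` stay below `‖θ‖` uniformly in `n`,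
and quotients pass to the limit. -/
theorem one_le_integral_bcf {Ω : Type*} [TopologicalSpace Ω] [MeasurableSpace Ω]
    [OpensMeasurableSpace Ω] (μ : Measure Ω) [IsProbabilityMeasure μ] {θ : Ω →ᵇ ℝ}
    (hθ : ∀ ω, 1 ≤ θ ω) : 1 ≤ ∫ ω, θ ω ∂μ := by
  calc (1 : ℝ) = ∫ _, (1 : ℝ) ∂μ := by simp
    _ ≤ _ := integral_mono (integrable_const _) (θ.integrable μ) hθ

/-- Normalizing by `∫ θ` gives mass one during `(s,t)`, and the weight `1` gives mass one at other
times. Hence the densities are admissible in the convergence hypothesis at every time. -/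
theorem CompressionLE.exists_timeWeight_density (hT : 0 ≤ T) [SigmaFinite m]
    {π : ProbabilityMeasure C(Icc (0 : ℝ) T, X)} {C : ℝ≥0} (hC : CompressionLE m π C)
    (θ : C(Icc (0 : ℝ) T, X) →ᵇ ℝ) (hθ : ∀ γ, 1 ≤ θ γ) (s t : ℝ) :
    ∃ v : ℝ → X → ℝ≥0, Measurable (Function.uncurry v) ∧ (∀ r x, v r x ≤ ‖θ‖₊ * C) ∧
      (∀ r, IsProbabilityMeasure (m.withDensity fun x => (v r x : ℝ≥0∞))) ∧
      ∀ (r : ℝ) (ψ : X → ℝ), AEStronglyMeasurable ψ m → ∫ x, ψ x * v r x ∂m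
        = ∫ γ : C(Icc (0 : ℝ) T, X), timeWeight s t
            (π : Measure C(Icc (0 : ℝ) T, X)) θ r γ * ψ (IccExtend hT γ r)
          ∂(π : Measure C(Icc (0 : ℝ) T, X)) := by
  set c := ∫ γ, θ γ ∂(π : Measure C(Icc (0 : ℝ) T, X)) with hc
  have hc1 : 1 ≤ c := one_le_integral_bcf _ hθ
  have hc0 : 0 < c := lt_of_lt_of_le one_pos hc1
  have hθn : ∀ γ, θ γ ≤ (‖θ‖₊ : ℝ) := fun γ => (le_abs_self _).trans (θ.norm_coe_le_norm γ)
  obtain ⟨v₁, hm₁, hb₁, hu₁, hi₁⟩ := hC.exists_weighted_density hT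
    (Θ := fun γ => θ γ / c) (M := ‖θ‖₊) (θ.continuous.measurable.div_const c)
    (fun γ => div_nonneg (zero_le_one.trans (hθ γ)) hc0.le)
    (fun γ => (div_le_self (zero_le_one.trans (hθ γ)) hc1).trans (hθn γ))
  obtain ⟨v₀, hm₀, hb₀, hu₀, hi₀⟩ := hC.exists_weighted_density hT
    (Θ := fun _ => 1) (M := ‖θ‖₊) measurable_const (fun _ => zero_le_one)
    (fun γ => (hθ γ).trans (hθn γ))
  refine ⟨fun r x => if r ∈ Ioo s t then v₁ r x else v₀ r x, ?_, fun r x => ?_, fun r => ?_,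
    fun r ψ hψ => ?_⟩
  · exact Measurable.ite (measurable_fst measurableSet_Ioo) hm₁ hm₀
  · dsimp only
    split_ifs
    · exact hb₁ r x
    · exact hb₀ r x
  · by_cases hr : r ∈ Ioo s t
    · simp only [if_pos hr]
      exact ⟨by rw [hu₁, integral_div, ← hc, div_self hc0.ne']; simp⟩
    · simp only [if_neg hr]
      exact ⟨by rw [hu₀]; simp⟩
  · by_cases hr : r ∈ Ioo s t
    · simp only [timeWeight, if_pos hr]
      exact hi₁ r ψ hψ
    · simp only [timeWeight, if_neg hr]
      exact hi₀ r ψ hψ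

theorem tendsto_integral_timeWeight {π : ProbabilityMeasure C(Icc (0 : ℝ) T, X)}
    {πn : ℕ → ProbabilityMeasure C(Icc (0 : ℝ) T, X)} (hπ : Tendsto πn atTop (𝓝 π))
    (θ : C(Icc (0 : ℝ) T, X) →ᵇ ℝ) (hθ : ∀ γ, 1 ≤ θ γ) (s t r : ℝ)
    (ψ : C(Icc (0 : ℝ) T, X) →ᵇ ℝ) :
    Tendsto (fun n => ∫ γ, timeWeight s t (πn n : Measure C(Icc (0 : ℝ) T, X)) θ r γ * ψ γ
        ∂(πn n : Measure C(Icc (0 : ℝ) T, X))) atTop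
      (𝓝 (∫ γ, timeWeight s t (π : Measure C(Icc (0 : ℝ) T, X)) θ r γ * ψ γ
        ∂(π : Measure C(Icc (0 : ℝ) T, X)))) := by
  by_cases hr : r ∈ Ioo s t
  · simp only [timeWeight, if_pos hr, div_mul_eq_mul_div]
    simp only [integral_div]
    refine (tendsto_integral_bcf hπ (θ * ψ)).div (tendsto_integral_bcf hπ θ) ?_
    exact (zero_lt_one.trans_le (one_le_integral_bcf _ hθ)).ne'
  · simp only [timeWeight, if_neg hr, one_mul]
    exact tendsto_integral_bcf hπ ψ

/-- The convergence hypothesis rewritten on curves: the densities of the weighted marginals converge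
weakly at each time, because `πn` converges and evaluations are continuous. -/
theorem ConvergesAgainstDensities.tendsto_timeWeight (hT : 0 ≤ T) {mn : ℕ → Measure X}
    [SigmaFinite m] [∀ n, SigmaFinite (mn n)]
    {bn : (n : ℕ) → ℝ → Der (mn n)} {b : ℝ → Der m} {f : LipB X}
    (hconv : ConvergesAgainstDensities T bn b f)
    {π : ProbabilityMeasure C(Icc (0 : ℝ) T, X)}
    {πn : ℕ → ProbabilityMeasure C(Icc (0 : ℝ) T, X)} (hπ : Tendsto πn atTop (𝓝 π)) {C : ℝ≥0}
    (hCn : ∀ n, CompressionLE (mn n) (πn n) C) (hC : CompressionLE m π C)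
    {Bn : ℕ → ℝ → X → ℝ} {B : ℝ → X → ℝ} (hBn : ∀ n, IsBorelRep T (bn n) f (Bn n))
    (hB : IsBorelRep T b f B) (θ : C(Icc (0 : ℝ) T, X) →ᵇ ℝ) (hθ : ∀ γ, 1 ≤ θ γ) (s t : ℝ) :
    Tendsto (fun n => ∫ r in Ioo 0 T, ∫ γ : C(Icc (0 : ℝ) T, X),
        timeWeight s t (πn n : Measure C(Icc (0 : ℝ) T, X)) θ r γ * Bn n r (IccExtend hT γ r)
        ∂(πn n : Measure C(Icc (0 : ℝ) T, X))) atTop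
      (𝓝 (∫ r in Ioo 0 T, ∫ γ : C(Icc (0 : ℝ) T, X),
        timeWeight s t (π : Measure C(Icc (0 : ℝ) T, X)) θ r γ * B r (IccExtend hT γ r)
        ∂(π : Measure C(Icc (0 : ℝ) T, X)))) := by
  choose vn hvm hvb hvp hvi using fun n => (hCn n).exists_timeWeight_density hT θ hθ s t
  obtain ⟨v, hm, hb, hp, hi⟩ := hC.exists_timeWeight_density hT θ hθ s t
  have hrep : ∀ {m' : Measure X} {b' : ℝ → Der m'} {B' : ℝ → X → ℝ}
      {π' : ProbabilityMeasure C(Icc (0 : ℝ) T, X)} {v' : ℝ → X → ℝ≥0},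
      IsBorelRep T b' f B' → (∀ (r : ℝ) (ψ : X → ℝ), AEStronglyMeasurable ψ m' →
        ∫ x, ψ x * v' r x ∂m' = ∫ γ : C(Icc (0 : ℝ) T, X), timeWeight s t
            (π' : Measure C(Icc (0 : ℝ) T, X)) θ r γ * ψ (IccExtend hT γ r)
          ∂(π' : Measure C(Icc (0 : ℝ) T, X))) →
      ∫ r in Ioo 0 T, ∫ x, (b' r).toLin f x * v' r x ∂m'
        = ∫ r in Ioo 0 T, ∫ γ : C(Icc (0 : ℝ) T, X),
          timeWeight s t (π' : Measure C(Icc (0 : ℝ) T, X)) θ r γ * B' r (IccExtend hT γ r)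
          ∂(π' : Measure C(Icc (0 : ℝ) T, X)) := by
    intro m' b' B' π' v' hB' hi'
    refine integral_congr_ae ?_
    filter_upwards [hB'.2] with r hr
    rw [← hi' r (B' r) (hB'.1.comp measurable_prodMk_left).aestronglyMeasurable]
    refine integral_congr_ae ?_
    filter_upwards [hr] with x hx
    rw [hx]
  have hwd : ∀ {m' : Measure X} {v' : ℝ → X → ℝ≥0} (_ : Measurable (Function.uncurry v'))
      (r : ℝ) (ψ : X →ᵇ ℝ), ∫ x, ψ x ∂(m'.withDensity fun x => (v' r x : ℝ≥0∞))
        = ∫ x, ψ x * v' r x ∂m' := by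
    intro m' v' hv' r ψ
    have hvr : Measurable (v' r) := hv'.comp measurable_prodMk_left
    rw [integral_withDensity_eq_integral_smul hvr]
    refine integral_congr_ae (Eventually.of_forall fun x => ?_)
    simp only [NNReal.smul_def, smul_eq_mul]
    ring
  have key := hconv vn v (‖θ‖₊ * C) hvm hm fun r _ => by
    refine ⟨fun n x => hvb n r x, fun n => hvp n r, hp r, fun ψ _ => ?_⟩
    simp only [hwd (hvm _), hwd hm]
    have h1 : ∀ n, ∫ x, ψ x * vn n r x ∂(mn n) = _ :=
      fun n => hvi n r ψ ψ.continuous.aestronglyMeasurable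
    have h2 : ∫ x, ψ x * v r x ∂m = _ := hi r ψ ψ.continuous.aestronglyMeasurable
    rw [h2]
    simp only [h1]
    exact tendsto_integral_timeWeight hπ θ hθ s t r (evalBCF hT ψ r)
  rw [hrep hB hi] at key
  exact key.congr fun n => hrep (hBn n) (hvi n)

/-- The defect of the integrated equation is almost surely constant. -/
theorem ConvergesAgainstDensities.ae_defect_eq [Nonempty X] (hT : 0 ≤ T) {mn : ℕ → Measure X}
    [SigmaFinite m] [∀ n, SigmaFinite (mn n)] (hmn : ∀ n, FiniteOnBounded (mn n))
    {bn : (n : ℕ) → ℝ → Der (mn n)} {b : ℝ → Der m} (hbn : ∀ n, IsBorelFamily T (bn n))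
    {f : LipB X} (hconv : ConvergesAgainstDensities T bn b f)
    {π : ProbabilityMeasure C(Icc (0 : ℝ) T, X)}
    {πn : ℕ → ProbabilityMeasure C(Icc (0 : ℝ) T, X)} (hπ : Tendsto πn atTop (𝓝 π)) {C : ℝ≥0}
    (hflow : ∀ n, IsRegularGeneralizedFlow hT (bn n) (πn n))
    (hCn : ∀ n, CompressionLE (mn n) (πn n) C) (hC : CompressionLE m π C)
    {B : ℝ → X → ℝ} (hB : IsBorelRep T b f B)
    (hint : ∫⁻ t in Ioo 0 T, l1PlusLinfNorm m ((b t).toLin f) < ∞)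
    (hintn : ∀ n, ∫⁻ t in Ioo 0 T, l1PlusLinfNorm (mn n) ((bn n t).toLin f) < ∞)
    {s t : ℝ} (hs : 0 < s) (hst : s ≤ t) (ht : t < T) :
    ∃ c : ℝ, ∀ᵐ γ : C(Icc (0 : ℝ) T, X) ∂(π : Measure C(Icc (0 : ℝ) T, X)),
      (f : X → ℝ) (IccExtend hT γ t) - (f : X → ℝ) (IccExtend hT γ s)
        - ∫ r in s..t, B r (IccExtend hT γ r) = c := by
  choose Bn hBn using fun n => (hbn n).2 f
  have hI := hC.integrable_eval hT hB hint
  have hIn := fun n => (hCn n).integrable_eval hT (hBn n) (hintn n)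
  let Δ : C(Icc (0 : ℝ) T, X) →ᵇ ℝ := evalBCF hT (toBCF f) t - evalBCF hT (toBCF f) s
  have hΔ : ∀ γ, Δ γ = (f : X → ℝ) (IccExtend hT γ t) - (f : X → ℝ) (IccExtend hT γ s) :=
    fun γ => rfl
  have hII : Integrable (fun γ : C(Icc (0 : ℝ) T, X) => ∫ r in s..t, B r (IccExtend hT γ r))
      (π : Measure C(Icc (0 : ℝ) T, X)) :=
    integrable_intervalIntegral (q := fun r (γ : C(Icc (0 : ℝ) T, X)) => B r (IccExtend hT γ r))
      hs.le hst ht.le hI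
  have hZ : Integrable (fun γ : C(Icc (0 : ℝ) T, X) => Δ γ - ∫ r in s..t, B r (IccExtend hT γ r))
      (π : Measure C(Icc (0 : ℝ) T, X)) := (Δ.integrable _).sub hII
  refine ⟨_, ae_eq_integral_of_uncorrelated hZ fun θ hθ => ?_⟩
  -- differences of the weighted time integrals
  have hdiff : ∀ {π' : ProbabilityMeasure C(Icc (0 : ℝ) T, X)} {B' : ℝ → X → ℝ},
      Integrable (fun p : ℝ × C(Icc (0 : ℝ) T, X) => B' p.1 (IccExtend hT p.2 p.1))
        ((volume.restrict (Ioo 0 T)).prod (π' : Measure C(Icc (0 : ℝ) T, X))) →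
      ∫ r in Ioo 0 T, ∫ γ : C(Icc (0 : ℝ) T, X),
        timeWeight s t (π' : Measure C(Icc (0 : ℝ) T, X)) θ r γ * B' r (IccExtend hT γ r)
        ∂(π' : Measure C(Icc (0 : ℝ) T, X))
      = ∫ γ : C(Icc (0 : ℝ) T, X), (θ γ / (∫ γ, θ γ ∂(π' : Measure C(Icc (0 : ℝ) T, X))) - 1)
          * (∫ r in s..t, B' r (IccExtend hT γ r)) ∂(π' : Measure C(Icc (0 : ℝ) T, X))
        + ∫ r in Ioo 0 T, ∫ γ : C(Icc (0 : ℝ) T, X), B' r (IccExtend hT γ r)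
          ∂(π' : Measure C(Icc (0 : ℝ) T, X)) := by
    intro π' B' hI'
    have hc1 := one_le_integral_bcf (π' : Measure C(Icc (0 : ℝ) T, X)) hθ
    refine setIntegral_integral_weight
      (q := fun r (γ : C(Icc (0 : ℝ) T, X)) => B' r (IccExtend hT γ r)) hs.le hst ht.le hI'
      (θ.continuous.measurable.div_const _) (M := ‖θ‖) fun γ => ?_
    rw [abs_div, abs_of_nonneg (zero_le_one.trans hc1)]
    exact (div_le_self (abs_nonneg _) hc1).trans (θ.norm_coe_le_norm γ)
  have h1θ : ∀ γ, 1 ≤ (BoundedContinuousFunction.const C(Icc (0 : ℝ) T, X) (1 : ℝ)) γ :=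
    fun γ => le_rfl
  have hone : ∀ (π' : ProbabilityMeasure C(Icc (0 : ℝ) T, X)) r γ,
      timeWeight s t (π' : Measure C(Icc (0 : ℝ) T, X))
        (BoundedContinuousFunction.const C(Icc (0 : ℝ) T, X) (1 : ℝ)) r γ = 1 := by
    intro π' r γ
    simp [timeWeight]
  -- Neither limit is localized in time, but the two weights agree outside `(s,t)`, so their
  -- difference involves only the integral of `b` over `(s,t)`.
  have L1 := hconv.tendsto_timeWeight hT hπ hCn hC hBn hB θ hθ s t
  have L0 := hconv.tendsto_timeWeight hT hπ hCn hC hBn hB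
    (BoundedContinuousFunction.const C(Icc (0 : ℝ) T, X) (1 : ℝ)) h1θ s t
  simp only [hone, one_mul] at L0
  have L := L1.sub L0
  rw [hdiff hI, add_sub_cancel_right] at L
  have Ln := L.congr fun n => by rw [hdiff (hIn n), add_sub_cancel_right]
  -- along the approximating flows the integrated equation holds
  have hE : ∀ n, ∫ γ : C(Icc (0 : ℝ) T, X),
      (θ γ / (∫ γ, θ γ ∂(πn n : Measure C(Icc (0 : ℝ) T, X))) - 1)
          * (∫ r in s..t, Bn n r (IccExtend hT γ r)) ∂(πn n : Measure C(Icc (0 : ℝ) T, X))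
      = (∫ γ, (θ * Δ) γ ∂(πn n : Measure C(Icc (0 : ℝ) T, X)))
          / (∫ γ, θ γ ∂(πn n : Measure C(Icc (0 : ℝ) T, X)))
        - ∫ γ, Δ γ ∂(πn n : Measure C(Icc (0 : ℝ) T, X)) := by
    intro n
    rw [← integral_div, ← integral_sub (((θ * Δ).integrable _).div_const _) (Δ.integrable _)]
    refine integral_congr_ae ?_
    filter_upwards [(hflow n).ac, (hflow n).ae_hasDerivAt hT (hmn n) (hbn n) (hBn n)]
      with γ hγ hode
    rw [← hγ.sub_eq_integral hT f hode hs hst ht, ← hΔ, BoundedContinuousFunction.mul_apply]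
    ring
  simp only [hE] at Ln
  have hc0 : (∫ γ, θ γ ∂(π : Measure C(Icc (0 : ℝ) T, X))) ≠ 0 :=
    (zero_lt_one.trans_le (one_le_integral_bcf _ hθ)).ne'
  have Llim := ((tendsto_integral_bcf hπ (θ * Δ)).div (tendsto_integral_bcf hπ θ) hc0).sub
    (tendsto_integral_bcf hπ Δ)
  -- The covariances of `θ` with the increment of `f` and with the integral of `b_r(f)` agree under
  -- `π`, up to the normalization by `∫ θ`.
  have heq := tendsto_nhds_unique Ln Llim
  set c := ∫ γ, θ γ ∂(π : Measure C(Icc (0 : ℝ) T, X)) with hc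
  have hθI : Integrable (fun γ : C(Icc (0 : ℝ) T, X) =>
      θ γ * ∫ r in s..t, B r (IccExtend hT γ r)) (π : Measure C(Icc (0 : ℝ) T, X)) :=
    hII.bdd_mul (c := ‖θ‖) θ.continuous.aestronglyMeasurable
      (Eventually.of_forall fun γ => θ.norm_coe_le_norm γ)
  have e1 : ∀ γ : C(Icc (0 : ℝ) T, X), (θ γ / c - 1) * (∫ r in s..t, B r (IccExtend hT γ r))
      = (θ γ * ∫ r in s..t, B r (IccExtend hT γ r)) / c
        - ∫ r in s..t, B r (IccExtend hT γ r) := fun γ => by ring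
  simp only [e1] at heq
  rw [integral_sub (hθI.div_const c) hII, integral_div] at heq
  have e2 : ∀ γ : C(Icc (0 : ℝ) T, X), θ γ * (Δ γ - ∫ r in s..t, B r (IccExtend hT γ r))
      = (θ * Δ) γ - θ γ * ∫ r in s..t, B r (IccExtend hT γ r) := fun γ => by
    rw [BoundedContinuousFunction.mul_apply]
    ring
  simp only [← hΔ, e2]
  rw [integral_sub ((θ * Δ).integrable _) hθI, integral_sub (Δ.integrable _) hII]
  field_simp at heq
  linarith

end WeightedConvergence

/-! ### Defects depending on time only, and their stability -/

section DeterministicDefect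

variable {X : Type*} [MetricSpace X] [SecondCountableTopology X] [MeasurableSpace X]
  [BorelSpace X] {T : ℝ} {m : Measure X}

/-- Along almost every curve the derivative of `f` is `b_t(f)` up to an error that depends on time
only. -/
def HasDeterministicDefect (hT : 0 ≤ T) (b : ℝ → Der m)
    (π : ProbabilityMeasure C(Icc (0 : ℝ) T, X)) (f : LipB X) : Prop :=
  ∃ (B : ℝ → X → ℝ) (a : ℝ → ℝ), IsBorelRep T b f B ∧ Measurable a ∧
    ∀ᵐ γ : C(Icc (0 : ℝ) T, X) ∂(π : Measure C(Icc (0 : ℝ) T, X)),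
      ∀ᵐ r ∂(volume.restrict (Ioo 0 T)),
        HasDerivAt (fun s => (f : X → ℝ) (IccExtend hT γ s)) (B r (IccExtend hT γ r) + a r) r

variable {b : ℝ → Der m} {π : ProbabilityMeasure C(Icc (0 : ℝ) T, X)}

/-- The defect of one fixed good curve `γ₀` serves as `a`, so only differences between two curves
have to be controlled. -/
theorem HasDeterministicDefect.of_pairs (hT : 0 ≤ T)
    (hAC : ∀ᵐ γ ∂(π : Measure C(Icc (0 : ℝ) T, X)), IsAC γ) {f : LipB X} {B : ℝ → X → ℝ}
    (hB : IsBorelRep T b f B) {p : C(Icc (0 : ℝ) T, X) → Prop}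
    (hp : ∀ᵐ γ ∂(π : Measure C(Icc (0 : ℝ) T, X)), p γ)
    (h : ∀ γ γ₀ : C(Icc (0 : ℝ) T, X), p γ → p γ₀ → ∀ᵐ r ∂(volume.restrict (Ioo 0 T)),
      HasDerivAt (fun s => (f : X → ℝ) (IccExtend hT γ s) - (f : X → ℝ) (IccExtend hT γ₀ s))
        (B r (IccExtend hT γ r) - B r (IccExtend hT γ₀ r)) r) :
    HasDeterministicDefect hT b π f := by
  obtain ⟨γ₀, hγ₀, hp₀⟩ := (hAC.and hp).exists
  obtain ⟨L, hL, -⟩ := exists_lip_bound f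
  refine ⟨B, fun r => deriv (fun s => (f : X → ℝ) (IccExtend hT γ₀ s)) r - B r (IccExtend hT γ₀ r),
    hB, (measurable_deriv _).sub (hB.1.comp
      (measurable_id.prodMk (continuous_IccExtend_coe hT γ₀).measurable)), ?_⟩
  have hd := (hγ₀.absolutelyContinuousOnInterval hT hL).ae_differentiableAt
  filter_upwards [hp] with γ hγ
  have hd' : ∀ᵐ r ∂(volume.restrict (Ioo 0 T)),
      DifferentiableAt ℝ (fun s => (f : X → ℝ) (IccExtend hT γ₀ s)) r := by
    rw [ae_restrict_iff' measurableSet_Ioo]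
    filter_upwards [hd] with r hr hrI
    exact hr (by rw [uIcc_of_le hT]; exact Ioo_subset_Icc_self hrI)
  filter_upwards [h γ γ₀ hγ hp₀, hd'] with r hr hr'
  have := hr.add hr'.hasDerivAt
  refine (this.congr_of_eventuallyEq (Eventually.of_forall fun s => ?_)).congr_deriv ?_
  · simp
  · ring

theorem HasDeterministicDefect.of_rep (hT : 0 ≤ T) {C : ℝ≥0} (hC : CompressionLE m π C)
    {f : LipB X} (hf : HasDeterministicDefect hT b π f) {B : ℝ → X → ℝ}
    (hB : IsBorelRep T b f B) :
    ∃ a : ℝ → ℝ, Measurable a ∧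
      ∀ᵐ γ : C(Icc (0 : ℝ) T, X) ∂(π : Measure C(Icc (0 : ℝ) T, X)),
        ∀ᵐ r ∂(volume.restrict (Ioo 0 T)),
          HasDerivAt (fun s => (f : X → ℝ) (IccExtend hT γ s))
            (B r (IccExtend hT γ r) + a r) r := by
  obtain ⟨B', a, hB', ha, h⟩ := hf
  have heq : ∀ᵐ γ : C(Icc (0 : ℝ) T, X) ∂(π : Measure C(Icc (0 : ℝ) T, X)),
      ∀ᵐ r ∂(volume.restrict (Ioo 0 T)), B r (IccExtend hT γ r) = B' r (IccExtend hT γ r) := by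
    refine hC.ae_ae_eval hT (P := fun r x => B r x = B' r x) (measurableSet_eq_fun hB.1 hB'.1) ?_
    filter_upwards [hB.2, hB'.2] with r h1 h2
    exact h1.trans h2.symm
  refine ⟨a, ha, ?_⟩
  filter_upwards [h, heq] with γ h1 h2
  filter_upwards [h1, h2] with r h3 h4
  rwa [h4]

theorem IsBorelRep.combo {f g : LipB X} {B B' : ℝ → X → ℝ} (hB : IsBorelRep T b f B)
    (hB' : IsBorelRep T b g B') (α β : ℝ) :
    IsBorelRep T b (α • f + β • g) fun r x => α * B r x + β * B' r x := by
  refine ⟨(hB.1.const_mul α).add (hB'.1.const_mul β), ?_⟩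
  filter_upwards [hB.2, hB'.2] with r h1 h2
  filter_upwards [h1, h2, coeFn_map_add (b r).toLin (α • f) (β • g),
    coeFn_map_smul (b r).toLin α f, coeFn_map_smul (b r).toLin β g] with x a1 a2 a3 a4 a5
  rw [a3, a4, a5, a1, a2]

theorem convex_hasDeterministicDefect (hT : 0 ≤ T) :
    Convex ℝ {f : LipB X | HasDeterministicDefect hT b π f} := by
  rintro f ⟨B, a, hB, ha, h⟩ g ⟨B', a', hB', ha', h'⟩ α β _ _ _
  refine ⟨_, fun r => α * a r + β * a' r, hB.combo hB' α β,
    (ha.const_mul α).add (ha'.const_mul β), ?_⟩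
  filter_upwards [h, h'] with γ h1 h2
  filter_upwards [h1, h2] with r h3 h4
  refine ((h3.const_mul α).add (h4.const_mul β)).congr_deriv ?_
  ring

/-- If the defect of the integrated equation is constant for all rational times, it is the integral
of a function of time. -/
theorem HasDeterministicDefect.of_ae_defect_eq (hT : 0 ≤ T)
    (hAC : ∀ᵐ γ ∂(π : Measure C(Icc (0 : ℝ) T, X)), IsAC γ) {f : LipB X} {B : ℝ → X → ℝ}
    (hB : IsBorelRep T b f B)
    (hi : ∀ᵐ γ : C(Icc (0 : ℝ) T, X) ∂(π : Measure C(Icc (0 : ℝ) T, X)),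
      IntegrableOn (fun r => B r (IccExtend hT γ r)) (Ioo 0 T))
    (h : ∀ s t : ℝ, 0 < s → s ≤ t → t < T → ∃ c : ℝ,
      ∀ᵐ γ : C(Icc (0 : ℝ) T, X) ∂(π : Measure C(Icc (0 : ℝ) T, X)),
        (f : X → ℝ) (IccExtend hT γ t) - (f : X → ℝ) (IccExtend hT γ s)
          - ∫ r in s..t, B r (IccExtend hT γ r) = c) :
    HasDeterministicDefect hT b π f := by
  -- With rational times only, a single null set of curves is discarded. The constants `c` then
  -- cancel between two remaining curves, so no regularity of `c` in time is needed.
  have h' : ∀ st : ℚ × ℚ, ∃ c : ℝ, 0 < (st.1 : ℝ) → (st.1 : ℝ) ≤ st.2 → (st.2 : ℝ) < T →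
      ∀ᵐ γ : C(Icc (0 : ℝ) T, X) ∂(π : Measure C(Icc (0 : ℝ) T, X)),
        (f : X → ℝ) (IccExtend hT γ st.2) - (f : X → ℝ) (IccExtend hT γ st.1)
          - ∫ r in (st.1 : ℝ)..st.2, B r (IccExtend hT γ r) = c := by
    intro st
    by_cases hst : 0 < (st.1 : ℝ) ∧ (st.1 : ℝ) ≤ st.2 ∧ (st.2 : ℝ) < T
    · obtain ⟨c, hc⟩ := h st.1 st.2 hst.1 hst.2.1 hst.2.2
      exact ⟨c, fun _ _ _ => hc⟩
    · exact ⟨0, fun h1 h2 h3 => absurd ⟨h1, h2, h3⟩ hst⟩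
  choose c hc using h'
  have hall : ∀ᵐ γ : C(Icc (0 : ℝ) T, X) ∂(π : Measure C(Icc (0 : ℝ) T, X)),
      ∀ st : ℚ × ℚ, 0 < (st.1 : ℝ) → (st.1 : ℝ) ≤ st.2 → (st.2 : ℝ) < T →
        (f : X → ℝ) (IccExtend hT γ st.2) - (f : X → ℝ) (IccExtend hT γ st.1)
          - ∫ r in (st.1 : ℝ)..st.2, B r (IccExtend hT γ r) = c st := by
    refine ae_all_iff.2 fun st => ?_
    by_cases hst : 0 < (st.1 : ℝ) ∧ (st.1 : ℝ) ≤ st.2 ∧ (st.2 : ℝ) < T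
    · filter_upwards [hc st hst.1 hst.2.1 hst.2.2] with γ hγ _ _ _
      exact hγ
    · exact Eventually.of_forall fun γ h1 h2 h3 => absurd ⟨h1, h2, h3⟩ hst
  refine HasDeterministicDefect.of_pairs hT hAC hB (hi.and hall) ?_
  rintro γ γ₀ ⟨hi1, h1⟩ ⟨hi2, h2⟩
  refine ae_hasDerivAt_of_rat_increments
    (((continuous_lipB f).comp (continuous_IccExtend_coe hT γ)).sub
      ((continuous_lipB f).comp (continuous_IccExtend_coe hT γ₀))) (hi1.sub hi2) ?_
  intro s t hs hst ht
  have hI : ∀ {q : ℝ → ℝ}, IntegrableOn q (Ioo 0 T) → IntervalIntegrable q volume s t := by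
    intro q hq
    rw [intervalIntegrable_iff_integrableOn_Ioo_of_le hst.le]
    exact hq.mono_set (Ioo_subset_Ioo hs.le ht.le)
  rw [intervalIntegral.integral_sub (hI hi1) (hI hi2)]
  have e1 := h1 (s, t) hs hst.le ht
  have e2 := h2 (s, t) hs hst.le ht
  linarith

theorem tendsto_of_mem_convexHull_tail {F G : ℕ → LipB X}
    (hG : ∀ j, G j ∈ convexHull ℝ (F '' Ici j)) {x : X} {y : ℝ}
    (h : Tendsto (fun k => (F k : X → ℝ) x) atTop (𝓝 y)) :
    Tendsto (fun j => (G j : X → ℝ) x) atTop (𝓝 y) := by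
  rw [Metric.tendsto_atTop'] at h ⊢
  intro ε hε
  obtain ⟨N, hN⟩ := h ε hε
  refine ⟨N, fun j hj => ?_⟩
  have hconv : Convex ℝ {H : LipB X | (H : X → ℝ) x ∈ Metric.ball y ε} :=
    (convex_ball y ε).is_linear_preimage (f := fun H : LipB X => (H : X → ℝ) x)
      ⟨fun _ _ => rfl, fun _ _ => rfl⟩
  refine convexHull_min ?_ hconv (hG j)
  rintro _ ⟨k, hk, rfl⟩
  exact hN k (lt_of_lt_of_le hj hk)

/-- The defects of the approximations are not known to converge, so the limit is taken in the
difference of two curves, where they cancel. Convex combinations inherit both a deterministic defect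
and the uniform Lipschitz bound. -/
theorem HasDeterministicDefect.of_flatTendsto [Nonempty X] (hT : 0 ≤ T) {C : ℝ≥0}
    (hC : CompressionLE m π C) (hb : IsBorelFamily T b) (hK : FlatConvexClosed T b)
    (hAC : ∀ᵐ γ ∂(π : Measure C(Icc (0 : ℝ) T, X)), IsAC γ) {F : ℕ → LipB X} {f : LipB X}
    (hF : FlatTendsto m F f) (hFd : ∀ k, HasDeterministicDefect hT b π (F k)) :
    HasDeterministicDefect hT b π f := by
  obtain ⟨x₀⟩ := ‹Nonempty X›
  obtain ⟨B, hB⟩ := hb.2 f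
  have hk : ∀ k : ℕ, (0 : ℝ) < (k : ℝ) + 1 := fun k => by positivity
  choose G hG hlim using fun k : ℕ => hK F f hF x₀ ((k : ℝ) + 1) (hk k)
  obtain ⟨⟨K, hFK⟩, hFlim⟩ := hF
  have hGK : ∀ k j, LipschitzWith K (G k j : X → ℝ) := fun k j =>
    (lipschitzWith_abs_le_of_mem_convexHull
      (S := F '' Ici j) (by rintro _ ⟨i, -, rfl⟩; exact hFK i) (hG k j)).1
  have hGd : ∀ k j, HasDeterministicDefect hT b π (G k j) := fun k j =>
    convexHull_min (by rintro _ ⟨i, -, rfl⟩; exact hFd i)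
      (convex_hasDeterministicDefect hT) (hG k j)
  choose Bg a hBg ha hder using hGd
  have h1 : ∀ᵐ γ : C(Icc (0 : ℝ) T, X) ∂(π : Measure C(Icc (0 : ℝ) T, X)),
      ∀ k j, ∀ᵐ r ∂(volume.restrict (Ioo 0 T)),
        HasDerivAt (fun s => (G k j : X → ℝ) (IccExtend hT γ s))
          (Bg k j r (IccExtend hT γ r) + a k j r) r :=
    ae_all_iff.2 fun k => ae_all_iff.2 fun j => hder k j
  have h2 : ∀ᵐ γ : C(Icc (0 : ℝ) T, X) ∂(π : Measure C(Icc (0 : ℝ) T, X)),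
      ∀ k : ℕ, ∀ᵐ r ∂(volume.restrict (Ioo 0 T)),
        IccExtend hT γ r ∈ Metric.ball x₀ ((k : ℝ) + 1) →
          Tendsto (fun j => Bg k j r (IccExtend hT γ r)) atTop (𝓝 (B r (IccExtend hT γ r))) := by
    refine ae_all_iff.2 fun k => ?_
    refine hC.ae_ae_eval hT (P := fun r x => x ∈ Metric.ball x₀ ((k : ℝ) + 1) →
      Tendsto (fun j => Bg k j r x) atTop (𝓝 (B r x))) ?_ ?_
    · refine MeasurableSet.imp ?_ ?_
      · exact measurable_snd Metric.isOpen_ball.measurableSet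
      · exact measurableSet_tendsto_fun (fun j => (hBg k j).1) hB.1
    · filter_upwards [hlim k, hB.2, ae_all_iff.2 fun j => (hBg k j).2] with r hr hr' hr''
      filter_upwards [hr, hr', ae_all_iff.2 hr''] with x a1 a2 a3 hx
      simp only [a2, a3]
      exact a1 hx
  have h3 : ∀ᵐ γ : C(Icc (0 : ℝ) T, X) ∂(π : Measure C(Icc (0 : ℝ) T, X)),
      ∀ t : ℚ, Tendsto (fun k => (F k : X → ℝ) (IccExtend hT γ t)) atTop
        (𝓝 ((f : X → ℝ) (IccExtend hT γ t))) :=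
    ae_all_iff.2 fun t => hC.ae_eval hT t hFlim
  refine HasDeterministicDefect.of_pairs hT hAC hB (hAC.and (h1.and (h2.and h3))) ?_
  rintro γ γ₀ ⟨hγ, hd, hl, ht⟩ ⟨hγ₀, hd₀, hl₀, ht₀⟩
  have hbdd : Bornology.IsBounded (range (IccExtend hT γ) ∪ range (IccExtend hT γ₀)) := by
    rw [IccExtend_range, IccExtend_range]
    exact (isCompact_range γ.continuous).isBounded.union (isCompact_range γ₀.continuous).isBounded
  obtain ⟨R, hR⟩ := hbdd.subset_ball x₀
  -- The combinations depend on the ball; `k` is chosen so that its ball contains both curves.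
  obtain ⟨k, hk'⟩ := exists_nat_ge R
  have hin : ∀ r, IccExtend hT γ r ∈ Metric.ball x₀ ((k : ℝ) + 1) := fun r =>
    Metric.ball_subset_ball (by linarith) (hR (Or.inl (mem_range_self r)))
  have hin₀ : ∀ r, IccExtend hT γ₀ r ∈ Metric.ball x₀ ((k : ℝ) + 1) := fun r =>
    Metric.ball_subset_ball (by linarith) (hR (Or.inr (mem_range_self r)))
  obtain ⟨g, hg, hgd⟩ := hγ.exists_speed hT
  obtain ⟨g₀, hg₀, hgd₀⟩ := hγ₀.exists_speed hT
  set q : ℝ → ℝ := fun r => B r (IccExtend hT γ r) - B r (IccExtend hT γ₀ r) with hq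
  set qj : ℕ → ℝ → ℝ := fun j r => Bg k j r (IccExtend hT γ r) - Bg k j r (IccExtend hT γ₀ r)
    with hqj
  have hmeas : ∀ {B' : ℝ → X → ℝ} (_ : Measurable (Function.uncurry B'))
      (γ' : C(Icc (0 : ℝ) T, X)), Measurable fun r => B' r (IccExtend hT γ' r) := fun hB' γ' =>
    hB'.comp (measurable_id.prodMk (continuous_IccExtend_coe hT γ').measurable)
  have hqjm : ∀ j, Measurable (qj j) := fun j =>
    (hmeas (hBg k j).1 γ).sub (hmeas (hBg k j).1 γ₀)
  have hqm : Measurable q := (hmeas hB.1 γ).sub (hmeas hB.1 γ₀)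
  have hqlim : ∀ᵐ r ∂(volume.restrict (Ioo 0 T)),
      Tendsto (fun j => qj j r) atTop (𝓝 (q r)) := by
    filter_upwards [hl k, hl₀ k] with r a1 a2
    exact (a1 (hin r)).sub (a2 (hin₀ r))
  have hqd : ∀ j, ∀ᵐ r ∂(volume.restrict (Ioo 0 T)), HasDerivAt (fun s =>
      (G k j : X → ℝ) (IccExtend hT γ s) - (G k j : X → ℝ) (IccExtend hT γ₀ s)) (qj j r) r := by
    intro j
    filter_upwards [hd k j, hd₀ k j] with r a1 a2
    exact (a1.sub a2).congr_deriv (by simp only [hqj]; ring)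
  -- `qj` is also a difference of derivatives of a `K`-Lipschitz function along the two curves,
  -- hence bounded by `K` times their speeds. This dominates the limit and makes `q` integrable.
  have hqb : ∀ j, ∀ᵐ r ∂(volume.restrict (Ioo 0 T)), ‖qj j r‖ ≤ K * g r + K * g₀ r := by
    intro j
    filter_upwards [hd k j, hd₀ k j, hgd _ K (hGK k j), hgd₀ _ K (hGK k j)] with r a1 a2 a3 a4
    rw [a1.deriv] at a3
    rw [a2.deriv] at a4
    have e : qj j r = (Bg k j r (IccExtend hT γ r) + a k j r)
        - (Bg k j r (IccExtend hT γ₀ r) + a k j r) := by simp only [hqj]; ring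
    rw [e, Real.norm_eq_abs]
    exact (abs_sub _ _).trans (add_le_add a3 a4)
  have hdom : IntegrableOn (fun r => K * g r + K * g₀ r) (Ioo 0 T) :=
    (hg.const_mul _).add (hg₀.const_mul _)
  have hqi : IntegrableOn q (Ioo 0 T) := by
    refine Integrable.mono' hdom hqm.aestronglyMeasurable ?_
    filter_upwards [hqlim, ae_all_iff.2 hqb] with r a1 a2
    exact le_of_tendsto a1.norm (Eventually.of_forall a2)
  refine ae_hasDerivAt_of_rat_increments
    (((continuous_lipB f).comp (continuous_IccExtend_coe hT γ)).sub
      ((continuous_lipB f).comp (continuous_IccExtend_coe hT γ₀))) hqi ?_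
  intro s t hs hst htT
  have hsub : Ioc (s : ℝ) t ⊆ Ioo 0 T := fun r hr => ⟨hs.trans hr.1, hr.2.trans_lt htT⟩
  have hres : ∀ {p : ℝ → Prop}, (∀ᵐ r ∂(volume.restrict (Ioo 0 T)), p r) →
      ∀ᵐ r, r ∈ uIoc (s : ℝ) t → p r := by
    intro p hp
    rw [ae_restrict_iff' measurableSet_Ioo] at hp
    filter_upwards [hp] with r hr hrI
    rw [uIoc_of_le hst.le] at hrI
    exact hr (hsub hrI)
  have hint : ∀ j, ∫ r in (s : ℝ)..t, qj j r
      = ((G k j : X → ℝ) (IccExtend hT γ t) - (G k j : X → ℝ) (IccExtend hT γ₀ t))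
        - ((G k j : X → ℝ) (IccExtend hT γ s) - (G k j : X → ℝ) (IccExtend hT γ₀ s)) := by
    intro j
    have hac := ((hγ.absolutelyContinuousOnInterval hT (hGK k j)).sub
      (hγ₀.absolutelyContinuousOnInterval hT (hGK k j))).mono (c := s) (d := t) (by
      rw [uIcc_of_le hst.le, uIcc_of_le hT]; exact Icc_subset_Icc hs.le htT.le)
    have h4 := hac.integral_deriv_eq_sub
    refine Eq.trans ?_ h4
    refine intervalIntegral.integral_congr_ae ?_
    filter_upwards [hres (hqd j)] with r hr hrI
    exact (hr hrI).deriv.symm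
  have hL1 : Tendsto (fun j => ∫ r in (s : ℝ)..t, qj j r) atTop
      (𝓝 (∫ r in (s : ℝ)..t, q r)) := by
    refine intervalIntegral.tendsto_integral_filter_of_dominated_convergence
      (fun r => K * g r + K * g₀ r) (Eventually.of_forall fun j => (hqjm j).aestronglyMeasurable)
      (Eventually.of_forall fun j => hres (hqb j)) ?_ (hres hqlim)
    rw [intervalIntegrable_iff_integrableOn_Ioc_of_le hst.le]
    exact hdom.mono_set hsub
  simp only [hint] at hL1
  have hL2 := ((tendsto_of_mem_convexHull_tail (hG k) (ht t)).sub
    (tendsto_of_mem_convexHull_tail (hG k) (ht₀ t))).sub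
    ((tendsto_of_mem_convexHull_tail (hG k) (ht s)).sub
    (tendsto_of_mem_convexHull_tail (hG k) (ht₀ s)))
  exact tendsto_nhds_unique hL2 hL1

end DeterministicDefect

/-! ### The defect vanishes -/

section NoDefect

variable {X : Type*} [MetricSpace X] [SecondCountableTopology X] [MeasurableSpace X]
  [BorelSpace X] {T : ℝ} {m : Measure X} {b : ℝ → Der m}
  {π : ProbabilityMeasure C(Icc (0 : ℝ) T, X)}

theorem ae_ae_deriv_eval_swap (hT : 0 ≤ T) {f : X → ℝ} (hf : Continuous f)
    {P : ℝ → X → ℝ → Prop} (hP : MeasurableSet {p : ℝ × X × ℝ | P p.1 p.2.1 p.2.2}) :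
    (∀ᵐ γ : C(Icc (0 : ℝ) T, X) ∂(π : Measure C(Icc (0 : ℝ) T, X)),
      ∀ᵐ r ∂(volume.restrict (Ioo 0 T)),
        P r (IccExtend hT γ r) (deriv (fun s => f (IccExtend hT γ s)) r)) ↔
    ∀ᵐ r ∂(volume.restrict (Ioo 0 T)),
      ∀ᵐ γ : C(Icc (0 : ℝ) T, X) ∂(π : Measure C(Icc (0 : ℝ) T, X)),
        P r (IccExtend hT γ r) (deriv (fun s => f (IccExtend hT γ s)) r) := by
  refine (Measure.ae_ae_comm (p := fun r (γ : C(Icc (0 : ℝ) T, X)) =>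
    P r (IccExtend hT γ r) (deriv (fun s => f (IccExtend hT γ s)) r)) ?_).symm
  exact (measurable_fst.prodMk
    ((measurable_IccExtend_eval hT).prodMk (measurable_deriv_eval hT hf))) hP

/-- Countably many cutoffs separate all pairs of points, so that one null set of times and curves is
enough. A radius below `dist x y / 4` keeps `y` farther than three radii from the centre. -/
theorem exists_bump_separating [Nonempty X] {x y : X} (hxy : x ≠ y) :
    ∃ i : ℕ × ℕ, dist x (TopologicalSpace.denseSeq X i.1) < 1 / ((i.2 : ℝ) + 1) ∧
      2 * (1 / ((i.2 : ℝ) + 1)) < dist y (TopologicalSpace.denseSeq X i.1) := by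
  have hd : 0 < dist x y / 4 := by have := dist_pos.2 hxy; positivity
  obtain ⟨q, hq⟩ := exists_nat_one_div_lt hd
  have hq0 : (0 : ℝ) < 1 / ((q : ℝ) + 1) := by positivity
  obtain ⟨_, hi, ⟨i, rfl⟩⟩ := Metric.dense_iff.1 (TopologicalSpace.denseRange_denseSeq X) x _ hq0
  rw [Metric.mem_ball'] at hi
  refine ⟨(i, q), hi, ?_⟩
  have h1 := dist_triangle x (TopologicalSpace.denseSeq X i) y
  rw [dist_comm (TopologicalSpace.denseSeq X i) y] at h1
  simp only
  linarith

/-- A defect that depends on time only vanishes, because two curves at different positions can be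
told apart by a cutoff, and `b_t` vanishes at the atoms of `m`. -/
theorem ae_hasDerivAt_of_hasDeterministicDefect [Nonempty X] (hT : 0 ≤ T) [SigmaFinite m]
    (hm : FiniteOnBounded m) (hb : IsBorelFamily T b) (hK : FlatConvexClosed T b) {C : ℝ≥0}
    (hC : CompressionLE m π C)
    (h : ∀ f : LipB X, HasDeterministicDefect hT b π f) {f : LipB X} {B : ℝ → X → ℝ}
    (hB : IsBorelRep T b f B) :
    ∀ᵐ p ∂((volume.restrict (Ioo 0 T)).prod (π : Measure C(Icc (0 : ℝ) T, X))),
      HasDerivAt (fun s => (f : X → ℝ) (IccExtend hT p.2 s)) (B p.1 (IccExtend hT p.2 p.1)) p.1 := by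
  let c : ℕ × ℕ → X := fun i => TopologicalSpace.denseSeq X i.1
  have hρ : ∀ i : ℕ × ℕ, (0 : ℝ) < 1 / ((i.2 : ℝ) + 1) := fun i => by positivity
  let g : ℕ × ℕ → LipB X := fun i => mulLip f (bump (c i) (hρ i))
  choose Bg hBg using fun i => hb.2 (g i)
  obtain ⟨a, ha, hda⟩ := (h f).of_rep hT hC hB
  choose ag hag hdag using fun i => (h (g i)).of_rep hT hC (hBg i)
  -- There are countably many atoms, so what holds at each of them for almost every time holds at
  -- all of them simultaneously.
  let S : Set X := {p | m {p} ≠ 0}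
  have hS : S.Countable := by
    have := Measure.countable_meas_pos_of_disjoint_iUnion (μ := m) (As := fun p : X => {p})
      (fun p => measurableSet_singleton p) (fun p q hpq => by simpa using hpq)
    exact this.mono fun p hp => pos_iff_ne_zero.2 hp
  have hEq : ∀ {B' : ℝ → X → ℝ} {a' : ℝ → ℝ}, Measurable (Function.uncurry B') → Measurable a' →
      MeasurableSet {p : ℝ × X × ℝ | p.2.2 = B' p.1 p.2.1 + a' p.1} := fun hB' ha' =>
    measurableSet_eq_fun (measurable_snd.comp measurable_snd)
      ((hB'.comp (measurable_fst.prodMk (measurable_fst.comp measurable_snd))).add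
        (ha'.comp measurable_fst))
  have h1 : ∀ᵐ r ∂(volume.restrict (Ioo 0 T)),
      ∀ᵐ γ : C(Icc (0 : ℝ) T, X) ∂(π : Measure C(Icc (0 : ℝ) T, X)),
        deriv (fun s => (f : X → ℝ) (IccExtend hT γ s)) r = B r (IccExtend hT γ r) + a r := by
    refine (ae_ae_deriv_eval_swap hT (continuous_lipB f)
      (P := fun r x d => d = B r x + a r) (hEq hB.1 ha)).1 ?_
    filter_upwards [hda] with γ hγ
    filter_upwards [hγ] with r hr
    exact hr.deriv
  have h2 : ∀ᵐ r ∂(volume.restrict (Ioo 0 T)), ∀ i,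
      ∀ᵐ γ : C(Icc (0 : ℝ) T, X) ∂(π : Measure C(Icc (0 : ℝ) T, X)),
        deriv (fun s => (g i : X → ℝ) (IccExtend hT γ s)) r
          = Bg i r (IccExtend hT γ r) + ag i r := by
    refine ae_all_iff.2 fun i => ?_
    refine (ae_ae_deriv_eval_swap hT (continuous_lipB (g i))
      (P := fun r x d => d = Bg i r x + ag i r) (hEq (hBg i).1 (hag i))).1 ?_
    filter_upwards [hdag i] with γ hγ
    filter_upwards [hγ] with r hr
    exact hr.deriv
  have hgone : ∀ i, EqOn (g i : X → ℝ) (f : X → ℝ) (Metric.ball (c i) (1 / ((i.2 : ℝ) + 1))) := by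
    intro i x hx
    simp only [g, mulLip_apply]
    rw [bump_eq_one (hρ i) (Metric.mem_ball.1 hx).le, mul_one]
  have hVo : ∀ i : ℕ × ℕ, IsOpen {x | 2 * (1 / ((i.2 : ℝ) + 1)) < dist x (c i)} := fun i =>
    isOpen_lt continuous_const (continuous_id.dist continuous_const)
  have hgzero : ∀ i : ℕ × ℕ, ∀ x ∈ {x | 2 * (1 / ((i.2 : ℝ) + 1)) < dist x (c i)},
      (g i : X → ℝ) x = 0 := by
    intro i x hx
    simp only [g, mulLip_apply]
    rw [bump_eq_zero (hρ i) (le_of_lt (mem_ofPred_eq ▸ hx :)), mul_zero]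
  have h3 : ∀ᵐ r ∂(volume.restrict (Ioo 0 T)), ∀ᵐ x ∂m, ∀ i : ℕ × ℕ,
      (x ∈ Metric.ball (c i) (1 / ((i.2 : ℝ) + 1)) → Bg i r x = B r x) ∧
      (2 * (1 / ((i.2 : ℝ) + 1)) < dist x (c i) → Bg i r x = 0) := by
    filter_upwards [hB.2, ae_all_iff.2 fun i => (hBg i).2] with r hr hr'
    obtain ⟨l, hl⟩ := (b r).locality
    refine ae_all_iff.2 fun i => ?_
    filter_upwards [hr, hr' i, hl.congr_of_eqOn hm (g i) f Metric.isOpen_ball (hgone i),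
      hl.eq_zero_of_eqOn hm (g i) (hVo i) (hgzero i)] with x a1 a2 a3 a4
    exact ⟨fun hx => by rw [a1, a2, a3 hx], fun hx => by rw [a2, a4 hx]⟩
  have h4 : ∀ᵐ r ∂(volume.restrict (Ioo 0 T)), ∀ p ∈ S,
      (∀ᵐ x ∂m, x = p → B r x = 0) ∧
      ∀ᵐ γ : C(Icc (0 : ℝ) T, X) ∂(π : Measure C(Icc (0 : ℝ) T, X)), IccExtend hT γ r = p →
        deriv (fun s => (f : X → ℝ) (IccExtend hT γ s)) r = 0 := by
    refine (ae_ball_iff hS).2 fun p _ => ?_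
    have hA : ∀ᵐ r ∂(volume.restrict (Ioo 0 T)),
        ∀ᵐ γ : C(Icc (0 : ℝ) T, X) ∂(π : Measure C(Icc (0 : ℝ) T, X)), IccExtend hT γ r = p →
          deriv (fun s => (f : X → ℝ) (IccExtend hT γ s)) r = 0 := by
      refine (ae_ae_deriv_eval_swap hT (continuous_lipB f)
        (P := fun _ x d => x = p → d = 0) ?_).1 ?_
      · exact MeasurableSet.imp
          ((measurable_fst.comp measurable_snd) (measurableSet_singleton p))
          ((measurable_snd.comp measurable_snd) (measurableSet_singleton 0))
      · exact Eventually.of_forall fun γ =>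
          ae_deriv_eq_zero_of_eq (w := fun s => (f : X → ℝ) (IccExtend hT γ s))
            (S := {r | IccExtend hT γ r = p}) (c := (f : X → ℝ) p)
            fun r hr => congrArg (f : X → ℝ) hr
    filter_upwards [hK.eq_zero_of_eq hm f p, hB.2, hA] with r hr hr' hr''
    refine ⟨?_, hr''⟩
    filter_upwards [hr, hr'] with x a1 a2 hx
    rw [a2, a1 hx]
  have hzero : ∀ᵐ r ∂(volume.restrict (Ioo 0 T)), a r = 0 := by
    filter_upwards [h1, h2, h3, h4] with r k1 k2 k3 k4
    by_contra hne
    let Good : C(Icc (0 : ℝ) T, X) → Prop := fun γ =>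
      deriv (fun s => (f : X → ℝ) (IccExtend hT γ s)) r = B r (IccExtend hT γ r) + a r ∧
      (∀ i, deriv (fun s => (g i : X → ℝ) (IccExtend hT γ s)) r
          = Bg i r (IccExtend hT γ r) + ag i r) ∧
      ∀ i : ℕ × ℕ, (IccExtend hT γ r ∈ Metric.ball (c i) (1 / ((i.2 : ℝ) + 1)) →
          Bg i r (IccExtend hT γ r) = B r (IccExtend hT γ r)) ∧
        (2 * (1 / ((i.2 : ℝ) + 1)) < dist (IccExtend hT γ r) (c i) →
          Bg i r (IccExtend hT γ r) = 0)
    have hGood : ∀ᵐ γ ∂(π : Measure C(Icc (0 : ℝ) T, X)), Good γ := by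
      filter_upwards [k1, ae_all_iff.2 k2, hC.ae_eval hT r k3] with γ a1 a2 a3
      exact ⟨a1, a2, a3⟩
    -- If two good curves were at different points, a separating cutoff of `f` would have defect `a
    -- r` read along the first and `0` read along the second, contrary to `a r ≠ 0`.
    have hsame : ∀ γ γ', Good γ → Good γ' → IccExtend hT γ r = IccExtend hT γ' r := by
      intro γ γ' hγ hγ'
      by_contra hne'
      obtain ⟨i, hi, hi'⟩ := exists_bump_separating hne'
      have e1 : deriv (fun s => (g i : X → ℝ) (IccExtend hT γ s)) r
          = deriv (fun s => (f : X → ℝ) (IccExtend hT γ s)) r := by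
        refine Filter.EventuallyEq.deriv_eq ?_
        filter_upwards [(continuous_IccExtend_coe hT γ).continuousAt.preimage_mem_nhds
          (Metric.isOpen_ball.mem_nhds (Metric.mem_ball.2 hi))] with s hs
        exact hgone i hs
      have e2 : deriv (fun s => (g i : X → ℝ) (IccExtend hT γ' s)) r = 0 := by
        have : (fun s => (g i : X → ℝ) (IccExtend hT γ' s)) =ᶠ[𝓝 r] fun _ => (0 : ℝ) := by
          filter_upwards [(continuous_IccExtend_coe hT γ').continuousAt.preimage_mem_nhds
            ((hVo i).mem_nhds hi')] with s hs
          exact hgzero i _ hs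
        rw [this.deriv_eq, deriv_const]
      have e3 := hγ.2.1 i
      have e4 := hγ'.2.1 i
      rw [e1, hγ.1, (hγ.2.2 i).1 (Metric.mem_ball.2 hi)] at e3
      rw [e2, (hγ'.2.2 i).2 hi'] at e4
      exact hne (by linarith)
    obtain ⟨γ₀, hγ₀⟩ := hGood.exists
    -- Almost all curves are at this point at time `r`, so the marginal charges it, and therefore so
    -- does `m`.
    have hpS : IccExtend hT γ₀ r ∈ S := by
      intro h0
      have hle := hC.map_le hT r {IccExtend hT γ₀ r}
      rw [Measure.smul_apply, h0, smul_zero, nonpos_iff_eq_zero,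
        Measure.map_apply (measurable_eval_const hT r) (measurableSet_singleton _)] at hle
      have hall : ∀ᵐ γ : C(Icc (0 : ℝ) T, X) ∂(π : Measure C(Icc (0 : ℝ) T, X)),
          ¬ IccExtend hT γ r = IccExtend hT γ₀ r := measure_eq_zero_iff_ae_notMem.1 hle
      obtain ⟨γ, hγ1, hγ2⟩ := (hall.and hGood).exists
      exact hγ1 (hsame γ γ₀ hγ2 hγ₀)
    -- At an atom both `b_r(f)` and the derivative along the curve vanish, leaving `a r = 0`.
    obtain ⟨kB, kd⟩ := k4 _ hpS
    obtain ⟨γ, hγ, hγB, hγd⟩ := (hGood.and ((hC.ae_eval hT r kB).and kd)).exists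
    have e := hsame γ γ₀ hγ hγ₀
    have := hγ.1
    rw [hγB e, hγd e] at this
    exact hne (by linarith)
  have hfin : ∀ᵐ γ : C(Icc (0 : ℝ) T, X) ∂(π : Measure C(Icc (0 : ℝ) T, X)),
      ∀ᵐ r ∂(volume.restrict (Ioo 0 T)),
        HasDerivAt (fun s => (f : X → ℝ) (IccExtend hT γ s)) (B r (IccExtend hT γ r)) r := by
    filter_upwards [hda] with γ hγ
    filter_upwards [hγ, hzero] with r hr hr0
    rwa [hr0, add_zero] at hr
  -- Measurability is what turns the statement curve by curve into one for the product measure.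
  have hmeas : MeasurableSet {p : ℝ × C(Icc (0 : ℝ) T, X) |
      HasDerivAt (fun s => (f : X → ℝ) (IccExtend hT p.2 s))
        (B p.1 (IccExtend hT p.2 p.1)) p.1} := by
    have hD := measurableSet_of_differentiableAt_with_param ℝ
      (f := fun (γ : C(Icc (0 : ℝ) T, X)) s => (f : X → ℝ) (IccExtend hT γ s))
      ((continuous_lipB f).comp ((continuous_IccExtend_eval hT).comp continuous_swap))
    have hE := measurableSet_eq_fun (measurable_deriv_eval (T := T) hT (continuous_lipB f))
      (measurable_eval_prod hT hB.1)
    refine ((measurable_swap hD).inter hE).congr ?_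
    ext p
    exact ⟨fun hp => HasDerivAt.congr_deriv (DifferentiableAt.hasDerivAt hp.1) hp.2, fun hp => ⟨HasDerivAt.differentiableAt hp, HasDerivAt.deriv hp⟩⟩
  refine (Measure.ae_prod_iff_ae_ae hmeas).2 ?_
  exact (Measure.ae_ae_comm (p := fun r (γ : C(Icc (0 : ℝ) T, X)) =>
    HasDerivAt (fun s => (f : X → ℝ) (IccExtend hT γ s)) (B r (IccExtend hT γ r)) r) hmeas).2 hfin

end NoDefect

end MetricFlow

/-! ### Assembly of the closure theorem -/

theorem mainTheorem7 {X : Type*} [MetricSpace X] [CompleteSpace X] [SecondCountableTopology X]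
    [MeasurableSpace X] [BorelSpace X] (T : ℝ) (hT : 0 < T)
    (m : Measure X) (mn : ℕ → Measure X)
    (hm : MetricFlow.FiniteOnBounded m) (hmn : ∀ n, MetricFlow.FiniteOnBounded (mn n))
    (hmm : MetricFlow.WeakTendsto mn m)
    (b : ℝ → MetricFlow.Der m) (bn : (n : ℕ) → ℝ → MetricFlow.Der (mn n))
    (hb : MetricFlow.IsBorelFamily T b) (hbn : ∀ n, MetricFlow.IsBorelFamily T (bn n))
    (π : ProbabilityMeasure C(Set.Icc (0 : ℝ) T, X))
    (πn : ℕ → ProbabilityMeasure C(Set.Icc (0 : ℝ) T, X))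
    (hflow : ∀ n, MetricFlow.IsRegularGeneralizedFlow hT.le (bn n) (πn n))
    -- uniform compression bound and weak convergence of the flows
    (hcomp : ∃ C : ℝ≥0, ∀ n, MetricFlow.CompressionLE (mn n) (πn n) C)
    (hπ : Tendsto πn atTop (𝓝 π))
    (hAC : ∀ᵐ γ ∂(π : Measure C(Set.Icc (0 : ℝ) T, X)), MetricFlow.IsAC γ)
    -- strong convergence of the derivations on a dense class
    (D : Set (MetricFlow.LipB X))
    (hD : ∀ f : MetricFlow.LipB X, ∃ F : ℕ → MetricFlow.LipB X,
      (∀ k, F k ∈ D) ∧ MetricFlow.FlatTendsto m F f)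
    (hconv : ∀ f ∈ D, ∀ (vn : ℕ → ℝ → X → ℝ≥0) (v : ℝ → X → ℝ≥0) (C : ℝ≥0),
      (∀ n, Measurable (Function.uncurry (vn n))) → Measurable (Function.uncurry v) →
      (∀ t ∈ Set.Ioo 0 T,
        (∀ n x, vn n t x ≤ C) ∧
        (∀ n, IsProbabilityMeasure ((mn n).withDensity fun x => (vn n t x : ℝ≥0∞))) ∧
        IsProbabilityMeasure (m.withDensity fun x => (v t x : ℝ≥0∞)) ∧
        MetricFlow.WeakTendsto (fun n => (mn n).withDensity fun x => (vn n t x : ℝ≥0∞))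
          (m.withDensity fun x => (v t x : ℝ≥0∞))) →
      Tendsto (fun n => ∫ t in Set.Ioo 0 T, ∫ x, (bn n t).toLin f x * vn n t x ∂(mn n)) atTop
        (𝓝 (∫ t in Set.Ioo 0 T, ∫ x, (b t).toLin f x * v t x ∂m)))
    -- integrability bounds
    (hint : ∀ f : MetricFlow.LipB X,
      ∫⁻ t in Set.Ioo 0 T, MetricFlow.l1PlusLinfNorm m ((b t).toLin f) < ∞)
    (hintn : ∀ f : MetricFlow.LipB X, ∃ C : ℝ≥0, ∀ n,
      ∫⁻ t in Set.Ioo 0 T, MetricFlow.l1PlusLinfNorm (mn n) ((bn n t).toLin f) ≤ C)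
    -- reflexivity, or local integrability of the divergence
    (hiv : MetricFlow.IsReflexiveH12 m ∨
      ∃ g : ℝ → X → ℝ, Measurable (Function.uncurry g) ∧
        (∀ᵐ t ∂(volume.restrict (Set.Ioo 0 T)), (b t).IsDivergence (g t)) ∧
        ∀ (x₀ : X) (R : ℝ), 0 < R →
          ∫⁻ t in Set.Ioo 0 T, ∫⁻ x in Metric.ball x₀ R, ‖g t x‖ₑ ∂m < ∞) :
    MetricFlow.IsRegularGeneralizedFlow hT.le b π := by
  -- A probability measure on curves forces the space to be nonempty.
  have hne : Nonempty X := by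
    obtain ⟨γ⟩ : Nonempty C(Set.Icc (0 : ℝ) T, X) := π.nonempty
    exact ⟨γ ⟨0, Set.left_mem_Icc.2 hT.le⟩⟩
  have := hm.isLocallyFinite
  have := fun n => (hmn n).isLocallyFinite
  have hK : MetricFlow.FlatConvexClosed T b := by
    refine MetricFlow.flatConvexClosed hm hb ?_
    rcases hiv with h | ⟨g, -, hg, -⟩
    · exact Or.inl h
    · exact Or.inr ⟨g, hg⟩
  obtain ⟨C, hCn⟩ := hcomp
  have hC := MetricFlow.CompressionLE.of_tendsto hT.le hm hmn hmm hπ hCn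
  have hDd : ∀ f ∈ D, MetricFlow.HasDeterministicDefect hT.le b π f := by
    intro f hf
    obtain ⟨B, hB⟩ := hb.2 f
    have hintn' : ∀ n, ∫⁻ t in Set.Ioo 0 T,
        MetricFlow.l1PlusLinfNorm (mn n) ((bn n t).toLin f) < ∞ := by
      obtain ⟨K, hK'⟩ := hintn f
      exact fun n => (hK' n).trans_lt ENNReal.coe_lt_top
    have hcf : MetricFlow.ConvergesAgainstDensities T bn b f := hconv f hf
    refine MetricFlow.HasDeterministicDefect.of_ae_defect_eq hT.le hAC hB
      (hC.ae_integrableOn_eval hT.le hB (hint f)) fun s t hs hst ht => ?_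
    exact hcf.ae_defect_eq hT.le hmn hbn hπ hflow hCn hC hB (hint f) hintn' hs hst ht
  refine ⟨⟨C, hC⟩, hAC, fun f _ B hB => ?_⟩
  -- Even for `f` with bounded support, removing the defect uses the cutoffs of `f`, which need not
  -- lie in `D`; hence the passage through all bounded Lipschitz functions.
  refine MetricFlow.ae_hasDerivAt_of_hasDeterministicDefect hT.le hm hb hK hC (fun f' => ?_) hB
  obtain ⟨F, hFD, hF⟩ := hD f'
  exact MetricFlow.HasDeterministicDefect.of_flatTendsto hT.le hC hb hK hAC hF
    fun k => hDd _ (hFD k)
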